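/- Let $q$ be a prime power and let $s,d,n,\ell$ be nonnegative integers with $n,\ell\ge 1$ and $n\le (q-1)/s$. Let $\gamma$ be a primitive element of $\mathbb F_q$ and let $a_1,\dots,a_n$ be distinct elements of $\{\gamma^{si} : 0\le i\le (q-1)/s-1\}$. The folded Reed–Solomon code $\mathrm{FRS}_{q,s}(n,d)\subseteq(\mathbb F_q^s)^n$ consists of the words $$\mathsf{FRSEnc}_s(P)=\Big(\big(P(a_i),P(\gamma a_i),\dots,P(\gamma^{s-1}a_i)\big)\Big)_{i=1}^n,\qquad P\in\mathbb F_q[X],\ \deg P\le d .$$ For $S=(S_1,\dots,S_n)$ with $S_i\subseteq\mathbb F_q^s$ and $|S_i|=\ell$, let $\mathrm{dist}(c,S)=|\{i : c_i\notin S_i\}|/n$. A code is $(\alpha,\ell,L)$-list-recoverable if for every such $S$ at most $L$ codewords $c$ satisfy $\mathrm{dist}(c,S)\le\alpha$. **Theorem.** There are an absolute constant $C$ and a single randomized algorithm $A$ such that the following holds for all $q,s,d,n,\ell,\gamma,a_1,\dots,a_n$ as above and all real $\varepsilon>0$ with $16\ell/\varepsilon^2\le s$. Put $$\alpha=1-\frac{d}{sn}-\varepsilon,\qquad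 L=\Big\lfloor (\ell/\varepsilon)^{C\cdot\frac1\varepsilon\log_2(\ell/\varepsilon)}\Big\rfloor .$$ 1. $\mathrm{FRS}_{q,s}(n,d)$ is $(\alpha,\ell,L)$-list-recoverable. In particular, the bound $L$ on the list size does not depend on $n$. 2. If $\alpha\ge 0$, then $A$ list-recovers $\mathrm{FRS}_{q,s}(n,d)$ with these parameters: given $q,s,d,n,\ell$, the number $\lfloor\alpha n\rfloor$ of coordinates that may be missed, $\gamma,a_1,\dots,a_n$, and any $S=(S_1,\dots,S_n)$ with $|S_i|=\ell$ (each $S_i$ listed in any order), every run of $A$ takes time at most $$C\cdot\Big(\log_2 q+s+d+n+(\ell/\varepsilon)^{\log_2(\ell/\varepsilon)/\varepsilon}\Big)^{C}$$ and outputs a list of at most $L$ polynomials of degree at most $d$; and with probability at least $0.99$ this list contains every $P\in\mathbb F_q[X]$ of degree at most $d$ with $\mathrm{dist}(\mathsf{FRSEnc}_s(P),S)\le\alpha$. Here an algorithm is a program, independent of the field and of the input, for a random access machine with memory for natural numbers and for elements of $\mathbb F_q$. It can draw uniformly random elements of $\{0,\dots,m\}$. Operations on natural numbers are charged their (schoolbook)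 bit cost, including the bit length of the addresses, and each operation in $\mathbb F_q$ is charged $(2+\lfloor\log_2 q\rfloor)^2$. -/

import Mathlib

noncomputable section

namespace FoldedRS

/-! ### Codes and list recovery -/

/-- The fraction of coordinates `i` with `c i ∉ S i`. -/
def distToLists {n : ℕ} {A : Type*} (c : Fin n → A) (S : Fin n → Finset A) : ℝ :=
  (Set.ncard {i : Fin n | c i ∉ S i} : ℝ) / n

/-- `(α, ℓ, L)`-list-recoverability: whenever each `S i` is a set of exactly `ℓ` symbols, at most
`L` codewords are at distance at most `α` from `S`. -/
def IsListRecoverable {n : ℕ} {A : Type*} (C : Set (Fin n → A)) (α : ℝ) (ℓ L : ℕ) : Prop :=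
  ∀ S : Fin n → Finset A, (∀ i, (S i).card = ℓ) →
    Set.encard {c | c ∈ C ∧ distToLists c S ≤ α} ≤ (L : ℕ∞)

/-- `γ` is a primitive element of the finite field `F`: a generator of its multiplicative group. -/
def IsPrimitiveElement {F : Type*} [Field F] (γ : F) : Prop :=
  IsPrimitiveRoot γ (Nat.card F - 1)

/-- The `a i` are distinct elements of `{γ ^ (s k) | 0 ≤ k ≤ (q - 1) / s - 1}`, `q = #F`. -/
def IsFoldedDomain {F : Type*} [Field F] (γ : F) (s : ℕ) {n : ℕ} (a : Fin n → F) : Prop :=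
  Function.Injective a ∧ ∀ i, ∃ k : ℕ, k < (Nat.card F - 1) / s ∧ a i = γ ^ (s * k)

/-- The folded Reed-Solomon encoding of a polynomial `P`: the coordinate with index `i` is the
vector `(P(a i), P(γ a i), …, P(γ ^ (s - 1) a i))`. -/
def frsEnc {F : Type*} [Field F] (γ : F) (s : ℕ) {n : ℕ} (a : Fin n → F)
    (P : Polynomial F) : Fin n → Fin s → F :=
  fun i j => P.eval (γ ^ (j : ℕ) * a i)

/-- The folded Reed-Solomon code: the encodings of all polynomials of degree at most `d`. -/
def frsCode {F : Type*} [Field F] (γ : F) (s d : ℕ) {n : ℕ} (a : Fin n → F) :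
    Set (Fin n → Fin s → F) :=
  {c | ∃ P : Polynomial F, P.natDegree ≤ d ∧ c = frsEnc γ s a P}

/-! ### A randomized random access machine over a finite field, with logarithmic cost

A program is a finite piece of text that is independent of the field and of the input. It works on
arrays of natural numbers and arrays of field elements. An array is named by a number
that is written in the program, its cells are addressed by computed natural numbers. The only
constants of the field are `0` and `1`; field elements can be added, subtracted, multiplied,
inverted and compared for equality. All loops are counting loops, whose number of rounds is fixed
when the loop is entered. Every operation is charged (an upper bound on, up to a constant factor) its
bit cost with schoolbook arithmetic, so the cost of a run is polynomially related to bit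
operations. -/

/-- Expressions of type natural number. `sub` is truncated and `div`, `mod` are Euclidean. -/
inductive NExpr : Type
  | const (c : ℕ) : NExpr
  | read (A : ℕ) (i : NExpr) : NExpr
  | add (x y : NExpr) : NExpr
  | sub (x y : NExpr) : NExpr
  | mul (x y : NExpr) : NExpr
  | div (x y : NExpr) : NExpr
  | mod (x y : NExpr) : NExpr

/-- Expressions of type field element; the inverse of `0` is `0`. -/
inductive FExpr : Type
  | zero : FExpr
  | one : FExpr
  | read (A : ℕ) (i : NExpr) : FExpr
  | add (x y : FExpr) : FExpr
  | sub (x y : FExpr) : FExpr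
  | mul (x y : FExpr) : FExpr
  | inv (x : FExpr) : FExpr

/-- Tests: `x ≤ y` for natural numbers, `x = y` for field elements. -/
inductive Test : Type
  | le (x y : NExpr) : Test
  | eq (x y : FExpr) : Test

/-- Programs. `setN A i e` and `setF A i e` write the value of `e` into cell `i` of array `A`;
`rand A i e` writes a uniformly random element of `{0, …, m}` there, where `m` is the value of `e`;
`loop e c` executes `c` as many times as the value of `e` says. -/
inductive Prog : Type
  | skip : Prog
  | setN (A : ℕ) (i e : NExpr) : Prog
  | setF (A : ℕ) (i : NExpr) (e : FExpr) : Prog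
  | rand (A : ℕ) (i e : NExpr) : Prog
  | seq (c₁ c₂ : Prog) : Prog
  | ite (t : Test) (c₁ c₂ : Prog) : Prog
  | loop (e : NExpr) (c : Prog) : Prog

/-- The state of the machine: the contents of the arrays of natural numbers and of field elements,
and the time spent so far (which programs cannot read). -/
structure State (F : Type*) where
  nat : ℕ → ℕ → ℕ
  fld : ℕ → ℕ → F
  time : ℕ

namespace State

variable {F : Type*}

/-- Let `t` units of time pass. -/
def tick (σ : State F) (t : ℕ) : State F := { σ with time := σ.time + t }

/-- Write `v` into cell `i` of the array `A` of natural numbers. -/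
def writeN (σ : State F) (A i v : ℕ) : State F :=
  { σ with nat := Function.update σ.nat A (Function.update (σ.nat A) i v) }

/-- Write `v` into cell `i` of the array `A` of field elements. -/
def writeF (σ : State F) (A i : ℕ) (v : F) : State F :=
  { σ with fld := Function.update σ.fld A (Function.update (σ.fld A) i v) }

end State

namespace NExpr

variable {F : Type*}

/-- The value of an expression in a state. -/
def eval (σ : State F) : NExpr → ℕ
  | const c => c
  | read A i => σ.nat A (i.eval σ)
  | add x y => x.eval σ + y.eval σ
  | sub x y => x.eval σ - y.eval σ
  | mul x y => x.eval σ * y.eval σ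
  | div x y => x.eval σ / y.eval σ
  | mod x y => x.eval σ % y.eval σ

/-- Charge for one arithmetic operation on two natural numbers. -/
def opCost (x y : ℕ) : ℕ := (1 + Nat.size x) * (1 + Nat.size y)

/-- The time needed to evaluate an expression. -/
def cost (σ : State F) : NExpr → ℕ
  | const c => 1 + Nat.size c
  | read A i => i.cost σ + 1 + Nat.size (i.eval σ) + Nat.size (σ.nat A (i.eval σ))
  | add x y => x.cost σ + y.cost σ + opCost (x.eval σ) (y.eval σ)
  | sub x y => x.cost σ + y.cost σ + opCost (x.eval σ) (y.eval σ)
  | mul x y => x.cost σ + y.cost σ + opCost (x.eval σ) (y.eval σ)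
  | div x y => x.cost σ + y.cost σ + opCost (x.eval σ) (y.eval σ)
  | mod x y => x.cost σ + y.cost σ + opCost (x.eval σ) (y.eval σ)

end NExpr

/-- Charge for one operation in the field `F` of `q` elements: `(1 + ⌊log₂ q⌋ + 1) ^ 2`. -/
def fieldOpCost (F : Type*) : ℕ := (1 + Nat.size (Nat.card F)) ^ 2

namespace FExpr

variable {F : Type*} [Field F]

/-- The value of an expression in a state. -/
def eval (σ : State F) : FExpr → F
  | zero => 0
  | one => 1
  | read A i => σ.fld A (i.eval σ)
  | add x y => x.eval σ + y.eval σ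
  | sub x y => x.eval σ - y.eval σ
  | mul x y => x.eval σ * y.eval σ
  | inv x => (x.eval σ)⁻¹

/-- The time needed to evaluate an expression. -/
def cost (σ : State F) : FExpr → ℕ
  | zero => fieldOpCost F
  | one => fieldOpCost F
  | read _ i => i.cost σ + 1 + Nat.size (i.eval σ) + fieldOpCost F
  | add x y => x.cost σ + y.cost σ + fieldOpCost F
  | sub x y => x.cost σ + y.cost σ + fieldOpCost F
  | mul x y => x.cost σ + y.cost σ + fieldOpCost F
  | inv x => x.cost σ + fieldOpCost F

end FExpr

namespace Test

variable {F : Type*} [Field F]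

/-- Whether a test succeeds in a state. -/
def Holds (σ : State F) : Test → Prop
  | le x y => x.eval σ ≤ y.eval σ
  | eq x y => x.eval σ = y.eval σ

/-- The time needed for a test. -/
def cost (σ : State F) : Test → ℕ
  | le x y => x.cost σ + y.cost σ + NExpr.opCost (x.eval σ) (y.eval σ)
  | eq x y => x.cost σ + y.cost σ + fieldOpCost F

end Test

namespace Prog

variable {F : Type*} [Field F]

open Classical in
/-- The probability distribution of the final state of a program that is started in a state. -/
def run : Prog → State F → PMF (State F)
  | skip, σ => PMF.pure (σ.tick 1)
  | setN A i e, σ =>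
      PMF.pure ((σ.writeN A (i.eval σ) (e.eval σ)).tick
        (i.cost σ + e.cost σ + 1 + Nat.size (i.eval σ) + Nat.size (e.eval σ)))
  | setF A i e, σ =>
      PMF.pure ((σ.writeF A (i.eval σ) (e.eval σ)).tick
        (i.cost σ + e.cost σ + 1 + Nat.size (i.eval σ) + fieldOpCost F))
  | rand A i e, σ =>
      (PMF.uniformOfFinset (Finset.range (e.eval σ + 1)) ⟨0, by simp⟩).map fun v =>
        (σ.writeN A (i.eval σ) v).tick
          (i.cost σ + e.cost σ + 1 + Nat.size (i.eval σ) + Nat.size (e.eval σ))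
  | seq c₁ c₂, σ => (run c₁ σ).bind fun σ' => run c₂ σ'
  | ite t c₁ c₂, σ =>
      if t.Holds σ then run c₁ (σ.tick (t.cost σ)) else run c₂ (σ.tick (t.cost σ))
  | loop e c, σ =>
      (fun μ : PMF (State F) => μ.bind fun σ' => run c (σ'.tick 1))^[e.eval σ]
        (PMF.pure (σ.tick (e.cost σ + 1)))

end Prog

/-! ### List recovery by a program -/

/-- The initial state. The array `0` of natural numbers holds `q, s, d, n, ℓ, e`, where `e` is the
number of coordinates that may be missed. The arrays `0`, `1`, `2` of field elements hold `γ`, the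
points `a 0, …, a (n - 1)`, and the input lists, where coordinate `k` of entry `j` of list
`i` is in cell `(i ℓ + j) s + k`. All other cells are `0`. -/
def inputState {F : Type*} [Field F] (γ : F) (s d ℓ e : ℕ) {n : ℕ} (a : Fin n → F)
    (y : Fin n → Fin ℓ → Fin s → F) : State F where
  nat A i := if A = 0 then [Nat.card F, s, d, n, ℓ, e].getD i 0 else 0
  fld A i :=
    if A = 0 then (if i = 0 then γ else 0)
    else if A = 1 then (if h : i < n then a ⟨i, h⟩ else 0)
    else if A = 2 then
      (if h : i < n * ℓ * s then
        y (Fin.divNat (Fin.divNat (⟨i, h⟩ : Fin (n * ℓ * s))))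
          (Fin.modNat (Fin.divNat (⟨i, h⟩ : Fin (n * ℓ * s))))
          (Fin.modNat (⟨i, h⟩ : Fin (n * ℓ * s)))
      else 0)
    else 0
  time := 0

/-- The length of the output list: cell `0` of the array `1` of natural numbers. -/
def outputLength {F : Type*} (σ : State F) : ℕ := σ.nat 1 0

/-- Entry `j` of the output list: the polynomial of degree at most `d` whose coefficient of `X ^ k`
is in cell `j (d + 1) + k` of the array `3` of field elements. -/
def outputPoly {F : Type*} [Field F] (d : ℕ) (σ : State F) (j : ℕ) : Polynomial F :=
  ∑ k ∈ Finset.range (d + 1), Polynomial.monomial k (σ.fld 3 (j * (d + 1) + k))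

/-- The program `p` list-recovers the folded Reed-Solomon code from a fraction `α` of errors with
input lists of size `ℓ`, output lists of size at most `L` and running time at most `T`: given any
`S` with `#(S i) = ℓ`, its elements listed in any order, every run takes time at most `T` and
outputs at most `L` polynomials of degree at most `d`, and with probability at least `0.99` all
polynomials of degree at most `d` whose encoding is at distance at most `α` from `S` are in the
output list. The real number `α` is given to the program as `⌊α n⌋`, the number of coordinates
that may be missed. -/
def ListRecovers {F : Type*} [Field F] (p : Prog) (γ : F) (s d : ℕ) {n : ℕ} (a : Fin n → F)
    (α : ℝ) (ℓ L : ℕ) (T : ℝ) : Prop :=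
  ∀ (S : Fin n → Finset (Fin s → F)) (y : (i : Fin n) → Fin ℓ ≃ {z // z ∈ S i}),
    let μ : PMF (State F) :=
      p.run (inputState γ s d ℓ ⌊α * n⌋₊ a fun i j => (y i j : Fin s → F))
    (∀ σ ∈ μ.support, (σ.time : ℝ) ≤ T ∧ outputLength σ ≤ L) ∧
    (99 / 100 : ENNReal) ≤ μ.toOuterMeasure
      {σ | ∀ P : Polynomial F, P.natDegree ≤ d → distToLists (frsEnc γ s a P) S ≤ α →
        ∃ j < outputLength σ, outputPoly d σ j = P}

/-- The list size `⌊(ℓ / ε) ^ (C (1 / ε) log₂ (ℓ / ε))⌋`. -/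
def listSize (C ℓ : ℕ) (ε : ℝ) : ℕ :=
  ⌊((ℓ : ℝ) / ε) ^ ((C : ℝ) * ((1 / ε) * Real.logb 2 (ℓ / ε)))⌋₊

/-- The time bound `C (log₂ q + s + d + n + (ℓ / ε) ^ (log₂ (ℓ / ε) / ε)) ^ C`. -/
def timeBound (C q s d n ℓ : ℕ) (ε : ℝ) : ℝ :=
  C * (Real.logb 2 q + s + d + n + ((ℓ : ℝ) / ε) ^ (Real.logb 2 (ℓ / ε) / ε)) ^ C

end FoldedRS

end

noncomputable section

namespace FoldedRS

universe u

set_option linter.unusedSectionVars false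

variable {F : Type u}

/-! ### Deterministic programs -/

/-! Write `E = s n - d - s e`, where `e` coordinates may be missed, so that `E ≥ ε s n`. The
argument combines linear-algebraic list decoding with a subspace design.

Linear counting gives a nonzero form `A₀ + A₁ Y₁ + … + A_m Y_m` with `m ≈ 4 ℓ / ε` and coefficients
of degree at most `D`. It vanishes on all windows of length `m` of all list entries
(`exists_interp`). If `P` misses at most `e` coordinates, substituting `P(X), P(γ X), …` gives a
polynomial of degree at most `D + d` with at least `(n - e) w` zeros, which is more than its degree.
So it is zero (`IsInterp.combine_eq_zero`). All solutions `P` therefore lie in a translate of one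
linear space of dimension at most `m` (`finrank_lt_of_dilation`).

Next, few coordinates single out a solution. Let `U` be a space of polynomials of degree at most `d`
and dimension `k ≤ s`. Its folded Wronskian is nonzero, has degree at most `d k`, and vanishes to
order `dim (U ⊓ vanishing γ s (a i))` at `s + 1 - k` points for each `i`. This gives
`sum_finrank_vanishing_le`. Iterated `t` times, it shows that at least half of the required `(n - e)
^ t` tuples of hit coordinates cut the solution space down to zero (`pow_le_two_mul_card_cut`). The
exponent is `t = O(log (ℓ / ε) / ε)`, because each `K = O(1 / ε)` coordinates halve the average
dimension.

So every `P` in the list owns at least `(n - e) ^ t / 2` of the `(n ℓ) ^ t` tuples of list entries: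
those that agree with `P` and determine it. Different `P` own disjoint sets (`Good.unique`), and the
list has at most `2 (n ℓ / (n - e)) ^ t ≤ 2 (ℓ / ε) ^ t` elements. The factor 2 is absorbed if `ℓ /
ε ≥ 2`. Otherwise `ℓ = 1`, `ε > 1 / 2`, and decoding is unique (`InList.eq_of_l_eq_one`).

The algorithm follows the same count. It interpolates and draws `Z (Z + 5)` random `t`-tuples of
list entries, where `Z` bounds both the list size and the inverse success probability of one tuple.
For each tuple it solves the linear system that a polynomial through these entries must satisfy
(`candidate_spec`). A candidate is stored only if it passes the exact test for membership in the
list and is new, so every run outputs a repetition-free part of the list. A union bound over the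
list gives completeness (`card_fail_le`).

Correctness is proved for the deterministic semantics `Prog.det`; the guesses are a uniform random
tape filled in one loop (`run_fill_tape`). The time bound is mostly syntactic. A tame program writes
only values that the memory bound `M` already covers, so it takes time at most a fixed power of `M`
(`run_tame`). Only the parameter assignments and the loop that computes `Z` need separate treatment.
The field size is never read, so it enters only through the cost of field operations. -/

@[simp] theorem State.tick_nat (σ : State F) (t : ℕ) : (σ.tick t).nat = σ.nat := rfl
@[simp] theorem State.tick_fld (σ : State F) (t : ℕ) : (σ.tick t).fld = σ.fld := rfl
@[simp] theorem State.tick_time (σ : State F) (t : ℕ) : (σ.tick t).time = σ.time + t := rfl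
@[simp] theorem State.writeN_nat (σ : State F) (A i v : ℕ) :
    (σ.writeN A i v).nat = Function.update σ.nat A (Function.update (σ.nat A) i v) := rfl
@[simp] theorem State.writeN_fld (σ : State F) (A i v : ℕ) : (σ.writeN A i v).fld = σ.fld := rfl
@[simp] theorem State.writeN_time (σ : State F) (A i v : ℕ) : (σ.writeN A i v).time = σ.time := rfl
@[simp] theorem State.writeF_nat (σ : State F) (A i : ℕ) (v : F) : (σ.writeF A i v).nat = σ.nat :=
  rfl
@[simp] theorem State.writeF_fld (σ : State F) (A i : ℕ) (v : F) :
    (σ.writeF A i v).fld = Function.update σ.fld A (Function.update (σ.fld A) i v) := rfl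
@[simp] theorem State.writeF_time (σ : State F) (A i : ℕ) (v : F) :
    (σ.writeF A i v).time = σ.time := rfl

theorem NExpr.eval_congr {σ τ : State F} (h : σ.nat = τ.nat) (e : NExpr) :
    e.eval σ = e.eval τ := by
  induction e with
  | const c => rfl
  | read A i ih => simp [NExpr.eval, ih, h]
  | _ x y hx hy => simp [NExpr.eval, hx, hy]

@[simp] theorem NExpr.eval_tick (σ : State F) (t : ℕ) (e : NExpr) :
    e.eval (σ.tick t) = e.eval σ :=
  NExpr.eval_congr (σ := σ.tick t) (τ := σ) rfl e

@[simp] theorem NExpr.eval_writeF (σ : State F) (A i : ℕ) (v : F) (e : NExpr) :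
    e.eval (σ.writeF A i v) = e.eval σ :=
  NExpr.eval_congr (σ := σ.writeF A i v) (τ := σ) rfl e

variable [Field F]

theorem FExpr.eval_congr {σ τ : State F} (h : σ.nat = τ.nat) (hf : σ.fld = τ.fld) (e : FExpr) :
    e.eval σ = e.eval τ := by
  induction e with
  | zero => rfl
  | one => rfl
  | read A i => simp [FExpr.eval, NExpr.eval_congr h, hf]
  | inv x hx => simp [FExpr.eval, hx]
  | _ x y hx hy => simp [FExpr.eval, hx, hy]

@[simp] theorem FExpr.eval_tick (σ : State F) (t : ℕ) (e : FExpr) :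
    e.eval (σ.tick t) = e.eval σ :=
  FExpr.eval_congr (σ := σ.tick t) (τ := σ) rfl rfl e

@[simp] theorem Test.holds_tick (σ : State F) (t : ℕ) (e : Test) :
    e.Holds (σ.tick t) ↔ e.Holds σ := by
  cases e <;> simp [Test.Holds]

namespace Prog

open Classical in
/-- The final state of a program without random choices. -/
def det : Prog → State F → State F
  | skip, σ => σ.tick 1
  | setN A i e, σ => (σ.writeN A (i.eval σ) (e.eval σ)).tick
        (i.cost σ + e.cost σ + 1 + Nat.size (i.eval σ) + Nat.size (e.eval σ))
  | setF A i e, σ => (σ.writeF A (i.eval σ) (e.eval σ)).tick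
        (i.cost σ + e.cost σ + 1 + Nat.size (i.eval σ) + fieldOpCost F)
  -- A default value: `run_eq_pure` concerns only programs without `rand`.
  | rand _ _ _, σ => σ
  | seq c₁ c₂, σ => det c₂ (det c₁ σ)
  | ite t c₁ c₂, σ =>
      if t.Holds σ then det c₁ (σ.tick (t.cost σ)) else det c₂ (σ.tick (t.cost σ))
  | loop e c, σ => (fun σ' => det c (σ'.tick 1))^[e.eval σ] (σ.tick (e.cost σ + 1))

/-- The program makes no random choices. -/
def noRand : Prog → Bool
  | rand _ _ _ => false
  | seq c₁ c₂ => noRand c₁ && noRand c₂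
  | ite _ c₁ c₂ => noRand c₁ && noRand c₂
  | loop _ c => noRand c
  | _ => true

/-- Point masses are preserved by every construct except `rand`. This reduces all correctness
statements to functions on states. -/
theorem run_eq_pure (c : Prog) (h : c.noRand = true) (σ : State F) :
    c.run σ = PMF.pure (c.det σ) := by
  induction c generalizing σ with
  | skip => rfl
  | setN => rfl
  | setF => rfl
  | rand => simp [noRand] at h
  | seq c₁ c₂ h₁ h₂ =>
    simp only [noRand, Bool.and_eq_true] at h
    simp only [run, det, h₁ h.1, PMF.pure_bind, h₂ h.2]
  | ite t c₁ c₂ h₁ h₂ =>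
    simp only [noRand, Bool.and_eq_true] at h
    simp only [run, det]
    split_ifs
    · exact h₁ h.1 _
    · exact h₂ h.2 _
  | loop e c hc =>
    simp only [noRand] at h
    simp only [run, det]
    generalize σ.tick (e.cost σ + 1) = τ
    induction e.eval σ with
    | zero => rfl
    | succ k ih =>
      rw [Function.iterate_succ_apply', Function.iterate_succ_apply', ih, PMF.pure_bind, hc h]

/-- The arrays of natural numbers that a program may write to. -/
def writesN : Prog → List ℕ
  | setN A _ _ => [A]
  | rand A _ _ => [A]
  | seq c₁ c₂ => writesN c₁ ++ writesN c₂
  | ite _ c₁ c₂ => writesN c₁ ++ writesN c₂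
  | loop _ c => writesN c
  | _ => []

/-- The arrays of field elements that a program may write to. -/
def writesF : Prog → List ℕ
  | setF A _ _ => [A]
  | seq c₁ c₂ => writesF c₁ ++ writesF c₂
  | ite _ c₁ c₂ => writesF c₁ ++ writesF c₂
  | loop _ c => writesF c
  | _ => []

theorem det_nat_of_notMem (c : Prog) {A : ℕ} (h : A ∉ c.writesN) (σ : State F) :
    (c.det σ).nat A = σ.nat A := by
  induction c generalizing σ with
  | skip => rfl
  | setN B i e =>
    simp only [writesN, List.mem_singleton] at h
    simp [det, Function.update_of_ne h]
  | setF => rfl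
  | rand => rfl
  | seq c₁ c₂ h₁ h₂ =>
    simp only [writesN, List.mem_append, not_or] at h
    simp only [det, h₁ h.1, h₂ h.2]
  | ite t c₁ c₂ h₁ h₂ =>
    simp only [writesN, List.mem_append, not_or] at h
    simp only [det]
    split_ifs
    · simp [h₁ h.1]
    · simp [h₂ h.2]
  | loop e c hc =>
    simp only [writesN] at h
    simp only [det]
    rw [show σ.nat A = (σ.tick (e.cost σ + 1)).nat A from rfl]
    generalize σ.tick (e.cost σ + 1) = τ
    induction e.eval σ with
    | zero => rfl
    | succ k ih => rw [Function.iterate_succ_apply', hc h, State.tick_nat, ih]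

theorem det_fld_of_notMem (c : Prog) {A : ℕ} (h : A ∉ c.writesF) (σ : State F) :
    (c.det σ).fld A = σ.fld A := by
  induction c generalizing σ with
  | skip => rfl
  | setN => rfl
  | setF B i e =>
    simp only [writesF, List.mem_singleton] at h
    simp [det, Function.update_of_ne h]
  | rand => rfl
  | seq c₁ c₂ h₁ h₂ =>
    simp only [writesF, List.mem_append, not_or] at h
    simp only [det, h₁ h.1, h₂ h.2]
  | ite t c₁ c₂ h₁ h₂ =>
    simp only [writesF, List.mem_append, not_or] at h
    simp only [det]
    split_ifs
    · simp [h₁ h.1]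
    · simp [h₂ h.2]
  | loop e c hc =>
    simp only [writesF] at h
    simp only [det]
    rw [show σ.fld A = (σ.tick (e.cost σ + 1)).fld A from rfl]
    generalize σ.tick (e.cost σ + 1) = τ
    induction e.eval σ with
    | zero => rfl
    | succ k ih => rw [Function.iterate_succ_apply', hc h, State.tick_fld, ih]

end Prog

/-- Cell `0` of an array of natural numbers, used as a variable. -/
def NExpr.var (A : ℕ) : NExpr := .read A (.const 0)

/-- Cell `0` of an array of field elements, used as a variable. -/
def FExpr.var (A : ℕ) : FExpr := .read A (.const 0)

@[simp] theorem NExpr.eval_var (σ : State F) (A : ℕ) : (NExpr.var A).eval σ = σ.nat A 0 := rfl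
@[simp] theorem FExpr.eval_var (σ : State F) (A : ℕ) : (FExpr.var A).eval σ = σ.fld A 0 := rfl

namespace Prog

/-- Assign to a variable of type natural number. -/
def letN (A : ℕ) (e : NExpr) : Prog := setN A (.const 0) e

/-- Assign to a variable of type field element. -/
def letF (A : ℕ) (e : FExpr) : Prog := setF A (.const 0) e

/-- Increase the variable `v`, which stays at most the value of the variable `x`. -/
def incr (v x : ℕ) : Prog :=
  -- The reduction changes nothing while the counter is below the value of `x`. It makes the bound
  -- on the counter visible in the syntax, for `NExpr.small`.
  letN v (.mod (.add (.var v) (.const 1)) (.add (.var x) (.const 1)))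

/-- Execute `c` for `v = 0, …, x - 1`. -/
def for' (v x : ℕ) (c : Prog) : Prog :=
  seq (letN v (.const 0)) (loop (.var x) (seq c (incr v x)))

@[simp] theorem writesN_letN (A e) : (letN A e).writesN = [A] := rfl
@[simp] theorem writesF_letN (A e) : (letN A e).writesF = [] := rfl
@[simp] theorem writesN_letF (A e) : (letF A e).writesN = [] := rfl
@[simp] theorem writesF_letF (A e) : (letF A e).writesF = [A] := rfl
@[simp] theorem writesN_incr (v x) : (incr v x).writesN = [v] := rfl
@[simp] theorem writesF_incr (v x) : (incr v x).writesF = [] := rfl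
@[simp] theorem writesN_for' (v x c) : (for' v x c).writesN = v :: (c.writesN ++ [v]) := rfl
@[simp] theorem writesF_for' (v x c) : (for' v x c).writesF = c.writesF ++ [] := rfl

@[simp] theorem det_letN_nat (A : ℕ) (e : NExpr) (σ : State F) :
    ((letN A e).det σ).nat = Function.update σ.nat A (Function.update (σ.nat A) 0 (e.eval σ)) :=
  rfl
@[simp] theorem det_letN_fld (A : ℕ) (e : NExpr) (σ : State F) :
    ((letN A e).det σ).fld = σ.fld := rfl
@[simp] theorem det_letF_fld (A : ℕ) (e : FExpr) (σ : State F) :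
    ((letF A e).det σ).fld = Function.update σ.fld A (Function.update (σ.fld A) 0 (e.eval σ)) :=
  rfl
@[simp] theorem det_letF_nat (A : ℕ) (e : FExpr) (σ : State F) :
    ((letF A e).det σ).nat = σ.nat := rfl
@[simp] theorem det_setF_fld (A : ℕ) (i : NExpr) (e : FExpr) (σ : State F) :
    ((setF A i e).det σ).fld =
      Function.update σ.fld A (Function.update (σ.fld A) (i.eval σ) (e.eval σ)) := rfl
@[simp] theorem det_setF_nat (A : ℕ) (i : NExpr) (e : FExpr) (σ : State F) :
    ((setF A i e).det σ).nat = σ.nat := rfl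
@[simp] theorem det_incr_fld (v x : ℕ) (σ : State F) : ((incr v x).det σ).fld = σ.fld := rfl
@[simp] theorem det_incr_nat (v x : ℕ) (σ : State F) :
    ((incr v x).det σ).nat =
      Function.update σ.nat v (Function.update (σ.nat v) 0 ((σ.nat v 0 + 1) % (σ.nat x 0 + 1))) :=
  rfl
@[simp] theorem det_seq (c₁ c₂ : Prog) (σ : State F) : (seq c₁ c₂).det σ = c₂.det (c₁.det σ) := rfl
@[simp] theorem det_skip_nat (σ : State F) : (skip.det σ).nat = σ.nat := rfl
@[simp] theorem det_skip_fld (σ : State F) : (skip.det σ).fld = σ.fld := rfl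

/-- The invariant rule for counting loops. -/
theorem for'_rule (I : ℕ → State F → Prop) (v x : ℕ) (c : Prog) (σ : State F)
    (hI : ∀ k τ τ', τ.fld = τ'.fld → (∀ A, A ≠ v → τ.nat A = τ'.nat A) → I k τ → I k τ')
    (hv : v ∉ c.writesN) (hx : x ∉ c.writesN) (hvx : x ≠ v)
    (h0 : I 0 σ)
    (step : ∀ k < σ.nat x 0, ∀ τ : State F, τ.nat v 0 = k →
      (∀ A, A ≠ v → A ∉ c.writesN → τ.nat A = σ.nat A) →
      (∀ A, A ∉ c.writesF → τ.fld A = σ.fld A) → I k τ → I (k + 1) (c.det τ)) :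
    I (σ.nat x 0) ((for' v x c).det σ) := by
  -- Besides the invariant, the induction carries what the loop body may assume: the counter is the
  -- number of rounds, and arrays outside the write sets are unchanged.
  have key : ∀ k ≤ σ.nat x 0, ∀ τ : State F,
      τ = (fun σ' => (seq c (incr v x)).det (σ'.tick 1))^[k]
        (((letN v (.const 0)).det σ).tick
          ((NExpr.var x).cost ((letN v (.const 0)).det σ) + 1)) →
      τ.nat v 0 = k ∧ (∀ A, A ≠ v → A ∉ c.writesN → τ.nat A = σ.nat A) ∧
      (∀ A, A ∉ c.writesF → τ.fld A = σ.fld A) ∧ I k τ := by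
    intro k
    induction k with
    | zero =>
      rintro - τ rfl
      refine ⟨by simp [NExpr.eval], fun A hA _ => by simp [hA], fun A _ => rfl, ?_⟩
      exact hI _ σ _ rfl (fun A hA => by simp [hA]) h0
    | succ k ih =>
      rintro hk τ rfl
      rw [Function.iterate_succ_apply']
      obtain ⟨h1, h2, h3, h4⟩ := ih (by omega) _ rfl
      set τ := (fun σ' => (seq c (incr v x)).det (σ'.tick 1))^[k]
        (((letN v (.const 0)).det σ).tick
          ((NExpr.var x).cost ((letN v (.const 0)).det σ) + 1))
      have hvv : (c.det (τ.tick 1)).nat v = τ.nat v := det_nat_of_notMem _ hv _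
      have hxx : (c.det (τ.tick 1)).nat x 0 = σ.nat x 0 := by
        rw [det_nat_of_notMem _ hx, State.tick_nat, h2 x hvx hx]
      refine ⟨?_, ?_, ?_, ?_⟩
      · simp only [det_seq, det_incr_nat, Function.update_self, hvv, h1, hxx]
        exact Nat.mod_eq_of_lt (by omega)
      · intro A hA hA'
        simp only [det_seq, det_incr_nat, Function.update_of_ne hA]
        rw [det_nat_of_notMem _ hA', State.tick_nat, h2 A hA hA']
      · intro A hA
        simp only [det_seq, det_incr_fld]
        rw [det_fld_of_notMem _ hA, State.tick_fld, h3 A hA]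
      · refine hI _ (c.det (τ.tick 1)) _ rfl (fun A hA => by simp [hA]) ?_
        exact step k (by omega) (τ.tick 1) h1 h2 h3 (hI _ τ _ rfl (fun A _ => rfl) h4)
  have hfor : (for' v x c).det σ = (fun σ' => (seq c (incr v x)).det (σ'.tick 1))^[σ.nat x 0]
        (((letN v (.const 0)).det σ).tick
          ((NExpr.var x).cost ((letN v (.const 0)).det σ) + 1)) := by
    rw [← show (NExpr.var x).eval ((letN v (.const 0)).det σ) = σ.nat x 0 by simp [hvx]]
    rfl
  exact (key _ le_rfl _ hfor).2.2.2

/-- The invariant rule for counting loops, with an invariant on the arrays of field elements. -/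
theorem for'_rule_fld (I : ℕ → (ℕ → ℕ → F) → Prop) (v x : ℕ) (c : Prog) (σ : State F)
    (hv : v ∉ c.writesN) (hx : x ∉ c.writesN) (hvx : x ≠ v) (h0 : I 0 σ.fld)
    (step : ∀ k < σ.nat x 0, ∀ τ : State F, τ.nat v 0 = k →
      (∀ A, A ≠ v → A ∉ c.writesN → τ.nat A = σ.nat A) →
      (∀ A, A ∉ c.writesF → τ.fld A = σ.fld A) → I k τ.fld → I (k + 1) (c.det τ).fld) :
    I (σ.nat x 0) ((for' v x c).det σ).fld :=
  for'_rule (fun k τ => I k τ.fld) v x c σ (fun _ _ _ h _ hk => h ▸ hk) hv hx hvx h0 step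

end Prog
end FoldedRS
end

noncomputable section

namespace FoldedRS

universe u

set_option linter.unusedSectionVars false

/-! ### Static bounds for the running time -/

namespace NExpr

/-- The expression does not read cell `0` of the array `0`, which holds the size of the field. -/
def safe : NExpr → Bool
  | const _ => true
  | read A i => (A != 0 || (match i with | const (_ + 1) => true | _ => false)) && safe i
  | add x y => safe x && safe y
  | sub x y => safe x && safe y
  | mul x y => safe x && safe y
  | div x y => safe x && safe y
  | mod x y => safe x && safe y

/-- A sufficient condition for the value of a safe expression not to exceed the contents of the
memory. -/
def small : NExpr → Bool
  | const c => c ≤ 1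
  | read _ _ => true
  | sub x _ => small x
  | div x _ => small x
  | mod _ (add y (const 1)) => small y
  | _ => false

/-- The degree of a polynomial bound for the value and the cost of an expression. -/
def wt : NExpr → ℕ
  | const c => c + 1
  | read _ i => wt i + 2
  | add x y => wt x + wt y + 2
  | sub x y => wt x + wt y + 2
  | mul x y => wt x + wt y + 2
  | div x y => wt x + wt y + 2
  | mod x y => wt x + wt y + 2

theorem wt_pos (e : NExpr) : 0 < e.wt := by cases e <;> simp [wt]

end NExpr

/-- All cells of the memory for natural numbers except the size of the field are at most
`M - 2`. -/
def State.Bdd {F : Type u} (σ : State F) (M : ℕ) : Prop :=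
  3 ≤ M ∧ ∀ A i, ¬(A = 0 ∧ i = 0) → σ.nat A i + 2 ≤ M

theorem State.Bdd.mono {F : Type u} {σ : State F} {M M' : ℕ} (h : σ.Bdd M) (hM : M ≤ M') :
    σ.Bdd M' := ⟨h.1.trans hM, fun A i hA => (h.2 A i hA).trans hM⟩

theorem natSize_le_self (n : ℕ) : Nat.size n ≤ n := Nat.size_le.2 Nat.lt_two_pow_self

variable {F : Type u}

theorem pow_add_two_ge {M a b : ℕ} (hM : 2 ≤ M) (ha : 0 < a) (hb : 0 < b) :
    M ^ a + M ^ b + 2 * M ^ (a + b) ≤ M ^ (a + b + 2) ∧ M ^ a ≤ M ^ (a + b) ∧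
      M ^ b ≤ M ^ (a + b) ∧ M ≤ M ^ a ∧ M ≤ M ^ b := by
  have h1 : M ^ a ≤ M ^ (a + b) := Nat.pow_le_pow_right (by omega) (by omega)
  have h2 : M ^ b ≤ M ^ (a + b) := Nat.pow_le_pow_right (by omega) (by omega)
  have h3 : M ≤ M ^ a := Nat.le_self_pow (by omega) M
  have h4 : M ≤ M ^ b := Nat.le_self_pow (by omega) M
  refine ⟨?_, h1, h2, h3, h4⟩
  have : M ^ (a + b) * 4 ≤ M ^ (a + b + 2) := by
    rw [pow_add M (a + b) 2]
    exact Nat.mul_le_mul_left _ (by nlinarith)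
  omega

theorem NExpr.read_le {σ : State F} {M : ℕ} (h : σ.Bdd M) (A : ℕ) (i : NExpr)
    (he : (NExpr.read A i).safe = true) : σ.nat A (i.eval σ) + 2 ≤ M := by
  refine h.2 _ _ ?_
  rintro ⟨rfl, h0⟩
  cases i with
  | const c => cases c <;> simp_all [safe, eval]
  | _ => simp_all [safe]

/-- Small expressions are bounded by a readable cell or by `1`, so storing them preserves the same
bound `M`. This is why the memory bound does not grow inside loops. -/
theorem NExpr.eval_le {σ : State F} {M : ℕ} (h : σ.Bdd M) (e : NExpr) (he : e.safe = true)
    (hs : e.small = true) : e.eval σ + 2 ≤ M := by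
  have h2 := h.1
  fun_induction NExpr.small e with
  | case1 c =>
    simp only [decide_eq_true_eq] at hs
    simp only [eval]
    omega
  | case2 A i => exact read_le h A i he
  | case3 x y ih =>
    simp only [safe, Bool.and_eq_true] at he
    have := ih he.1 hs
    simp only [eval]
    omega
  | case4 x y ih =>
    simp only [safe, Bool.and_eq_true] at he
    have := ih he.1 hs
    have := Nat.div_le_self (x.eval σ) (y.eval σ)
    simp only [eval]
    omega
  | case5 x y ih =>
    simp only [safe, Bool.and_eq_true] at he
    have := ih he.2.1 hs
    have := Nat.mod_lt (x.eval σ) (Nat.succ_pos (y.eval σ))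
    simp only [eval]
    simp only [Nat.succ_eq_add_one] at this
    omega
  | case6 => simp at hs

/-- With bounds for the operands plus one, the result and the schoolbook charge are both covered by
the product of the bounds. Exponents therefore add; the extra `2` in `wt` pays for sums of costs, as
`M ≥ 3`. -/
theorem NExpr.eval_lt_pow {σ : State F} {M : ℕ} (h : σ.Bdd M) (e : NExpr) (he : e.safe = true) :
    e.eval σ + 1 ≤ M ^ e.wt ∧ e.cost σ + 1 ≤ M ^ e.wt := by
  have h3 := h.1
  have hconst : ∀ c : ℕ, c + 2 ≤ M ^ (c + 1) := fun c =>
    calc c + 2 ≤ 2 ^ (c + 1) := Nat.lt_two_pow_self (n := c + 1)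
      _ ≤ M ^ (c + 1) := Nat.pow_le_pow_left (by omega) _
  have hop : ∀ {x y X Y : ℕ}, x + 1 ≤ X → y + 1 ≤ Y → opCost x y ≤ X * Y := by
    intro x y X Y hx hy
    have := natSize_le_self x
    have := natSize_le_self y
    exact Nat.mul_le_mul (by omega) (by omega)
  have hadd : ∀ {x y X Y : ℕ}, x + 1 ≤ X → y + 1 ≤ Y → x + y + 1 ≤ X * Y := by
    intro x y X Y hx hy
    exact le_trans (by nlinarith [Nat.zero_le (x * y)]) (Nat.mul_le_mul hx hy)
  have hmul : ∀ {x y X Y : ℕ}, x + 1 ≤ X → y + 1 ≤ Y → x * y + 1 ≤ X * Y := by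
    intro x y X Y hx hy
    exact le_trans (by nlinarith [Nat.zero_le (x * y)]) (Nat.mul_le_mul hx hy)
  induction e with
  | const c =>
    have := natSize_le_self c
    have := hconst c
    simp only [eval, cost, wt]
    omega
  | read A i ih =>
    have hr := read_le h A i he
    simp only [safe, Bool.and_eq_true] at he
    obtain ⟨h1, h2⟩ := ih he.2
    have := natSize_le_self (i.eval σ)
    have := natSize_le_self (σ.nat A (i.eval σ))
    have h4 : M ≤ M ^ i.wt := Nat.le_self_pow (wt_pos i).ne' M
    have h5 : M ^ i.wt * 9 ≤ M ^ (i.wt + 2) := by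
      rw [pow_add]
      exact Nat.mul_le_mul_left _ (by nlinarith)
    simp only [eval, cost, wt]
    omega
  | _ x y hx hy =>
    simp only [safe, Bool.and_eq_true] at he
    obtain ⟨h1, h2⟩ := hx he.1
    obtain ⟨h4, h5⟩ := hy he.2
    obtain ⟨g1, g2, g3, g4, g5⟩ := pow_add_two_ge (M := M) (by omega) (wt_pos x) (wt_pos y)
    have k1 := hop h1 h4
    have k2 := hadd h1 h4
    have k3 := hmul h1 h4
    have k4 := Nat.div_le_self (x.eval σ) (y.eval σ)
    have k5 := Nat.mod_le (x.eval σ) (y.eval σ)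
    rw [← pow_add] at k1 k2 k3
    simp only [eval, cost, wt]
    omega

namespace FExpr

/-- All indices are safe expressions. -/
def safe : FExpr → Bool
  | zero => true
  | one => true
  | read _ i => i.safe
  | add x y => safe x && safe y
  | sub x y => safe x && safe y
  | mul x y => safe x && safe y
  | inv x => safe x

/-- The degree of a polynomial bound for the cost of an expression. -/
def wt : FExpr → ℕ
  | zero => 1
  | one => 1
  | read _ i => i.wt + 2
  | add x y => wt x + wt y + 2
  | sub x y => wt x + wt y + 2
  | mul x y => wt x + wt y + 2
  | inv x => wt x + 2

theorem wt_pos (e : FExpr) : 0 < e.wt := by cases e <;> simp [wt]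

variable [Field F]

theorem cost_lt_pow {σ : State F} {M : ℕ} (h : σ.Bdd M) (hf : fieldOpCost F + 1 ≤ M) (e : FExpr)
    (he : e.safe = true) : e.cost σ + 1 ≤ M ^ e.wt := by
  have h3 := h.1
  have h9 : ∀ a, M ^ a * 9 ≤ M ^ (a + 2) := fun a => by
    rw [pow_add]
    exact Nat.mul_le_mul_left _ (by nlinarith)
  induction e with
  | zero => simpa [cost, wt]
  | one => simpa [cost, wt]
  | read A i =>
    obtain ⟨h1, h2⟩ := NExpr.eval_lt_pow h i he
    have h4 : M ≤ M ^ i.wt := Nat.le_self_pow (NExpr.wt_pos i).ne' M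
    have := natSize_le_self (i.eval σ)
    have := h9 i.wt
    simp only [cost, wt]
    omega
  | inv x hx =>
    have h1 := hx he
    have h4 : M ≤ M ^ x.wt := Nat.le_self_pow (wt_pos x).ne' M
    have := h9 x.wt
    simp only [cost, wt]
    omega
  | _ x y hx hy =>
    simp only [safe, Bool.and_eq_true] at he
    have h1 := hx he.1
    have h2 := hy he.2
    obtain ⟨g1, g2, g3, g4, g5⟩ := pow_add_two_ge (M := M) (by omega) (wt_pos x) (wt_pos y)
    simp only [cost, wt]
    omega

end FExpr

namespace Test

/-- All expressions are safe. -/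
def safe : Test → Bool
  | le x y => x.safe && y.safe
  | eq x y => x.safe && y.safe

/-- The degree of a polynomial bound for the cost of a test. -/
def wt : Test → ℕ
  | le x y => x.wt + y.wt + 2
  | eq x y => x.wt + y.wt + 2

theorem wt_pos (e : Test) : 0 < e.wt := by cases e <;> simp [wt]

variable [Field F]

theorem cost_lt_pow {σ : State F} {M : ℕ} (h : σ.Bdd M) (hf : fieldOpCost F + 1 ≤ M) (e : Test)
    (he : e.safe = true) : e.cost σ + 1 ≤ M ^ e.wt := by
  have h3 := h.1
  cases e with
  | le x y =>
    simp only [safe, Bool.and_eq_true] at he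
    obtain ⟨h1, h2⟩ := NExpr.eval_lt_pow h x he.1
    obtain ⟨h4, h5⟩ := NExpr.eval_lt_pow h y he.2
    obtain ⟨g1, g2, g3, g4, g5⟩ :=
      pow_add_two_ge (M := M) (by omega) (NExpr.wt_pos x) (NExpr.wt_pos y)
    have := natSize_le_self (x.eval σ)
    have := natSize_le_self (y.eval σ)
    have k1 : NExpr.opCost (x.eval σ) (y.eval σ) ≤ M ^ x.wt * M ^ y.wt :=
      Nat.mul_le_mul (by omega) (by omega)
    rw [← pow_add] at k1
    simp only [cost, wt]
    omega
  | eq x y =>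
    simp only [safe, Bool.and_eq_true] at he
    have h1 := FExpr.cost_lt_pow h hf x he.1
    have h2 := FExpr.cost_lt_pow h hf y he.2
    obtain ⟨g1, g2, g3, g4, g5⟩ :=
      pow_add_two_ge (M := M) (by omega) (FExpr.wt_pos x) (FExpr.wt_pos y)
    simp only [cost, wt]
    omega

end Test

namespace Prog

/-- A syntactic condition that keeps the memory bounded. -/
def tame : Prog → Bool
  | skip => true
  | setN A i e => A != 0 && i.safe && e.safe && e.small
  | setF _ i e => i.safe && e.safe
  | rand A i e => A != 0 && i.safe && e.safe && e.small
  | seq c₁ c₂ => tame c₁ && tame c₂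
  | ite t c₁ c₂ => t.safe && tame c₁ && tame c₂
  | loop e c => e.safe && e.small && tame c

/-- The degree of a polynomial bound for the running time of a tame program. -/
def wt : Prog → ℕ
  | skip => 1
  | setN _ i e => i.wt + e.wt + 2
  | setF _ i e => i.wt + e.wt + 2
  | rand _ i e => i.wt + e.wt + 2
  | seq c₁ c₂ => wt c₁ + wt c₂
  | ite t c₁ c₂ => t.wt + wt c₁ + wt c₂
  | loop e c => e.wt + wt c + 3

theorem wt_pos (c : Prog) : 0 < c.wt := by
  induction c <;> simp_all [wt]

variable [Field F]

/-- On states whose memory is bounded by `M`, the program takes time less than `M ^ κ` and leaves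
a memory bounded by `M ^ κ`. -/
def PolyBounded (F : Type u) [Field F] (c : Prog) (κ : ℕ) : Prop :=
  ∀ (σ : State F) (M : ℕ), σ.Bdd M → fieldOpCost F + 1 ≤ M →
    ∀ σ' ∈ (c.run σ).support, σ'.Bdd (M ^ κ) ∧ σ'.time + 1 ≤ σ.time + M ^ κ

theorem Bdd.writeN {σ : State F} {M A : ℕ} (h : σ.Bdd M) (i : ℕ) {v : ℕ} (hv : v + 2 ≤ M) :
    (σ.writeN A i v).Bdd M := by
  refine ⟨h.1, fun B j hB => ?_⟩
  have := h.2 B j hB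
  simp only [State.writeN_nat]
  by_cases h1 : B = A
  · subst h1
    by_cases h2 : j = i
    · subst h2
      simpa using hv
    · simpa [h2] using this
  · simpa [h1] using this

/-- The same `M` bounds the memory after every step, and numbers of rounds are small expressions, so
a loop costs at most `M` times the bound for its body plus overhead. The exponent depends on the
text of the program alone. -/
theorem run_tame {c : Prog} (hc : c.tame = true) {M : ℕ} (hf : fieldOpCost F + 1 ≤ M)
    (σ : State F) (h : σ.Bdd M) :
    ∀ σ' ∈ (c.run σ).support, σ'.Bdd M ∧ σ'.time + 1 ≤ σ.time + M ^ c.wt := by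
  have h3 := h.1
  induction c generalizing σ with
  | skip =>
    simp only [run, PMF.support_pure, Set.mem_singleton_iff, forall_eq]
    exact ⟨h, by simp [wt]; omega⟩
  | setN A i e =>
    simp only [tame, Bool.and_eq_true] at hc
    simp only [run, PMF.support_pure, Set.mem_singleton_iff, forall_eq]
    refine ⟨Bdd.writeN h _ (NExpr.eval_le h e hc.1.2 hc.2), ?_⟩
    obtain ⟨h1, h2⟩ := NExpr.eval_lt_pow h i hc.1.1.2
    obtain ⟨h4, h5⟩ := NExpr.eval_lt_pow h e hc.1.2
    obtain ⟨g1, g2, g3, g4, g5⟩ :=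
      pow_add_two_ge (M := M) (by omega) (NExpr.wt_pos i) (NExpr.wt_pos e)
    have := natSize_le_self (i.eval σ)
    have := natSize_le_self (e.eval σ)
    simp only [wt, State.tick_time, State.writeN_time]
    omega
  | setF A i e =>
    simp only [tame, Bool.and_eq_true] at hc
    simp only [run, PMF.support_pure, Set.mem_singleton_iff, forall_eq]
    refine ⟨h, ?_⟩
    obtain ⟨h1, h2⟩ := NExpr.eval_lt_pow h i hc.1
    have h5 := FExpr.cost_lt_pow h hf e hc.2
    obtain ⟨g1, g2, g3, g4, g5⟩ :=
      pow_add_two_ge (M := M) (by omega) (NExpr.wt_pos i) (FExpr.wt_pos e)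
    have := natSize_le_self (i.eval σ)
    simp only [wt, State.tick_time, State.writeF_time]
    omega
  | rand A i e =>
    simp only [tame, Bool.and_eq_true] at hc
    simp only [run, PMF.support_map, Set.mem_image, forall_exists_index, and_imp]
    rintro _ v hv rfl
    replace hv := Finset.mem_range.1 ((PMF.mem_support_uniformOfFinset_iff _ _).1 hv)
    have hle := NExpr.eval_le h e hc.1.2 hc.2
    refine ⟨Bdd.writeN h _ (by omega), ?_⟩
    obtain ⟨h1, h2⟩ := NExpr.eval_lt_pow h i hc.1.1.2
    obtain ⟨h4, h5⟩ := NExpr.eval_lt_pow h e hc.1.2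
    obtain ⟨g1, g2, g3, g4, g5⟩ :=
      pow_add_two_ge (M := M) (by omega) (NExpr.wt_pos i) (NExpr.wt_pos e)
    have := natSize_le_self (i.eval σ)
    have := natSize_le_self (e.eval σ)
    simp only [wt, State.tick_time, State.writeN_time]
    omega
  | seq c₁ c₂ h₁ h₂ =>
    simp only [tame, Bool.and_eq_true] at hc
    intro σ' hσ'
    simp only [run, PMF.mem_support_bind_iff] at hσ'
    obtain ⟨τ, hτ, hσ'⟩ := hσ'
    obtain ⟨a1, a2⟩ := h₁ hc.1 σ h τ hτ
    obtain ⟨b1, b2⟩ := h₂ hc.2 τ a1 σ' hσ'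
    obtain ⟨g1, g2, g3, g4, g5⟩ :=
      pow_add_two_ge (M := M) (by omega) (wt_pos c₁) (wt_pos c₂)
    refine ⟨b1, ?_⟩
    simp only [wt]
    rw [pow_add]
    have : M ^ c₁.wt + M ^ c₂.wt ≤ M ^ c₁.wt * M ^ c₂.wt := Nat.add_le_mul (by omega) (by omega)
    omega
  | ite t c₁ c₂ h₁ h₂ =>
    simp only [tame, Bool.and_eq_true] at hc
    intro σ' hσ'
    simp only [run] at hσ'
    have ht := Test.cost_lt_pow h hf t hc.1.1
    have k1 : M ≤ M ^ t.wt := Nat.le_self_pow (Test.wt_pos t).ne' M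
    have k2 : M ≤ M ^ c₁.wt := Nat.le_self_pow (wt_pos c₁).ne' M
    have k3 : M ≤ M ^ c₂.wt := Nat.le_self_pow (wt_pos c₂).ne' M
    have e1 : M ^ t.wt + M ^ c₁.wt ≤ M ^ t.wt * M ^ c₁.wt := Nat.add_le_mul (by omega) (by omega)
    have e2 : M ^ t.wt * M ^ c₁.wt + M ^ c₂.wt ≤ M ^ t.wt * M ^ c₁.wt * M ^ c₂.wt :=
      Nat.add_le_mul (by nlinarith) (by omega)
    simp only [wt, pow_add]
    split_ifs at hσ'
    · obtain ⟨a1, a2⟩ := h₁ hc.1.2 (σ.tick (t.cost σ)) h σ' hσ'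
      refine ⟨a1, ?_⟩
      rw [State.tick_time] at a2
      omega
    · obtain ⟨a1, a2⟩ := h₂ hc.2 (σ.tick (t.cost σ)) h σ' hσ'
      refine ⟨a1, ?_⟩
      rw [State.tick_time] at a2
      omega
  | loop e c ih =>
    simp only [tame, Bool.and_eq_true] at hc
    intro σ' hσ'
    simp only [run] at hσ'
    have key : ∀ k, ∀ σ' ∈ ((fun μ : PMF (State F) => μ.bind fun σ' => run c (σ'.tick 1))^[k]
        (PMF.pure (σ.tick (e.cost σ + 1)))).support,
        σ'.Bdd M ∧ σ'.time ≤ σ.time + e.cost σ + 1 + k * M ^ c.wt := by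
      intro k
      induction k with
      | zero =>
        simp only [Function.iterate_zero, id, PMF.support_pure, Set.mem_singleton_iff, forall_eq]
        exact ⟨h, by simp [add_assoc]⟩
      | succ k ihk =>
        intro σ' hσ'
        rw [Function.iterate_succ_apply', PMF.mem_support_bind_iff] at hσ'
        obtain ⟨τ, hτ, hσ'⟩ := hσ'
        obtain ⟨a1, a2⟩ := ihk τ hτ
        obtain ⟨b1, b2⟩ := ih hc.2 (τ.tick 1) a1 σ' hσ'
        refine ⟨b1, ?_⟩
        rw [State.tick_time] at b2
        rw [add_one_mul]
        omega
    obtain ⟨a1, a2⟩ := key _ σ' hσ'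
    refine ⟨a1, ?_⟩
    have hle := NExpr.eval_le h e hc.1.1 hc.1.2
    obtain ⟨h1, h2⟩ := NExpr.eval_lt_pow h e hc.1.1
    have k1 : e.eval σ * M ^ c.wt ≤ M * M ^ c.wt := Nat.mul_le_mul_right _ (by omega)
    rw [← pow_succ'] at k1
    obtain ⟨g1, g2, g3, g4, g5⟩ :=
      pow_add_two_ge (M := M) (by omega) (NExpr.wt_pos e) (Nat.succ_pos c.wt)
    have e1 : M ≤ M ^ (c.wt + 1) := Nat.le_self_pow (by omega) M
    simp only [wt]
    simp only [Nat.succ_eq_add_one] at g1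
    rw [show e.wt + c.wt + 3 = e.wt + (c.wt + 1) + 2 by ring]
    have : 0 < M ^ (e.wt + (c.wt + 1)) := by positivity
    omega

theorem polyBounded_of_tame {c : Prog} (hc : c.tame = true) : PolyBounded F c c.wt :=
  fun σ _ h hf σ' hσ' =>
    ⟨(run_tame hc hf σ h σ' hσ').1.mono (Nat.le_self_pow (wt_pos c).ne' _),
      (run_tame hc hf σ h σ' hσ').2⟩

theorem polyBounded_letN {A : ℕ} {e : NExpr} (he : e.safe = true) :
    PolyBounded F (letN A e) (e.wt + 3) := by
  intro σ M h hf
  have h3 := h.1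
  simp only [letN, run, PMF.support_pure, Set.mem_singleton_iff, forall_eq]
  obtain ⟨h4, h5⟩ := NExpr.eval_lt_pow h e he
  have g1 : M ≤ M ^ e.wt := Nat.le_self_pow (NExpr.wt_pos e).ne' M
  have := natSize_le_self (e.eval σ)
  have h9 : M ^ e.wt * 27 ≤ M ^ (e.wt + 3) := by
    rw [pow_add]
    exact Nat.mul_le_mul_left _ (Nat.pow_le_pow_left h3 3)
  refine ⟨Bdd.writeN (h.mono (Nat.le_self_pow (by omega) _)) _ (by omega), ?_⟩
  simp only [State.tick_time, State.writeN_time, NExpr.cost, NExpr.eval, Nat.size_zero]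
  omega

/-- The first program may enlarge the memory bound to a power of `M`, which is the bound that the
second one sees. So exponents multiply here, whereas they add for tame programs. -/
theorem PolyBounded.seq {c₁ c₂ : Prog} {κ₁ κ₂ : ℕ} (h₁ : PolyBounded F c₁ κ₁)
    (h₂ : PolyBounded F c₂ κ₂) : PolyBounded F (seq c₁ c₂) ((κ₁ + 1) * (κ₂ + 1) * 2) := by
  intro σ M h hf σ' hσ'
  have h3 := h.1
  simp only [run, PMF.mem_support_bind_iff] at hσ'
  obtain ⟨τ, hτ, hσ'⟩ := hσ'
  obtain ⟨a1, a2⟩ := h₁ σ M h hf τ hτ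
  have hp : M ^ κ₁ ≤ M ^ (κ₁ + 1) := Nat.pow_le_pow_right (by omega) (by omega)
  have hM : M ≤ M ^ (κ₁ + 1) := Nat.le_self_pow (by omega) M
  -- The exponent `κ₁ + 1` keeps the new bound at least `M`, hence above the cost of a field
  -- operation, even for `κ₁ = 0`.
  obtain ⟨b1, b2⟩ := h₂ τ (M ^ (κ₁ + 1)) (a1.mono hp) (hf.trans hM) σ' hσ'
  rw [← pow_mul] at b1 b2
  refine ⟨b1.mono (Nat.pow_le_pow_right (by omega) (by nlinarith)), ?_⟩
  have e1 : M ^ κ₁ ≤ M ^ ((κ₁ + 1) * (κ₂ + 1)) := Nat.pow_le_pow_right (by omega) (by nlinarith)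
  have e2 : M ^ ((κ₁ + 1) * κ₂) ≤ M ^ ((κ₁ + 1) * (κ₂ + 1)) :=
    Nat.pow_le_pow_right (by omega) (by nlinarith)
  have e3 : M ≤ M ^ ((κ₁ + 1) * (κ₂ + 1)) := Nat.le_self_pow (by positivity) M
  rw [pow_mul]
  nlinarith

end Prog

end FoldedRS
end

noncomputable section

namespace FoldedRS

universe u

set_option linter.unusedSectionVars false

/-! ### The random tape -/

/-- A tuple splits in exactly one way into an initial part and a last entry, so its weight is the
product of the two uniform weights. -/
theorem bind_map_snoc_uniform (k M : ℕ) [NeZero M] :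
    (PMF.uniformOfFintype (Fin k → Fin M)).bind
      (fun ω => (PMF.uniformOfFintype (Fin M)).map fun v => (Fin.snoc ω v : Fin (k + 1) → Fin M)) =
      PMF.uniformOfFintype (Fin (k + 1) → Fin M) := by
  ext ω'
  obtain ⟨ω, v, rfl⟩ : ∃ (ω : Fin k → Fin M) (v : Fin M), ω' = Fin.snoc ω v :=
    ⟨Fin.init ω', ω' (Fin.last k), (Fin.snoc_init_self ω').symm⟩
  simp only [PMF.bind_apply, PMF.map_apply, PMF.uniformOfFintype_apply, tsum_fintype]
  rw [Finset.sum_eq_single ω, Finset.sum_eq_single v]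
  · simp only [if_true, Fintype.card_fun, Fintype.card_fin, Nat.cast_pow]
    rw [ENNReal.inv_pow, ENNReal.inv_pow, pow_succ]
  · intro w _ hw
    rw [if_neg]
    exact fun h => hw (Fin.snoc_injective2 h).2.symm
  · simp
  · intro w _ hw
    rw [Finset.sum_eq_zero, mul_zero]
    intro w' _
    rw [if_neg]
    exact fun h => hw (Fin.snoc_injective2 h).1.symm
  · simp

theorem uniformOfFinset_range (N : ℕ) (h : (Finset.range (N + 1)).Nonempty) :
    PMF.uniformOfFinset (Finset.range (N + 1)) h =
      (PMF.uniformOfFintype (Fin (N + 1))).map Fin.val := by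
  ext w
  simp only [PMF.uniformOfFinset_apply, PMF.map_apply, PMF.uniformOfFintype_apply, tsum_fintype,
    Finset.mem_range, Finset.card_range, Fintype.card_fin]
  split_ifs with hw
  · rw [Finset.sum_eq_single ⟨w, hw⟩]
    · simp
    · intro b _ hb
      rw [if_neg]
      exact fun h => hb (Fin.ext h.symm)
    · simp
  · rw [Finset.sum_eq_zero]
    intro v _
    rw [if_neg]
    rintro rfl
    exact hw v.2

variable {F : Type u} [Field F]

namespace Prog

theorem run_rand_eq (T : ℕ) (i e : NExpr) (σ : State F) (N : ℕ) (h : e.eval σ = N) :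
    run (rand T i e) σ = (PMF.uniformOfFintype (Fin (N + 1))).map fun w : Fin (N + 1) =>
      (σ.writeN T (i.eval σ) (w : ℕ)).tick
        (i.cost σ + e.cost σ + 1 + Nat.size (i.eval σ) + Nat.size (e.eval σ)) := by
  subst h
  exact (congrArg (PMF.map _) (uniformOfFinset_range _ _)).trans (PMF.map_comp _ _ _)

/-- This isolates the randomness: the run is the image of a uniformly random tape under a function,
and probabilities become numbers of tapes. -/
theorem run_fill_tape (T v x y : ℕ) (hTv : T ≠ v) (hTx : T ≠ x) (hTy : T ≠ y) (hvx : v ≠ x)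
    (hvy : v ≠ y) (σ : State F) :
    ∃ f : (Fin (σ.nat x 0) → Fin (σ.nat y 0 + 1)) → State F,
      (for' v x (rand T (.var v) (.var y))).run σ = (PMF.uniformOfFintype _).map f ∧
      ∀ ω, (f ω).fld = σ.fld ∧ (∀ A, A ≠ v → A ≠ T → (f ω).nat A = σ.nat A) ∧
        ∀ i : Fin _, (f ω).nat T i = ω i := by
  have key : ∀ k ≤ σ.nat x 0, ∃ f : (Fin k → Fin (σ.nat y 0 + 1)) → State F,
      (fun μ : PMF (State F) => μ.bind fun σ' =>
        run (seq (rand T (.var v) (.var y)) (incr v x)) (σ'.tick 1))^[k]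
        (PMF.pure (((letN v (.const 0)).det σ).tick
          ((NExpr.var x).cost ((letN v (.const 0)).det σ) + 1))) =
        (PMF.uniformOfFintype _).map f ∧
      ∀ ω, (f ω).fld = σ.fld ∧ (∀ A, A ≠ v → A ≠ T → (f ω).nat A = σ.nat A) ∧
        (∀ i : Fin k, (f ω).nat T i = ω i) ∧ (f ω).nat v 0 = k := by
    intro k
    induction k with
    | zero =>
      intro _
      refine ⟨fun _ => ((letN v (.const 0)).det σ).tick
          ((NExpr.var x).cost ((letN v (.const 0)).det σ) + 1), ?_, fun ω => ⟨rfl, ?_, ?_, ?_⟩⟩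
      · rw [Function.iterate_zero, id]
        exact (PMF.map_const _ _).symm
      · intro A hA _
        simp [hA]
      · exact fun i => i.elim0
      · simp [NExpr.eval]
    | succ k ih =>
      intro hk
      obtain ⟨f, hf, hω⟩ := ih (by omega)
      let g : State F → ℕ → State F := fun σ' w => (incr v x).det
        (((σ'.tick 1).writeN T ((NExpr.var v).eval (σ'.tick 1)) w).tick
          ((NExpr.var v).cost (σ'.tick 1) + (NExpr.var y).cost (σ'.tick 1) + 1 +
            Nat.size ((NExpr.var v).eval (σ'.tick 1)) + Nat.size ((NExpr.var y).eval (σ'.tick 1))))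
      refine ⟨fun ω => g (f (Fin.init ω)) (ω (Fin.last k)), ?_, ?_⟩
      · rw [Function.iterate_succ_apply', hf, ← bind_map_snoc_uniform, PMF.map_bind, PMF.bind_map]
        congr 1
        funext ω
        have hy : (NExpr.var y).eval ((f ω).tick 1) = σ.nat y 0 := by
          simp [(hω ω).2.1 y hvy.symm hTy.symm]
        have hr := run_rand_eq T (.var v) (.var y) ((f ω).tick 1) _ hy
        rw [Function.comp_apply, run, hr, PMF.bind_map, PMF.map_comp]
        simp only [Function.comp_def, run_eq_pure (incr v x) rfl]
        refine (PMF.bind_pure_comp (fun w : Fin _ => g (f ω) w) _).trans ?_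
        simp
      · intro ω
        obtain ⟨h1, h2, h3, h4⟩ := hω (Fin.init ω)
        refine ⟨?_, ?_, ?_, ?_⟩
        · simp [g, h1]
        · intro A hA hA'
          simp [g, hA, hA', h2]
        · intro i
          refine Fin.lastCases ?_ (fun i => ?_) i
          · simp [g, hTv, h4]
          · have := h3 i
            simp only [g, det_incr_nat, State.tick_nat, State.writeN_nat, NExpr.eval_var, h4,
              Function.update_of_ne hTv, Function.update_self, Fin.val_castSucc]
            rw [Function.update_of_ne (by have := i.2; omega), this]
            rfl
        · have hx := h2 x hvx.symm hTx.symm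
          simp [g, hTv.symm, hTx.symm, hx, h4]
          omega
  obtain ⟨f, hf, hω⟩ := key _ le_rfl
  refine ⟨f, ?_, fun ω => ⟨(hω ω).1, (hω ω).2.1, (hω ω).2.2.1⟩⟩
  rw [← hf]
  have hx : (NExpr.var x).eval ((letN v (.const 0)).det σ) = σ.nat x 0 := by simp [hvx.symm]
  rw [← hx, for', run, run_eq_pure _ rfl, PMF.pure_bind, run]

end Prog

end FoldedRS
end

noncomputable section

namespace FoldedRS

universe u

set_option linter.unusedSectionVars false

open Polynomial Module

variable {F : Type u} [Field F]

/-! ### Spaces of polynomials -/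

/-- A nontrivial linear equation with polynomial coefficients between the dilations of a polynomial
has a solution space of small dimension. -/
theorem finrank_lt_of_dilation {m d : ℕ} {γ : F}
    (hγ : Set.InjOn (fun k : ℕ => γ ^ k) (Set.Iic d)) (A : Fin m → F[X]) (hA : A ≠ 0)
    (U : Submodule F F[X])
    (hU : ∀ P ∈ U, P.natDegree ≤ d ∧ ∑ j, A j * P.comp (C (γ ^ (j : ℕ)) * X) = 0) :
    finrank F U < m := by
  classical
  have hex : ∃ b, ∃ j, (A j).coeff b ≠ 0 := by
    by_contra! h
    exact hA (funext fun j => Polynomial.ext fun b => by simp [h b j])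
  -- `b` is the lowest degree in which some `A j` has a nonzero coefficient.
  set b := Nat.find hex with hb
  obtain ⟨j₀, hj₀⟩ := Nat.find_spec hex
  have hlow : ∀ k < b, ∀ j, (A j).coeff k = 0 := fun k hk j => by
    by_contra h
    exact Nat.find_min hex hk ⟨j, h⟩
  -- If `k` is the lowest degree of a solution `P`, the coefficient of `X ^ (b + k)` in the equation
  -- is `P.coeff k * B.eval (γ ^ k)`. So `γ ^ k` is a root of `B`, which has fewer than `m` roots.
  let B : F[X] := ∑ j : Fin m, C ((A j).coeff b) * X ^ (j : ℕ)
  have hBc : ∀ j : Fin m, B.coeff j = (A j).coeff b := by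
    intro j
    simp only [B, finsetSum_coeff, coeff_C_mul, coeff_X_pow]
    rw [Finset.sum_eq_single j]
    · simp
    · intro i _ hi
      rw [if_neg (fun h => hi (Fin.ext h.symm)), mul_zero]
    · simp
  have hB0 : B ≠ 0 := fun h => hj₀ (by rw [← hb, ← hBc, h, coeff_zero])
  have hBd : B.natDegree < m := by
    have hm : 0 < m := j₀.pos
    refine (Nat.lt_iff_le_pred hm).2 (natDegree_sum_le_of_forall_le _ _ fun j _ => ?_)
    exact (natDegree_C_mul_X_pow_le _ _).trans (Nat.le_pred_of_lt j.2)
  let R : Finset ℕ := (Finset.range (d + 1)).filter fun k => B.eval (γ ^ k) = 0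
  have hR : R.card < m := by
    refine lt_of_le_of_lt ?_ hBd
    refine le_trans ?_ (B.card_roots')
    refine le_trans ?_ (Multiset.toFinset_card_le _)
    refine Finset.card_le_card_of_injOn (fun k => γ ^ k) ?_ ?_
    · intro k hk
      simp only [R, Finset.coe_filter, Set.mem_ofPred_eq] at hk
      simp [hB0, hk.2]
    · intro k hk l hl h
      simp only [R, Finset.coe_filter, Finset.mem_range, Set.mem_ofPred_eq] at hk hl
      exact hγ (Nat.lt_succ_iff.1 hk.1) (Nat.lt_succ_iff.1 hl.1) h
  -- A nonzero solution has its lowest term at an index in `R`, so the coefficients at `R` determine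
  -- a solution.
  let f : U →ₗ[F] (R → F) := LinearMap.pi fun k => (lcoeff F (k : ℕ)).comp U.subtype
  have hf : Function.Injective f := by
    rw [← LinearMap.ker_eq_bot, LinearMap.ker_eq_bot']
    rintro ⟨P, hP⟩ h0
    obtain ⟨hPd, hPe⟩ := hU P hP
    rw [Submodule.mk_eq_zero]
    by_contra hP0
    set k := P.natTrailingDegree with hk
    have hkd : k ≤ d := (natTrailingDegree_le_natDegree P).trans hPd
    have hPk : P.coeff k ≠ 0 := by
      rw [hk, ← trailingCoeff]
      exact trailingCoeff_nonzero_iff_nonzero.2 hP0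
    have hkR : B.eval (γ ^ k) ≠ 0 := by
      intro hB
      have hmem : k ∈ R := by simp [R, hB]; omega
      exact hPk (congrFun h0 ⟨k, hmem⟩)
    have hc := congrArg (fun Q => Q.coeff (b + k)) hPe
    simp only [finsetSum_coeff, coeff_zero] at hc
    have hterm : ∀ j : Fin m, (A j * P.comp (C (γ ^ (j : ℕ)) * X)).coeff (b + k) =
        P.coeff k * ((A j).coeff b * (γ ^ k) ^ (j : ℕ)) := by
      intro j
      rw [coeff_mul, Finset.sum_eq_single (b, k)]
      · rw [comp_C_mul_X_coeff, ← pow_mul, ← pow_mul, mul_comm k]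
        ring
      · rintro ⟨x, y⟩ hxy hne
        replace hxy : x + y = b + k := Finset.HasAntidiagonal.mem_antidiagonal.1 hxy
        simp only
        rcases lt_or_ge x b with hx | hx
        · rw [hlow x hx, zero_mul]
        · have hy : y < k := by
            rcases eq_or_lt_of_le hx with h | h
            · exact absurd (Prod.ext h.symm (by simp only; omega)) hne
            · omega
          rw [comp_C_mul_X_coeff, coeff_eq_zero_of_lt_natTrailingDegree hy, zero_mul, mul_zero]
      · simp
    rw [Finset.sum_congr rfl fun j _ => hterm j, ← Finset.mul_sum] at hc
    refine (mul_ne_zero hPk hkR) ?_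
    simpa [B, eval_finsetSum] using hc
  calc finrank F U ≤ finrank F (R → F) := LinearMap.finrank_le_finrank_of_injective hf
    _ = R.card := by simp
    _ < m := hR

/-- The polynomials that vanish at `x, γ x, …, γ ^ (s - 1) x`. -/
def vanishing (γ : F) (s : ℕ) (x : F) : Submodule F F[X] where
  carrier := {P | ∀ j < s, P.eval (γ ^ j * x) = 0}
  add_mem' hP hQ j hj := by simp [hP j hj, hQ j hj]
  zero_mem' j _ := by simp
  smul_mem' c P hP j hj := by simp [hP j hj]

/-- Each term of the Leibniz expansion takes one factor from every column in `T`. -/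
theorem pow_card_dvd_det {R n : Type*} [CommRing R] [DecidableEq n] [Fintype n]
    (M : Matrix n n R) (p : R) (T : Finset n) (h : ∀ l ∈ T, ∀ j, p ∣ M j l) :
    p ^ T.card ∣ M.det := by
  rw [Matrix.det_apply]
  refine Finset.dvd_sum fun σ _ => ?_
  rw [Units.smul_def, zsmul_eq_mul]
  refine Dvd.dvd.mul_left ?_ _
  calc p ^ T.card = ∏ l, if l ∈ T then p else 1 := by simp [Finset.prod_ite_mem]
    _ ∣ ∏ l, M (σ l) l := Finset.prod_dvd_prod_of_dvd _ _ fun l _ => by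
        split_ifs with hl
        · exact h l hl _
        · exact one_dvd _

/-- The folded Wronskian of a family of polynomials. -/
def foldedWronskian (γ : F) {k : ℕ} (b : Fin k → F[X]) : Matrix (Fin k) (Fin k) F[X] :=
  Matrix.of fun j l => (b l).comp (C (γ ^ (j : ℕ)) * X)

/-- A zero determinant yields a nontrivial polynomial relation between the rows. This is a dilation
equation with `k` terms that holds on the whole `k`-dimensional span, against
`finrank_lt_of_dilation`. -/
theorem det_foldedWronskian_ne_zero {d k : ℕ} {γ : F}
    (hγ : Set.InjOn (fun k : ℕ => γ ^ k) (Set.Iic d)) (b : Fin k → F[X])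
    (hb : LinearIndependent F b) (hd : ∀ l, (b l).natDegree ≤ d) :
    (foldedWronskian γ b).det ≠ 0 := by
  intro h0
  obtain ⟨A, hA, hAM⟩ := Matrix.exists_vecMul_eq_zero_iff.2 h0
  have hlt := finrank_lt_of_dilation hγ A hA (Submodule.span F (Set.range b)) ?_
  · rw [finrank_span_eq_card hb, Fintype.card_fin] at hlt
    exact lt_irrefl _ hlt
  · intro P hP
    induction hP using Submodule.span_induction with
    | mem P hP =>
      obtain ⟨l, rfl⟩ := hP
      exact ⟨hd l, congrFun hAM l⟩
    | zero => simp
    | add P Q _ _ hP hQ =>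
      refine ⟨natDegree_add_le_of_degree_le hP.1 hQ.1, ?_⟩
      simp only [add_comp, mul_add, Finset.sum_add_distrib, hP.2, hQ.2, add_zero]
    | smul c P _ hP =>
      refine ⟨(natDegree_smul_le c P).trans hP.1, ?_⟩
      simp only [smul_comp, mul_smul_comm, ← Finset.smul_sum, hP.2, smul_zero]

theorem natDegree_det_foldedWronskian_le {d k : ℕ} (γ : F) (b : Fin k → F[X])
    (hd : ∀ l, (b l).natDegree ≤ d) : (foldedWronskian γ b).det.natDegree ≤ d * k := by
  rw [Matrix.det_apply]
  refine natDegree_sum_le_of_forall_le _ _ fun σ _ => ?_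
  rw [Units.smul_def]
  refine (natDegree_smul_le _ _).trans ((natDegree_prod_le _ _).trans ?_)
  refine (Finset.sum_le_card_nsmul _ _ d fun l' _ => ?_).trans (by simp [mul_comm])
  refine natDegree_comp_le.trans ?_
  calc _ ≤ d * 1 := Nat.mul_le_mul (hd l') (by simpa using natDegree_C_mul_X_pow_le (γ ^ ((σ l' : Fin k) : ℕ)) 1)
    _ = d := mul_one d

theorem exists_adapted_basis {E : Type*} [AddCommGroup E] [Module F E] [FiniteDimensional F E]
    (V : Submodule F E) {k : ℕ} (b : Basis (Fin k) F E) :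
    ∃ (e : Basis (Fin k) F E) (T : Finset (Fin k)), T.card = finrank F V ∧ ∀ l ∈ T, e l ∈ V := by
  classical
  obtain ⟨V', hV'⟩ := Submodule.exists_isCompl V
  let e₀ : Basis (Fin (finrank F V) ⊕ Fin (finrank F V')) F E :=
    ((finBasis F V).prod (finBasis F V')).map (Submodule.prodEquivOfIsCompl V V' hV')
  let φ := e₀.indexEquiv b
  refine ⟨e₀.reindex φ, Finset.univ.image fun i => φ (Sum.inl i), ?_, ?_⟩
  · rw [Finset.card_image_of_injective _ fun i j h => Sum.inl_injective (φ.injective h)]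
    simp
  · intro l hl
    obtain ⟨i, -, rfl⟩ := Finset.mem_image.1 hl
    simp [e₀]

/-- Passing to a basis of `U` that extends one of `U ⊓ vanishing γ s x` changes the determinant only
by the determinant of a constant matrix. In the columns of the vanishing basis elements, row `j`
takes at `γ ^ t * x` the value of the element at `γ ^ (j + t) * x`, which is zero because `j + t <
s`. -/
theorem X_sub_C_pow_dvd_det_foldedWronskian {s k : ℕ} (γ x : F) (U : Submodule F F[X])
    [FiniteDimensional F U] (b : Basis (Fin k) F U) {t : ℕ} (ht : t + k ≤ s) :
    (X - C (γ ^ t * x)) ^ finrank F ↥(U ⊓ vanishing γ s x) ∣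
      (foldedWronskian γ fun l => (b l : F[X])).det := by
  classical
  let V : Submodule F U := (vanishing γ s x).comap U.subtype
  have hV : finrank F V = finrank F ↥(U ⊓ vanishing γ s x) := by
    rw [← Submodule.map_comap_subtype]
    exact (LinearEquiv.finrank_eq (Submodule.equivSubtypeMap U V)).trans rfl
  obtain ⟨e, T, hT, heT⟩ := exists_adapted_basis V b
  have hdvd : (foldedWronskian γ fun l => (e l : F[X])).det ∣
      (foldedWronskian γ fun l => (b l : F[X])).det := by
    have : foldedWronskian γ (fun l => (b l : F[X])) =
        foldedWronskian γ (fun l => (e l : F[X])) * (e.toMatrix b).map C := by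
      ext1 j l
      have h1 : (b l : F[X]) = ∑ i, e.toMatrix b i l • (e i : F[X]) := by
        conv_lhs => rw [← e.sum_toMatrix_smul_self b l]
        rw [Submodule.coe_sum]
        rfl
      simp only [foldedWronskian, Matrix.mul_apply, Matrix.of_apply, Matrix.map_apply]
      rw [h1, Polynomial.sum_comp]
      refine Finset.sum_congr rfl fun i _ => ?_
      rw [smul_comp, smul_eq_C_mul, mul_comm]
    rw [this, Matrix.det_mul]
    exact dvd_mul_right _ _
  refine dvd_trans ?_ hdvd
  rw [← hV, ← hT]
  refine pow_card_dvd_det _ _ T fun l hl j => ?_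
  rw [dvd_iff_isRoot, IsRoot.def]
  have hmem : (e l : F[X]) ∈ vanishing γ s x := heT l hl
  simp only [foldedWronskian, Matrix.of_apply, eval_comp, eval_mul, eval_C, eval_X]
  rw [← mul_assoc, ← pow_add]
  exact hmem _ (by have := j.2; omega)

/-- The spaces of polynomials that vanish on one of several disjoint geometric progressions form a
subspace design. -/
theorem sum_finrank_vanishing_le {ι : Type*} {s d : ℕ} {γ : F}
    (hγ : Set.InjOn (fun k : ℕ => γ ^ k) (Set.Iic d)) (I : Finset ι) (a : ι → F)
    (ha : ∀ i ∈ I, ∀ i' ∈ I, ∀ j < s, ∀ j' < s, γ ^ j * a i = γ ^ j' * a i' → i = i' ∧ j = j')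
    (U : Submodule F F[X]) [FiniteDimensional F U] (hU : ∀ P ∈ U, P.natDegree ≤ d)
    (hs : finrank F U ≤ s) :
    (s + 1 - finrank F U) * ∑ i ∈ I, finrank F ↥(U ⊓ vanishing γ s (a i)) ≤ d * finrank F U := by
  classical
  rcases Nat.eq_zero_or_pos (finrank F U) with h0 | hpos
  · have : U = ⊥ := Submodule.finrank_eq_zero.1 h0
    subst this
    simp
  let b := finBasis F U
  have hb : LinearIndependent F (fun l => (b l : F[X])) :=
    b.linearIndependent.map' U.subtype (Submodule.ker_subtype U)
  have hne := det_foldedWronskian_ne_zero hγ _ hb fun l => hU _ (b l).2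
  set W := (foldedWronskian γ fun l => (b l : F[X])).det
  -- These pairs index distinct points `γ ^ j * a i`, so the corresponding powers of linear factors
  -- are coprime and their product divides the Wronskian. Comparing degrees gives the claim.
  let J := I ×ˢ Finset.range (s + 1 - finrank F U)
  have hprod : ∏ p ∈ J, (X - C (γ ^ p.2 * a p.1)) ^ finrank F ↥(U ⊓ vanishing γ s (a p.1)) ∣ W := by
    refine Finset.prod_dvd_of_coprime ?_ ?_
    · rintro ⟨i, j⟩ hp ⟨i', j'⟩ hp' hne
      simp only [J, Finset.coe_product, Set.mem_prod, Finset.mem_coe, Finset.mem_range] at hp hp'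
      refine IsCoprime.pow (isCoprime_X_sub_C_of_isUnit_sub ?_)
      rw [isUnit_iff_ne_zero, sub_ne_zero]
      intro h
      obtain ⟨h1, h2⟩ := ha i hp.1 i' hp'.1 j (by omega) j' (by omega) h
      exact hne (Prod.ext h1 h2)
    · rintro ⟨i, j⟩ hp
      simp only [J, Finset.mem_product, Finset.mem_range] at hp
      exact X_sub_C_pow_dvd_det_foldedWronskian γ (a i) U b (by omega)
  have hdeg := natDegree_le_of_dvd hprod hne
  have h2 : (∏ p ∈ J, (X - C (γ ^ p.2 * a p.1)) ^
      finrank F ↥(U ⊓ vanishing γ s (a p.1))).natDegree =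
      (s + 1 - finrank F U) * ∑ i ∈ I, finrank F ↥(U ⊓ vanishing γ s (a i)) := by
    rw [natDegree_prod _ _ fun p _ => pow_ne_zero _ (X_sub_C_ne_zero _)]
    simp only [natDegree_pow, natDegree_X_sub_C, mul_one, J]
    clear hprod hdeg
    rw [Finset.sum_product, Finset.mul_sum]
    exact Finset.sum_congr rfl fun i _ =>
      (Finset.sum_const _).trans
        (congrArg (· * finrank F ↥(U ⊓ vanishing γ s (a i))) (Finset.card_range _))
  rw [← h2]
  exact hdeg.trans (natDegree_det_foldedWronskian_le γ _ fun l => hU _ (b l).2)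

end FoldedRS
end

/-! ### Iterating the subspace design; parameters of an instance -/

noncomputable section

namespace FoldedRS

universe u

set_option linter.unusedSectionVars false

open Polynomial Module

variable {F : Type u} [Field F]

/-- Induction on the length of the tuple: the inductive hypothesis is applied to each `U ⊓ vanishing
γ s (a i)`, then the subspace design to `U`. A uniform bound `r` on the dimensions replaces the
factor `s + 1 - finrank F U` by one that is common to all subspaces. -/
theorem sum_finrank_inf_vanishing_le {ι : Type*} [Fintype ι] {s d r : ℕ} {γ : F}
    (hγ : Set.InjOn (fun k : ℕ => γ ^ k) (Set.Iic d)) (a : ι → F)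
    (ha : ∀ i i', ∀ j < s, ∀ j' < s, γ ^ j * a i = γ ^ j' * a i' → i = i' ∧ j = j')
    (hr : r ≤ s) (t : ℕ) (U : Submodule F F[X]) [FiniteDimensional F U]
    (hU : ∀ P ∈ U, P.natDegree ≤ d) (hUr : finrank F U ≤ r) :
    (s + 1 - r) ^ t * ∑ w : Fin t → ι, finrank F ↥(U ⊓ ⨅ τ, vanishing γ s (a (w τ))) ≤
      d ^ t * finrank F U := by
  induction t generalizing U with
  | zero => simpa using Submodule.finrank_mono inf_le_left
  | succ t ih =>
    have hcons : ∑ w : Fin (t + 1) → ι, finrank F ↥(U ⊓ ⨅ τ, vanishing γ s (a (w τ))) =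
        ∑ i, ∑ w : Fin t → ι,
          finrank F ↥((U ⊓ vanishing γ s (a i)) ⊓ ⨅ τ, vanishing γ s (a (w τ))) := by
      rw [← (Fin.consEquiv fun _ => ι).sum_comp, Fintype.sum_prod_type]
      refine Finset.sum_congr rfl fun i _ => Finset.sum_congr rfl fun w _ => ?_
      have : (U ⊓ ⨅ τ, vanishing γ s (a (Fin.consEquiv (fun _ => ι) (i, w) τ))) =
          (U ⊓ vanishing γ s (a i)) ⊓ ⨅ τ, vanishing γ s (a (w τ)) := by
        ext P
        simp [Submodule.mem_iInf, Fin.forall_fin_succ, and_assoc]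
      rw [this]
    have hle : ∀ i, finrank F ↥(U ⊓ vanishing γ s (a i)) ≤ finrank F U := fun i =>
      Submodule.finrank_mono inf_le_left
    have hfd : ∀ i, FiniteDimensional F ↥(U ⊓ vanishing γ s (a i)) := fun i =>
      Submodule.finiteDimensional_of_le inf_le_left
    calc (s + 1 - r) ^ (t + 1) * ∑ w : Fin (t + 1) → ι, finrank F ↥(U ⊓ ⨅ τ, vanishing γ s (a (w τ)))
        = (s + 1 - r) * ∑ i, (s + 1 - r) ^ t * ∑ w : Fin t → ι,
          finrank F ↥((U ⊓ vanishing γ s (a i)) ⊓ ⨅ τ, vanishing γ s (a (w τ))) := by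
          rw [hcons, pow_succ', mul_assoc, Finset.mul_sum]
      _ ≤ (s + 1 - r) * ∑ i, d ^ t * finrank F ↥(U ⊓ vanishing γ s (a i)) := by
          refine Nat.mul_le_mul_left _ (Finset.sum_le_sum fun i _ => ?_)
          have := hfd i
          exact ih _ (fun P hP => hU P hP.1) ((hle i).trans hUr)
      _ = d ^ t * ((s + 1 - r) * ∑ i, finrank F ↥(U ⊓ vanishing γ s (a i))) := by
          rw [← Finset.mul_sum]
          ring
      _ ≤ d ^ t * ((s + 1 - finrank F U) * ∑ i, finrank F ↥(U ⊓ vanishing γ s (a i))) := by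
          gcongr
      _ ≤ d ^ t * (d * finrank F U) := Nat.mul_le_mul_left _
          (sum_finrank_vanishing_le hγ _ a (fun i _ i' _ => ha i i') U hU (hUr.trans hr))
      _ = d ^ (t + 1) * finrank F U := by ring

/-- Most tuples of coordinates from a large set cut a small space down to zero. -/
theorem pow_le_two_mul_card_cut {ι : Type*} [Fintype ι] [DecidableEq ι] {s d r N : ℕ} {γ : F}
    (hγ : Set.InjOn (fun k : ℕ => γ ^ k) (Set.Iic d)) (a : ι → F)
    (ha : ∀ i i', ∀ j < s, ∀ j' < s, γ ^ j * a i = γ ^ j' * a i' → i = i' ∧ j = j')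
    (hr : r ≤ s) (t : ℕ) (U : Submodule F F[X]) [FiniteDimensional F U]
    (hU : ∀ P ∈ U, P.natDegree ≤ d) (hUr : finrank F U ≤ r)
    (ht : 2 * (d ^ t * r) ≤ ((s + 1 - r) * N) ^ t) (A : Finset ι) (hA : N ≤ A.card)
    (G : Finset (Fin t → ι))
    (hG : ∀ w, (∀ τ, w τ ∈ A) → U ⊓ ⨅ τ, vanishing γ s (a (w τ)) = ⊥ → w ∈ G) :
    N ^ t ≤ 2 * G.card := by
  classical
  -- Every bad tuple contributes at least one to the sum of dimensions, so `ht` leaves at most `N ^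
  -- t / 2` bad tuples.
  let B : Finset (Fin t → ι) :=
    Finset.univ.filter fun w => U ⊓ ⨅ τ, vanishing γ s (a (w τ)) ≠ ⊥
  have h1 := sum_finrank_inf_vanishing_le hγ a ha hr t U hU hUr
  have h2 : B.card ≤ ∑ w : Fin t → ι, finrank F ↥(U ⊓ ⨅ τ, vanishing γ s (a (w τ))) := by
    rw [Finset.card_eq_sum_ones]
    refine (Finset.sum_le_sum fun w hw => ?_).trans
      (Finset.sum_le_sum_of_subset (Finset.subset_univ B))
    have : FiniteDimensional F ↥(U ⊓ ⨅ τ, vanishing γ s (a (w τ))) :=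
      Submodule.finiteDimensional_of_le inf_le_left
    rw [Nat.one_le_iff_ne_zero]
    exact fun h => (Finset.mem_filter.1 hw).2 (Submodule.finrank_eq_zero.1 h)
  have h3 : (s + 1 - r) ^ t * (2 * B.card) ≤ (s + 1 - r) ^ t * N ^ t := by
    rw [mul_pow] at ht
    calc (s + 1 - r) ^ t * (2 * B.card) = 2 * ((s + 1 - r) ^ t * B.card) := by ring
      _ ≤ 2 * (d ^ t * r) := Nat.mul_le_mul_left _
        ((Nat.mul_le_mul_left _ h2).trans (h1.trans (Nat.mul_le_mul_left _ hUr)))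
      _ ≤ _ := ht
  have h4 : 2 * B.card ≤ N ^ t :=
    Nat.le_of_mul_le_mul_left h3 (Nat.pow_pos (by omega))
  have h5 : (Fintype.piFinset fun _ : Fin t => A) ⊆ G ∪ B := by
    intro w hw
    rw [Finset.mem_union]
    by_cases h : U ⊓ ⨅ τ, vanishing γ s (a (w τ)) = ⊥
    · exact Or.inl (hG w (Fintype.mem_piFinset.1 hw) h)
    · exact Or.inr (Finset.mem_filter.2 ⟨Finset.mem_univ _, h⟩)
  have h6 := (Finset.card_le_card h5).trans (Finset.card_union_le _ _)
  rw [Fintype.card_piFinset, Finset.prod_const, Finset.card_univ, Fintype.card_fin] at h6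
  have h7 := Nat.pow_le_pow_left hA t
  omega

/-! ### Instances of the list recovery problem -/

/-- An instance of the list recovery problem, as it is presented to the program: entry `j` of the
list with index `i` is `k ↦ y ((i * l + j) * s + k)`, and `e` coordinates may be missed. -/
structure Inst (F : Type*) where
  /-- the generator -/
  g : F
  /-- the evaluation points -/
  a : ℕ → F
  /-- the lists -/
  y : ℕ → F
  /-- the folding parameter -/
  s : ℕ
  /-- the degree -/
  d : ℕ
  /-- the length of the code -/
  n : ℕ
  /-- the size of the lists -/
  l : ℕ
  /-- the number of coordinates that may be missed -/
  e : ℕ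

namespace Inst

/-- The slack `ε s n`. -/
def E (I : Inst F) : ℕ := I.s * I.n - I.d - I.s * I.e

/-- The number of variables of the interpolation polynomial. -/
def m (I : Inst F) : ℕ := 4 * I.l * I.s * I.n / I.E

/-- The number of windows of length `m` in `{0, …, s - 1}`. -/
def w (I : Inst F) : ℕ := I.s - I.m + 1

/-- The degree of the coefficients of the interpolation polynomial. -/
def D (I : Inst F) : ℕ := I.n * I.l * I.w / (I.m + 1)

/-- The number of coordinates after which the expected dimension is halved. -/
def K (I : Inst F) : ℕ := 2 * I.s * I.n / I.E + 1

/-- The number of coordinates at which a codeword is guessed. -/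
def t (I : Inst F) : ℕ := I.K * Nat.size (2 * I.m)

/-- The assumptions on the parameters. -/
structure Valid (I : Inst F) : Prop where
  n_pos : 0 < I.n
  l_pos : 0 < I.l
  lt : I.d + I.s * I.e < I.s * I.n
  le_sq : 16 * I.l * I.s * I.n ^ 2 ≤ I.E ^ 2
  inj : ∀ i < I.n, ∀ i' < I.n, ∀ j < I.s, ∀ j' < I.s,
    I.g ^ j * I.a i = I.g ^ j' * I.a i' → i = i' ∧ j = j'
  g_inj : Set.InjOn (fun k : ℕ => I.g ^ k) (Set.Iio (I.s * I.n))

/-- `P` agrees with entry `u % l` of the list with index `u / l`. -/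
def Agree (I : Inst F) (P : F[X]) (u : ℕ) : Prop :=
  ∀ k < I.s, P.eval (I.g ^ k * I.a (u / I.l)) = I.y (u * I.s + k)

/-- `P` agrees with an entry of the list with index `i`. -/
def Hit (I : Inst F) (P : F[X]) (i : ℕ) : Prop := ∃ j < I.l, I.Agree P (i * I.l + j)

open Classical in
/-- The number of missed coordinates. -/
def miss (I : Inst F) (P : F[X]) : ℕ := ((Finset.range I.n).filter fun i => ¬I.Hit P i).card

/-- `P` belongs to the list that is to be found. -/
def InList (I : Inst F) (P : F[X]) : Prop := P.natDegree ≤ I.d ∧ I.miss P ≤ I.e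

variable {I : Inst F}

namespace Valid

theorem s_mul_n (h : I.Valid) : I.s * I.n = I.E + I.d + I.s * I.e := by
  have := h.lt
  unfold E
  omega

theorem E_pos (h : I.Valid) : 0 < I.E := by
  have := h.lt
  unfold E
  omega

theorem s_pos (h : I.Valid) : 0 < I.s := by
  rcases Nat.eq_zero_or_pos I.s with h0 | h0
  · have := h.lt
    simp [h0] at this
  · exact h0

theorem e_lt (h : I.Valid) : I.e < I.n := by
  have := h.lt
  exact Nat.lt_of_mul_lt_mul_left (a := I.s) (by omega)

theorem m_mul_E (_ : I.Valid) : I.m * I.E ≤ 4 * I.l * I.s * I.n := Nat.div_mul_le_self _ _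

theorem lt_m_mul_E (h : I.Valid) : 4 * I.l * I.s * I.n < (I.m + 1) * I.E :=
  (Nat.div_lt_iff_lt_mul h.E_pos).1 (Nat.lt_succ_self _)

/-- After multiplication by `E` this reads `4 m n E ≤ 16 ℓ s n ^ 2 ≤ E ^ 2`. It is the use of the
assumption `16 ℓ / ε ^ 2 ≤ s`: roughly, `m ≤ ε s / 4`. -/
theorem four_m_n (h : I.Valid) : 4 * I.m * I.n ≤ I.E := by
  refine Nat.le_of_mul_le_mul_right ?_ h.E_pos
  nlinarith [h.m_mul_E, h.le_sq, h.n_pos]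

theorem four_m (h : I.Valid) : 4 * I.m ≤ I.s := by
  refine Nat.le_of_mul_le_mul_right ?_ h.n_pos
  have := h.four_m_n
  have := h.s_mul_n
  omega

theorem m_pos (h : I.Valid) : 0 < I.m := by
  refine Nat.div_pos ?_ h.E_pos
  have h1 : I.E ≤ I.s * I.n := by have := h.s_mul_n; omega
  have h2 := h.l_pos
  calc I.E ≤ 1 * (I.s * I.n) := by omega
    _ ≤ 4 * I.l * (I.s * I.n) := Nat.mul_le_mul_right _ (by omega)
    _ = _ := by ring

theorem w_add_m (h : I.Valid) : I.w + I.m = I.s + 1 := by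
  have := h.four_m
  unfold w
  omega

/-- Since `s (n - e) = E + d`, the loss from having only `w = s - m + 1` windows instead of `s`
positions is, up to the factor `s`, at most `m (E + d)`. The bounds `4 m ≤ s` and `4 d m ≤ s E` make
it at most half of `s E`. -/
theorem key_le (h : I.Valid) : 2 * I.d + I.E ≤ 2 * ((I.n - I.e) * I.w) := by
  obtain ⟨f, hf⟩ := Nat.exists_eq_add_of_le h.e_lt.le
  obtain ⟨v, hv⟩ := Nat.exists_eq_add_of_le h.four_m
  have h1 := h.s_mul_n
  have h2 := h.four_m_n
  have h3 : I.w = 3 * I.m + v + 1 := by have := h.w_add_m; omega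
  rw [show I.n - I.e = f by omega, h3]
  have h4 : I.s * f = I.E + I.d := by rw [hf] at h1; nlinarith
  have h5 : I.d ≤ I.s * I.n := by omega
  have h6 : 4 * (I.d * I.m) ≤ I.s * I.E := by
    calc 4 * (I.d * I.m) ≤ 4 * (I.s * I.n * I.m) := by gcongr
      _ = I.s * (4 * I.m * I.n) := by ring
      _ ≤ _ := by gcongr
  refine Nat.le_of_mul_le_mul_left ?_ h.s_pos
  have h7 : I.s * (2 * (f * (3 * I.m + v + 1))) = 2 * (I.E + I.d) * (3 * I.m + v + 1) := by
    rw [← h4]; ring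
  rw [h7]
  have h8 : 4 * I.m ≤ I.s := h.four_m
  have h9 : 4 * (I.m * I.E) ≤ I.s * I.E := by nlinarith
  have h10 : I.s * (I.E + I.d) = 4 * I.m * (I.E + I.d) + v * (I.E + I.d) := by
    conv_lhs => rw [hv]
    ring
  nlinarith

/-- By rounding, `D (m + 1) ≤ n ℓ w` with `w ≤ s`, while `(m + 1) E` exceeds `4 ℓ s n`. -/
theorem four_D_lt (h : I.Valid) : 4 * I.D < I.E := by
  have h1 : I.D * (I.m + 1) ≤ I.n * I.l * I.w := Nat.div_mul_le_self _ _
  have h2 := h.lt_m_mul_E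
  have h3 : 0 < I.w := Nat.succ_pos _
  have h4 : I.w ≤ I.s := by have := h.w_add_m; have := h.m_pos; omega
  have h5 : I.s * (4 * I.D) * (I.m + 1) < I.s * I.E * (I.m + 1) := by
    calc I.s * (4 * I.D) * (I.m + 1) = 4 * I.s * (I.D * (I.m + 1)) := by ring
      _ ≤ 4 * I.s * (I.n * I.l * I.w) := by gcongr
      _ = 4 * I.l * I.s * I.n * I.w := by ring
      _ < (I.m + 1) * I.E * I.w := Nat.mul_lt_mul_of_pos_right h2 h3
      _ ≤ (I.m + 1) * I.E * I.s := by gcongr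
      _ = _ := by ring
  exact Nat.lt_of_mul_lt_mul_left (Nat.lt_of_mul_lt_mul_right h5)

theorem D_add_d_lt (h : I.Valid) : I.D + I.d < (I.n - I.e) * I.w := by
  have := h.key_le
  have := h.four_D_lt
  have := h.E_pos
  omega

theorem D_add_d_lt' (h : I.Valid) : I.D + I.d < I.s * I.n := by
  have := h.D_add_d_lt
  have h4 : I.w ≤ I.s := by have := h.w_add_m; have := h.m_pos; omega
  calc _ < _ := this
    _ ≤ I.n * I.s := Nat.mul_le_mul (Nat.sub_le _ _) h4
    _ = _ := mul_comm _ _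

theorem d_lt (h : I.Valid) : I.d < I.s * I.n := by
  have := h.D_add_d_lt'
  omega

/-- The excess of `(n - e) w` over `d` is at least `E / 2`, and `K E > 2 s n > 2 d`. So `(n - e) w`
is at least `d (1 + 1 / K)`, and Bernoulli's inequality gives `(1 + 1 / K) ^ K ≥ 2`. -/
theorem two_mul_pow_le (h : I.Valid) : 2 * I.d ^ I.K ≤ ((I.n - I.e) * I.w) ^ I.K := by
  set Q := (I.n - I.e) * I.w
  have h1 : I.d * (I.K + 1) ≤ Q * I.K := by
    have h2 : 2 * I.s * I.n < I.K * I.E := (Nat.div_lt_iff_lt_mul h.E_pos).1 (Nat.lt_succ_self _)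
    have h3 := h.key_le
    have h4 := h.d_lt
    obtain ⟨v, hv⟩ : ∃ v, Q = I.d + v := Nat.exists_eq_add_of_le (by omega)
    have h5 : I.K * I.E ≤ I.K * (2 * v) := Nat.mul_le_mul_left _ (by omega)
    rw [hv]
    nlinarith
  have hK : 0 < I.K := Nat.succ_pos _
  have hK' : (0 : ℝ) < I.K := by exact_mod_cast hK
  have h5 : (2 : ℝ) ≤ (1 + 1 / (I.K : ℝ)) ^ I.K := by
    have := one_add_mul_le_pow (a := 1 / (I.K : ℝ)) (by have : 0 < 1 / (I.K : ℝ) := by positivity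
                                                        linarith) I.K
    rw [mul_one_div_cancel hK'.ne'] at this
    linarith
  have h6 : (I.d : ℝ) * (1 + 1 / I.K) ≤ Q := by
    have : (I.d : ℝ) * (I.K + 1) ≤ Q * I.K := by exact_mod_cast h1
    rw [← div_le_iff₀ hK'] at this
    calc (I.d : ℝ) * (1 + 1 / I.K) = I.d * (I.K + 1) / I.K := by field_simp
      _ ≤ Q := this
  have h7 : (2 : ℝ) * I.d ^ I.K ≤ Q ^ I.K := by
    calc (2 : ℝ) * I.d ^ I.K ≤ (1 + 1 / (I.K : ℝ)) ^ I.K * I.d ^ I.K := by gcongr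
      _ = (I.d * (1 + 1 / I.K)) ^ I.K := by rw [mul_pow]; ring
      _ ≤ Q ^ I.K := by gcongr
  exact_mod_cast h7

/-- Every `K` coordinates halve the average dimension; `Nat.size (2 * m)` halvings bring it from `m`
to at most `1 / 2`. -/
theorem two_mul_pow_mul_le (h : I.Valid) :
    2 * (I.d ^ I.t * I.m) ≤ ((I.s + 1 - I.m) * (I.n - I.e)) ^ I.t := by
  have h1 : 2 * I.m ≤ 2 ^ Nat.size (2 * I.m) := (Nat.lt_size_self _).le
  have h2 := Nat.pow_le_pow_left h.two_mul_pow_le (Nat.size (2 * I.m))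
  rw [mul_pow, ← pow_mul, ← pow_mul] at h2
  have h3 : I.s + 1 - I.m = I.w := by have := h.w_add_m; omega
  rw [h3, mul_comm I.w]
  calc 2 * (I.d ^ I.t * I.m) = 2 * I.m * I.d ^ I.t := by ring
    _ ≤ 2 ^ Nat.size (2 * I.m) * I.d ^ I.t := by gcongr
    _ ≤ _ := h2

end Valid

end Inst

end FoldedRS
end

/-! ### The interpolated equation and the combinatorial bound for the list -/

noncomputable section

namespace FoldedRS

universe u

set_option linter.unusedSectionVars false

open Polynomial Module

variable {F : Type u} [Field F]

/-- The polynomial whose coefficients are in the cells `off, …, off + len - 1`. -/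
def polyOf (x : ℕ → F) (off len : ℕ) : F[X] := ∑ k ∈ Finset.range len, monomial k (x (off + k))

theorem polyOf_coeff (x : ℕ → F) (off len k : ℕ) :
    (polyOf x off len).coeff k = if k < len then x (off + k) else 0 := by
  simp only [polyOf, finsetSum_coeff, coeff_monomial]
  rw [Finset.sum_ite_eq' (Finset.range len) k]
  simp

theorem natDegree_polyOf_le (x : ℕ → F) (off len : ℕ) :
    (polyOf x off (len + 1)).natDegree ≤ len := by
  refine natDegree_le_iff_coeff_eq_zero.2 fun k hk => ?_
  rw [polyOf_coeff, if_neg (by omega)]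

theorem eval_polyOf (x : ℕ → F) (off len : ℕ) (z : F) :
    (polyOf x off len).eval z = ∑ k ∈ Finset.range len, x (off + k) * z ^ k := by
  simp [polyOf, eval_finsetSum]

theorem polyOf_coeff_self {P : F[X]} {d : ℕ} (hP : P.natDegree ≤ d) :
    polyOf P.coeff 0 (d + 1) = P := by
  ext k
  rw [polyOf_coeff, zero_add]
  split_ifs with h
  · rfl
  · exact (coeff_eq_zero_of_natDegree_lt (by omega)).symm

namespace Inst

/-- The polynomial `z A₀ + ∑ A_{b + 1} P(g ^ b X)`. -/
def combine (I : Inst F) (A : ℕ → F[X]) (z : F) (P : F[X]) : F[X] :=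
  C z * A 0 + ∑ b : Fin I.m, A (b + 1) * P.comp (C (I.g ^ (b : ℕ)) * X)

/-- The value of the interpolation polynomial at window `j` of the list entry `u`. -/
def interpEval (I : Inst F) (A : ℕ → F[X]) (u j : ℕ) : F :=
  (A 0).eval (I.g ^ j * I.a (u / I.l)) +
    ∑ b ∈ Finset.range I.m, (A (b + 1)).eval (I.g ^ j * I.a (u / I.l)) * I.y (u * I.s + (j + b))

/-- The polynomials `A b` are the coefficients of an interpolation polynomial. -/
structure IsInterp (I : Inst F) (A : ℕ → F[X]) : Prop where
  natDegree_le : ∀ b, (A b).natDegree ≤ I.D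
  ne_zero : ∃ b ≤ I.m, A b ≠ 0
  eval_eq_zero : ∀ u < I.n * I.l, ∀ j < I.w, I.interpEval A u j = 0

/-- The solutions of the homogeneous equation. -/
def space (I : Inst F) (A : ℕ → F[X]) : Submodule F F[X] where
  carrier := {P | P.natDegree ≤ I.d ∧ ∑ b : Fin I.m, A (b + 1) * P.comp (C (I.g ^ (b : ℕ)) * X) = 0}
  add_mem' hP hQ := ⟨natDegree_add_le_of_degree_le hP.1 hQ.1, by
    simp only [add_comp, mul_add, Finset.sum_add_distrib, hP.2, hQ.2, add_zero]⟩
  zero_mem' := by simp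
  smul_mem' c P hP := ⟨(natDegree_smul_le c P).trans hP.1, by
    simp only [smul_comp, mul_smul_comm, ← Finset.smul_sum, hP.2, smul_zero]⟩

variable {I : Inst F} {A : ℕ → F[X]}

instance : FiniteDimensional F (I.space A) := by
  have : I.space A ≤ degreeLT F (I.d + 1) := fun P hP =>
    mem_degreeLT.2 ((degree_le_of_natDegree_le hP.1).trans_lt (by exact_mod_cast Nat.lt_succ_self _))
  have : FiniteDimensional F (degreeLT F (I.d + 1)) :=
    Module.Finite.equiv (degreeLTEquiv F (I.d + 1)).symm
  exact Submodule.finiteDimensional_of_le ‹I.space A ≤ _›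

theorem Valid.injOn_Iic (h : I.Valid) {k : ℕ} (hk : k < I.s * I.n) :
    Set.InjOn (fun k : ℕ => I.g ^ k) (Set.Iic k) :=
  h.g_inj.mono fun _ hj => lt_of_le_of_lt hj hk

theorem IsInterp.combine_natDegree_le (hA : I.IsInterp A) (z : F) {P : F[X]}
    (hP : P.natDegree ≤ I.d) : (I.combine A z P).natDegree ≤ I.D + I.d := by
  refine natDegree_add_le_of_degree_le ?_ ?_
  · exact (natDegree_C_mul_le _ _).trans ((hA.natDegree_le 0).trans (Nat.le_add_right _ _))
  · refine natDegree_sum_le_of_forall_le _ _ fun b _ => ?_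
    refine natDegree_mul_le.trans (Nat.add_le_add (hA.natDegree_le _) ?_)
    refine natDegree_comp_le.trans ?_
    calc _ ≤ I.d * 1 :=
          Nat.mul_le_mul hP (by simpa using natDegree_C_mul_X_pow_le (I.g ^ (b : ℕ)) 1)
      _ = I.d := mul_one _

theorem eval_combine (z : F) (P : F[X]) (x : F) :
    (I.combine A z P).eval x = z * (A 0).eval x +
      ∑ b ∈ Finset.range I.m, (A (b + 1)).eval x * P.eval (I.g ^ b * x) := by
  rw [Finset.sum_range fun b => (A (b + 1)).eval x * P.eval (I.g ^ b * x)]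
  simp [combine, eval_finsetSum, eval_comp]

theorem card_hit (P : F[X]) [DecidablePred (I.Hit P)] :
    ((Finset.range I.n).filter fun i => I.Hit P i).card + I.miss P = I.n := by
  classical
  rw [miss]
  convert Finset.card_filter_add_card_filter_not (s := Finset.range I.n) (I.Hit P)
  simp

theorem InList.sub_le_card_hit {P : F[X]} (hP : I.InList P) [DecidablePred (I.Hit P)] :
    I.n - I.e ≤ ((Finset.range I.n).filter fun i => I.Hit P i).card := by
  have := card_hit (I := I) P
  have := hP.2
  omega

/-- All polynomials of the list solve the interpolated equation. -/
theorem IsInterp.combine_eq_zero (h : I.Valid) (hA : I.IsInterp A) {P : F[X]} (hP : I.InList P) :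
    I.combine A 1 P = 0 := by
  classical
  let H := (Finset.range I.n).filter fun i => I.Hit P i
  -- The starting points of all windows at hit coordinates. There the list values equal the values
  -- of `P`, because a window starting at `j < w` ends below `s`.
  let S := (H ×ˢ Finset.range I.w).image fun p => I.g ^ p.2 * I.a p.1
  have hw : I.w ≤ I.s := by have := h.w_add_m; have := h.m_pos; omega
  have hS : S.card = H.card * I.w := by
    rw [Finset.card_image_of_injOn, Finset.card_product, Finset.card_range]
    rintro ⟨i, j⟩ hp ⟨i', j'⟩ hp' heq
    simp only [H, Finset.coe_product, Set.mem_prod, Finset.mem_coe, Finset.mem_range,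
      Finset.mem_filter] at hp hp'
    obtain ⟨h1, h2⟩ := h.inj i hp.1.1 i' hp'.1.1 j (by omega) j' (by omega) heq
    exact Prod.ext h1 h2
  refine eq_zero_of_natDegree_lt_card_of_eval_eq_zero' _ S ?_ ?_
  · intro x hx
    obtain ⟨⟨i, j⟩, hp, rfl⟩ := Finset.mem_image.1 hx
    simp only [H, Finset.mem_product, Finset.mem_range, Finset.mem_filter] at hp
    obtain ⟨⟨hi, k, hk, hag⟩, hj⟩ := hp
    have hu : i * I.l + k < I.n * I.l := by
      calc i * I.l + k < i * I.l + I.l := by omega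
        _ = (i + 1) * I.l := by ring
        _ ≤ I.n * I.l := Nat.mul_le_mul_right _ hi
    have hdiv : (i * I.l + k) / I.l = i := by
      rw [Nat.div_eq_iff h.l_pos]
      constructor <;> omega
    have := hA.eval_eq_zero _ hu j hj
    rw [interpEval, hdiv] at this
    simp only [eval_combine, one_mul]
    rw [← this]
    congr 1
    refine Finset.sum_congr rfl fun b hb => ?_
    have hb' := Finset.mem_range.1 hb
    have h1 := hag (j + b) (by have := h.w_add_m; omega)
    rw [hdiv] at h1
    rw [← h1, pow_add]
    ring_nf
  · rw [hS]
    calc _ ≤ I.D + I.d := hA.combine_natDegree_le 1 hP.1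
      _ < (I.n - I.e) * I.w := h.D_add_d_lt
      _ ≤ _ := Nat.mul_le_mul_right _ hP.sub_le_card_hit

/-- The dilation bound needs one of `A 1, …, A m` to be nonzero. If all of them vanished, the
equation satisfied by the given `P` would read `A 0 = 0`, and the interpolation polynomial would be
zero. -/
theorem IsInterp.finrank_space_le (h : I.Valid) (hA : I.IsInterp A) {P : F[X]} (hP : I.InList P) :
    finrank F (I.space A) ≤ I.m := by
  refine (finrank_lt_of_dilation (m := I.m) (h.injOn_Iic h.d_lt) (fun b => A (b + 1)) ?_ _
    fun P hP => hP).le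
  intro h0
  have hz : ∀ b < I.m, A (b + 1) = 0 := fun b hb => congrFun h0 ⟨b, hb⟩
  have h1 := hA.combine_eq_zero h hP
  rw [combine, Finset.sum_eq_zero fun b _ => by rw [hz b b.2, zero_mul]] at h1
  obtain ⟨b, hb, hne⟩ := hA.ne_zero
  cases b with
  | zero => exact hne (by simpa using h1)
  | succ b => exact hne (hz b (by omega))

/-- A tuple of list entries is good for `P` if `P` agrees with all of them and they determine `P`
as a solution of the interpolated equation. -/
def Good (I : Inst F) (A : ℕ → F[X]) (P : F[X]) {t : ℕ} (u : Fin t → Fin (I.n * I.l)) : Prop :=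
  (∀ τ, I.Agree P (u τ)) ∧
    I.space A ⊓ ⨅ τ, vanishing I.g I.s (I.a ((u τ : ℕ) / I.l)) = ⊥

/-- `R - z • P` solves the homogeneous equation and vanishes at all guessed coordinates, so it lies
in an intersection that is zero. The case `z = 1` serves the bound for the list, the general case
the homogeneous linear system of the algorithm. -/
theorem Good.unique {P : F[X]} (hPd : P.natDegree ≤ I.d) (hP : I.combine A 1 P = 0) {t : ℕ}
    {u : Fin t → Fin (I.n * I.l)} (hu : I.Good A P u) {R : F[X]} {z : F} (hRd : R.natDegree ≤ I.d)
    (hR : I.combine A z R = 0) (hag : ∀ τ, ∀ k < I.s,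
      R.eval (I.g ^ k * I.a ((u τ : ℕ) / I.l)) = z * I.y ((u τ : ℕ) * I.s + k)) :
    R = z • P := by
  rw [← sub_eq_zero, ← Submodule.mem_bot F, ← hu.2, Submodule.mem_inf, Submodule.mem_iInf]
  refine ⟨⟨?_, ?_⟩, fun τ k hk => ?_⟩
  · exact (natDegree_sub_le_iff_left ((natDegree_smul_le _ _).trans hPd)).2 hRd
  · simp only [combine, map_one, one_mul] at hP hR
    simp only [sub_comp, smul_comp, mul_sub, Finset.sum_sub_distrib, mul_smul_comm,
      ← Finset.smul_sum]
    rw [smul_eq_C_mul, eq_neg_of_add_eq_zero_right hP, eq_neg_of_add_eq_zero_right hR]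
    ring
  · rw [eval_sub, eval_smul, hag τ k hk, hu.1 τ k hk, smul_eq_mul, sub_self]

open Classical in
-- `pow_le_two_mul_card_cut` is applied to the coordinates hit by `P`. Choosing an agreeing entry at
-- each of them turns tuples of coordinates injectively into tuples of entries.
theorem IsInterp.pow_le_card_good (h : I.Valid) (hA : I.IsInterp A) {P : F[X]} (hP : I.InList P) :
    (I.n - I.e) ^ I.t ≤
      2 * (Finset.univ.filter fun u : Fin I.t → Fin (I.n * I.l) => I.Good A P u).card := by
  have hpick : ∀ i : Fin I.n, ∃ u : Fin (I.n * I.l), I.Hit P i → (u : ℕ) / I.l = i ∧ I.Agree P u := by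
    intro i
    by_cases hi : I.Hit P i
    · obtain ⟨k, hk, hag⟩ := hi
      have hi := i.2
      have hu : i * I.l + k < I.n * I.l := by
        calc i * I.l + k < i * I.l + I.l := by omega
          _ = (i + 1) * I.l := by ring
          _ ≤ I.n * I.l := Nat.mul_le_mul_right _ hi
      have hdiv : (i * I.l + k) / I.l = i := by
        rw [Nat.div_eq_iff h.l_pos]
        constructor <;> omega
      exact ⟨⟨_, hu⟩, fun _ => ⟨hdiv, hag⟩⟩
    -- An arbitrary entry; missed coordinates do not occur in the tuples below.
    · exact ⟨⟨0, Nat.mul_pos h.n_pos h.l_pos⟩, fun h => absurd h hi⟩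
  choose pick hpick using hpick
  let H : Finset (Fin I.n) := Finset.univ.filter fun i => I.Hit P i
  have hH : I.n - I.e ≤ H.card := by
    refine hP.sub_le_card_hit.trans_eq ?_
    simp only [H]
    rw [← Finset.card_map Fin.valEmbedding]
    congr 1
    ext i
    simp only [Finset.mem_filter, Finset.mem_range, Finset.mem_map, Finset.mem_univ, true_and,
      Fin.valEmbedding_apply]
    exact ⟨fun hi => ⟨⟨i, hi.1⟩, hi.2, rfl⟩, by rintro ⟨j, hj, rfl⟩; exact ⟨j.2, hj⟩⟩
  let G : Finset (Fin I.t → Fin I.n) := Finset.univ.filter fun v =>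
    (∀ τ, v τ ∈ H) ∧ I.space A ⊓ ⨅ τ, vanishing I.g I.s (I.a (v τ : ℕ)) = ⊥
  have hms : I.m ≤ I.s := by have := h.four_m; omega
  refine (pow_le_two_mul_card_cut (h.injOn_Iic h.d_lt) (fun i : Fin I.n => I.a i) ?_ hms
    I.t (I.space A) (fun P hP => hP.1) (hA.finrank_space_le h hP) h.two_mul_pow_mul_le H hH G
    fun v h1 h2 => Finset.mem_filter.2 ⟨Finset.mem_univ _, h1, h2⟩).trans ?_
  · intro i i' j hj j' hj' heq
    obtain ⟨h1, h2⟩ := h.inj i i.2 i' i'.2 j hj j' hj' heq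
    exact ⟨Fin.ext h1, h2⟩
  · refine Nat.mul_le_mul_left 2 (Finset.card_le_card_of_injOn (fun v τ => pick (v τ)) ?_ ?_)
    · intro v hv
      simp only [G, H, Finset.coe_filter, Finset.mem_filter, Finset.mem_univ, true_and,
        Set.mem_ofPred_eq] at hv ⊢
      refine ⟨fun τ => (hpick _ (hv.1 τ)).2, ?_⟩
      rw [← hv.2]
      congr 2
      funext τ
      rw [(hpick _ (hv.1 τ)).1]
    · intro v hv v' hv' heq
      simp only [G, H, Finset.coe_filter, Finset.mem_filter, Finset.mem_univ, true_and,
        Set.mem_ofPred_eq] at hv hv'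
      funext τ
      refine Fin.ext ?_
      rw [← (hpick _ (hv.1 τ)).1, ← (hpick _ (hv'.1 τ)).1, show pick (v τ) = pick (v' τ) from
        congrFun heq τ]

/-- The bound for the size of the list. -/
theorem IsInterp.card_mul_pow_le (h : I.Valid) (hA : I.IsInterp A) (Λ : Finset F[X])
    (hΛ : ∀ P ∈ Λ, I.InList P) : Λ.card * (I.n - I.e) ^ I.t ≤ 2 * (I.n * I.l) ^ I.t := by
  classical
  let G : F[X] → Finset (Fin I.t → Fin (I.n * I.l)) := fun P =>
    Finset.univ.filter fun u => I.Good A P u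
  -- A tuple that is good for `P` and agrees with `Q` forces `Q = P`, by `Good.unique` with `z = 1`.
  have hdisj : (Λ : Set F[X]).PairwiseDisjoint G := by
    intro P hP Q hQ hne
    refine Finset.disjoint_left.2 fun u hu hu' => hne ?_
    have h1 := (Finset.mem_filter.1 hu).2
    have h2 := (Finset.mem_filter.1 hu').2
    have := h1.unique (hΛ P hP).1 (hA.combine_eq_zero h (hΛ P hP)) (hΛ Q hQ).1
      (hA.combine_eq_zero h (hΛ Q hQ)) fun τ k hk => by rw [one_mul]; exact h2.1 τ k hk
    rw [one_smul] at this
    exact this.symm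
  calc Λ.card * (I.n - I.e) ^ I.t = ∑ P ∈ Λ, (I.n - I.e) ^ I.t := by
        rw [Finset.sum_const, smul_eq_mul]
    _ ≤ ∑ P ∈ Λ, 2 * (G P).card :=
        Finset.sum_le_sum fun P hP => hA.pow_le_card_good h (hΛ P hP)
    _ = 2 * (Λ.biUnion G).card := by rw [Finset.card_biUnion hdisj, Finset.mul_sum]
    _ ≤ 2 * (I.n * I.l) ^ I.t := by
        refine Nat.mul_le_mul_left 2 ((Finset.card_le_univ _).trans_eq ?_)
        simp

/-- The interpolation polynomial encoded by a vector. -/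
def interpPoly (I : Inst F) (x : ℕ → F) (b : ℕ) : F[X] := polyOf x (b * (I.D + 1)) (I.D + 1)

/-- The width of the linear system for the interpolation polynomial. -/
def width (I : Inst F) : ℕ := (I.m + 1) * (I.D + 1)

theorem isInterp_interpPoly {x : ℕ → F} (hx : ∀ k, I.width ≤ k → x k = 0) (hx0 : x ≠ 0)
    (hev : ∀ u < I.n * I.l, ∀ j < I.w, I.interpEval (I.interpPoly x) u j = 0) :
    I.IsInterp (I.interpPoly x) where
  natDegree_le b := natDegree_polyOf_le _ _ _
  ne_zero := by
    by_contra! h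
    refine hx0 (funext fun k => ?_)
    rcases lt_or_ge k I.width with hk | hk
    · have hb : k / (I.D + 1) < I.m + 1 := (Nat.div_lt_iff_lt_mul (Nat.succ_pos _)).2 hk
      have := congrArg (fun P => P.coeff (k % (I.D + 1))) (h (k / (I.D + 1)) (by omega))
      simp only [interpPoly, polyOf_coeff, coeff_zero, Nat.mod_lt _ (Nat.succ_pos I.D), if_true,
        Nat.div_add_mod'] at this
      exact this
    · exact hx k hk
  eval_eq_zero := hev

/-- There are `n ℓ w` homogeneous equations for `(m + 1)(D + 1)` unknowns. As `D` is `n ℓ w / (m +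
1)` rounded down, the unknowns outnumber the equations. -/
theorem exists_interp (I : Inst F) : ∃ x : ℕ → F, (∀ k, I.width ≤ k → x k = 0) ∧ x ≠ 0 ∧
    ∀ u < I.n * I.l, ∀ j < I.w, I.interpEval (I.interpPoly x) u j = 0 := by
  let ext : (Fin I.width → F) → ℕ → F := fun x k => if hk : k < I.width then x ⟨k, hk⟩ else 0
  have hadd : ∀ x y k, ext (x + y) k = ext x k + ext y k := fun x y k => by
    simp only [ext]; split_ifs <;> simp
  have hsmul : ∀ (c : F) x k, ext (c • x) k = c * ext x k := fun c x k => by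
    simp only [ext]; split_ifs <;> simp
  let f : (Fin I.width → F) →ₗ[F] (Fin (I.n * I.l) × Fin I.w → F) :=
    { toFun := fun x p => I.interpEval (I.interpPoly (ext x)) p.1 p.2
      map_add' := fun x y => by
        funext p
        simp only [interpEval, interpPoly, eval_polyOf, hadd, add_mul, Finset.sum_add_distrib,
          Pi.add_apply]
        ring
      map_smul' := fun c x => by
        funext p
        simp only [interpEval, interpPoly, eval_polyOf, hsmul, mul_assoc, ← Finset.mul_sum,
          Pi.smul_apply, smul_eq_mul, RingHom.id_apply, mul_add] }
  have hlt : finrank F (Fin (I.n * I.l) × Fin I.w → F) < finrank F (Fin I.width → F) := by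
    simp only [Module.finrank_fintype_fun_eq_card, Fintype.card_prod, Fintype.card_fin]
    exact (Nat.lt_mul_div_succ (I.n * I.l * I.w) (Nat.succ_pos I.m))
  obtain ⟨x, hx, hx0⟩ := (Submodule.ne_bot_iff _).1 (LinearMap.ker_ne_bot_of_finrank_lt (f := f) hlt)
  refine ⟨ext x, fun k hk => dif_neg (by omega), ?_, fun u hu j hj => ?_⟩
  · intro h0
    refine hx0 (funext fun k => ?_)
    have := congrFun h0 k
    simpa [ext] using this
  · exact congrFun (LinearMap.mem_ker.1 hx) (⟨u, hu⟩, ⟨j, hj⟩)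

theorem Valid.card_mul_pow_le (h : I.Valid) (Λ : Finset F[X]) (hΛ : ∀ P ∈ Λ, I.InList P) :
    Λ.card * (I.n - I.e) ^ I.t ≤ 2 * (I.n * I.l) ^ I.t := by
  obtain ⟨x, hx, hx0, hev⟩ := exists_interp I
  exact (isInterp_interpPoly hx hx0 hev).card_mul_pow_le h Λ hΛ

end Inst

end FoldedRS
end

/-! ### Bounds in terms of `ℓ / ε` -/

noncomputable section

namespace FoldedRS

universe u

set_option linter.unusedSectionVars false

open Polynomial Module

variable {F : Type u} [Field F]

namespace Inst

variable {I : Inst F}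

/-- Unique decoding with lists of size one. -/
theorem InList.eq_of_l_eq_one (h : I.Valid) (hl : I.l = 1) (hE : I.s * I.n < 2 * I.E) {P Q : F[X]}
    (hP : I.InList P) (hQ : I.InList Q) : P = Q := by
  classical
  let HP := (Finset.range I.n).filter fun i => I.Hit P i
  let HQ := (Finset.range I.n).filter fun i => I.Hit Q i
  -- `P` and `Q` share at least `n - 2 e` hit coordinates, each with only one possible value. They
  -- agree at `s (n - 2 e) > d` points at least, because `2 E > s n`.
  let S := ((HP ∩ HQ) ×ˢ Finset.range I.s).image fun p => I.g ^ p.2 * I.a p.1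
  have h1 : I.n - I.e ≤ HP.card := hP.sub_le_card_hit
  have h2 : I.n - I.e ≤ HQ.card := hQ.sub_le_card_hit
  have h3 : (HP ∪ HQ).card ≤ I.n := by
    refine (Finset.card_le_card (t := Finset.range I.n) ?_).trans_eq (Finset.card_range _)
    exact Finset.union_subset (Finset.filter_subset _ _) (Finset.filter_subset _ _)
  have h4 := Finset.card_union_add_card_inter HP HQ
  have hS : S.card = (HP ∩ HQ).card * I.s := by
    rw [Finset.card_image_of_injOn, Finset.card_product, Finset.card_range]
    rintro ⟨i, j⟩ hp ⟨i', j'⟩ hp' heq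
    simp only [HP, HQ, Finset.coe_product, Set.mem_prod, Finset.mem_coe, Finset.mem_range,
      Finset.mem_filter, Finset.mem_inter] at hp hp'
    obtain ⟨h1, h2⟩ := h.inj i hp.1.1.1 i' hp'.1.1.1 j hp.2 j' hp'.2 heq
    exact Prod.ext h1 h2
  rw [← sub_eq_zero]
  refine eq_zero_of_natDegree_lt_card_of_eval_eq_zero' _ S ?_ ?_
  · intro x hx
    obtain ⟨⟨i, j⟩, hp, rfl⟩ := Finset.mem_image.1 hx
    simp only [HP, HQ, Finset.mem_product, Finset.mem_range, Finset.mem_filter,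
      Finset.mem_inter] at hp
    obtain ⟨⟨⟨-, k, hk, ha⟩, -, k', hk', ha'⟩, hj⟩ := hp
    have e1 := ha j hj
    have e2 := ha' j hj
    rw [hl, Nat.div_one, mul_one] at e1 e2
    obtain rfl : k = 0 := by omega
    obtain rfl : k' = 0 := by omega
    rw [eval_sub, sub_eq_zero]
    exact e1.trans e2.symm
  · rw [hS]
    refine lt_of_le_of_lt ((natDegree_sub_le _ _).trans (max_le hP.1 hQ.1)) ?_
    have h5 := h.s_mul_n
    have h6 := h.e_lt
    have h7 : I.s * (I.n - 2 * I.e) ≤ (HP ∩ HQ).card * I.s := by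
      rw [mul_comm]
      exact Nat.mul_le_mul_right _ (by omega)
    refine lt_of_lt_of_le ?_ h7
    rw [Nat.mul_sub, show I.s * (2 * I.e) = 2 * (I.s * I.e) by ring]
    omega

/-- A bound for the number of outcomes of a trial divided by the number of good ones. -/
def h (I : Inst F) : ℕ := I.n * I.l / (I.n - I.e) + 1

/-- A bound for the inverse of the success probability of a trial. -/
def Z (I : Inst F) : ℕ := 2 * I.h ^ I.t

section bounds

variable {ε : ℝ}

theorem Valid.eps_le_one (h : I.Valid) (hE : ε * (I.s * I.n) ≤ I.E) : ε ≤ 1 := by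
  have h1 : (I.E : ℝ) ≤ I.s * I.n := by
    have := h.s_mul_n
    exact_mod_cast (by omega : I.E ≤ I.s * I.n)
  have h2 : (0 : ℝ) < I.s * I.n := by exact_mod_cast Nat.mul_pos h.s_pos h.n_pos
  by_contra hlt
  nlinarith

theorem Valid.ratio_le (h : I.Valid) (hε : 0 < ε) (hE : ε * (I.s * I.n) ≤ I.E) :
    ((I.s * I.n : ℕ) : ℝ) / I.E ≤ 1 / ε := by
  have hE0 : (0 : ℝ) < I.E := by exact_mod_cast h.E_pos
  rw [div_le_div_iff₀ hE0 hε]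
  push_cast
  linarith

theorem Valid.K_le (h : I.Valid) (hε : 0 < ε) (hE : ε * (I.s * I.n) ≤ I.E) :
    (I.K : ℝ) ≤ 2 / ε + 1 := by
  have h1 : ((2 * I.s * I.n / I.E : ℕ) : ℝ) ≤ ((2 * I.s * I.n : ℕ) : ℝ) / I.E := Nat.cast_div_le
  have h2 := h.ratio_le hε hE
  have h3 : ((2 * I.s * I.n : ℕ) : ℝ) / I.E = 2 * (((I.s * I.n : ℕ) : ℝ) / I.E) := by
    push_cast
    ring
  have h4 : 2 / ε = 2 * (1 / ε) := by ring
  unfold K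
  push_cast at *
  linarith

theorem Valid.m_le (h : I.Valid) (hε : 0 < ε) (hE : ε * (I.s * I.n) ≤ I.E) :
    (I.m : ℝ) ≤ 4 * (I.l / ε) := by
  have h1 : ((4 * I.l * I.s * I.n / I.E : ℕ) : ℝ) ≤ ((4 * I.l * I.s * I.n : ℕ) : ℝ) / I.E :=
    Nat.cast_div_le
  have h2 := mul_le_mul_of_nonneg_left (h.ratio_le hε hE) (by positivity : (0 : ℝ) ≤ 4 * I.l)
  have h3 : ((4 * I.l * I.s * I.n : ℕ) : ℝ) / I.E = 4 * I.l * (((I.s * I.n : ℕ) : ℝ) / I.E) := by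
    push_cast
    ring
  have h4 : 4 * (I.l / ε) = 4 * I.l * (1 / ε) := by ring
  unfold m
  linarith

theorem Valid.n_div_le (h : I.Valid) (hε : 0 < ε) (hE : ε * (I.s * I.n) ≤ I.E) :
    ((I.n * I.l : ℕ) : ℝ) / ((I.n - I.e : ℕ) : ℝ) ≤ I.l / ε := by
  have h0 : (0 : ℝ) < ((I.n - I.e : ℕ) : ℝ) := by
    have := h.e_lt
    exact_mod_cast (by omega : 0 < I.n - I.e)
  have hs : (0 : ℝ) < I.s := by exact_mod_cast h.s_pos
  rw [div_le_div_iff₀ h0 hε]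
  have h1 : I.E ≤ I.s * (I.n - I.e) := by
    rw [Nat.mul_sub]
    have := h.s_mul_n
    omega
  have h2 : (I.E : ℝ) ≤ I.s * ((I.n - I.e : ℕ) : ℝ) := by exact_mod_cast h1
  have h3 : ε * I.n ≤ ((I.n - I.e : ℕ) : ℝ) := by
    refine le_of_mul_le_mul_left ?_ hs
    nlinarith
  push_cast
  nlinarith [(Nat.cast_nonneg I.l : (0 : ℝ) ≤ I.l)]

/-- `K ≤ 3 / ε`, and `2 m ≤ 8 ℓ / ε` has bit length at most `4 + log₂ (ℓ / ε) ≤ 5 log₂ (ℓ / ε)`,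
where `ℓ / ε ≥ 2` makes the logarithm at least one. -/
theorem Valid.t_le (h : I.Valid) (hε : 0 < ε) (hE : ε * (I.s * I.n) ≤ I.E)
    (hx : 2 ≤ (I.l : ℝ) / ε) : (I.t : ℝ) ≤ 15 * (Real.logb 2 (I.l / ε) / ε) := by
  have hε1 := h.eps_le_one hE
  have hm := h.m_le hε hE
  have hK := h.K_le hε hE
  set x := (I.l : ℝ) / ε
  have hlog : 1 ≤ Real.logb 2 x := by
    rw [Real.le_logb_iff_rpow_le (by norm_num) (by linarith)]
    simpa using hx
  have hK3 : (I.K : ℝ) ≤ 3 / ε := by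
    have : 1 ≤ 1 / ε := by rw [le_div_iff₀ hε]; linarith
    have h3 : 3 / ε = 2 / ε + 1 / ε := by ring
    linarith
  have hsize : (Nat.size (2 * I.m) : ℝ) ≤ 5 * Real.logb 2 x := by
    have hm0 := h.m_pos
    obtain ⟨k, hk⟩ : ∃ k, Nat.size (2 * I.m) = k + 1 :=
      Nat.exists_eq_succ_of_ne_zero (by have := Nat.size_pos.2 (by omega : 0 < 2 * I.m); omega)
    have h1 : 2 ^ k ≤ 2 * I.m := Nat.lt_size.1 (by omega)
    have h2 : (k : ℝ) ≤ 3 + Real.logb 2 x := by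
      have h3 : (2 : ℝ) ^ (k : ℝ) ≤ 8 * x := by
        rw [Real.rpow_natCast]
        calc (2 : ℝ) ^ k ≤ 2 * I.m := by exact_mod_cast h1
          _ ≤ 8 * x := by linarith
      have h4 : (k : ℝ) ≤ Real.logb 2 (8 * x) := by
        rwa [Real.le_logb_iff_rpow_le (by norm_num) (by linarith)]
      rw [Real.logb_mul (by norm_num) (by linarith), show (8 : ℝ) = 2 ^ (3 : ℝ) by norm_num,
        Real.logb_rpow (by norm_num) (by norm_num)] at h4
      exact h4
    rw [hk]
    push_cast
    linarith
  unfold t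
  push_cast
  calc (I.K : ℝ) * Nat.size (2 * I.m) ≤ 3 / ε * (5 * Real.logb 2 x) := by gcongr
    _ = _ := by ring

theorem Valid.one_le_ratio (h : I.Valid) (hε : 0 < ε) (hE : ε * (I.s * I.n) ≤ I.E) :
    1 ≤ (I.l : ℝ) / ε := by
  rw [le_div_iff₀ hε]
  have : (1 : ℝ) ≤ I.l := by exact_mod_cast h.l_pos
  linarith [h.eps_le_one hE]

/-- The case left out by `t_le`. There `ℓ / ε` may be `1`, so no power of it absorbs a constant, and
unique decoding takes over. -/
theorem Valid.l_eq_one (h : I.Valid) (hε : 0 < ε) (hE : ε * (I.s * I.n) ≤ I.E)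
    (hx : ¬2 ≤ (I.l : ℝ) / ε) : I.l = 1 ∧ I.s * I.n < 2 * I.E := by
  have hε1 := h.eps_le_one hE
  rw [le_div_iff₀ hε, not_le] at hx
  have h1 : (I.l : ℝ) < 2 := by linarith
  have h2 : I.l < 2 := by exact_mod_cast h1
  have hl : I.l = 1 := by have := h.l_pos; omega
  refine ⟨hl, ?_⟩
  rw [hl, Nat.cast_one] at hx
  have h3 : (0 : ℝ) < I.s * I.n := by exact_mod_cast Nat.mul_pos h.s_pos h.n_pos
  have : (I.s * I.n : ℝ) < 2 * I.E := by nlinarith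
  exact_mod_cast this

/-- For `x = ℓ / ε ≥ 2`, the bound `2 x ^ t` is at most `x ^ (1 + t)`, and `1 + 15` gives the
constant `16`. For `x < 2` the list has at most one element, which any power of `x` with nonnegative
exponent bounds. -/
theorem Valid.card_le_listSize (h : I.Valid) (hε : 0 < ε) (hE : ε * (I.s * I.n) ≤ I.E) {C : ℕ}
    (hC : 16 ≤ C) (Λ : Finset F[X]) (hΛ : ∀ P ∈ Λ, I.InList P) : Λ.card ≤ listSize C I.l ε := by
  have hx1 := h.one_le_ratio hε hE
  have hε1 := h.eps_le_one hE
  have hC' : (16 : ℝ) ≤ C := by exact_mod_cast hC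
  have hε' : 1 ≤ 1 / ε := by rw [le_div_iff₀ hε]; linarith
  unfold listSize
  by_cases hx : 2 ≤ (I.l : ℝ) / ε
  · have ht := h.t_le hε hE hx
    have hcard := h.card_mul_pow_le Λ hΛ
    have hdiv := h.n_div_le hε hE
    set x := (I.l : ℝ) / ε
    have hlog : 1 ≤ Real.logb 2 x := by
      rw [Real.le_logb_iff_rpow_le (by norm_num) (by linarith)]
      simpa using hx
    refine Nat.le_floor ?_
    have h0 : (0 : ℝ) < ((I.n - I.e : ℕ) : ℝ) := by
      have := h.e_lt
      exact_mod_cast (by omega : 0 < I.n - I.e)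
    have h1 : (Λ.card : ℝ) ≤ 2 * x ^ I.t := by
      have h2 : (Λ.card : ℝ) * ((I.n - I.e : ℕ) : ℝ) ^ I.t ≤ 2 * ((I.n * I.l : ℕ) : ℝ) ^ I.t := by
        exact_mod_cast hcard
      rw [← le_div_iff₀ (by positivity), mul_div_assoc, ← div_pow] at h2
      refine h2.trans ?_
      gcongr
    refine h1.trans ?_
    calc 2 * x ^ I.t ≤ x ^ (1 : ℝ) * x ^ (I.t : ℝ) := by
          rw [Real.rpow_one, Real.rpow_natCast]
          gcongr
      _ = x ^ (1 + (I.t : ℝ)) := by rw [Real.rpow_add (by linarith)]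
      _ ≤ _ := by
          refine Real.rpow_le_rpow_of_exponent_le hx1 ?_
          have h3 : 1 ≤ 1 / ε * Real.logb 2 x := by nlinarith
          have h4 : 15 * (Real.logb 2 x / ε) = 15 * (1 / ε * Real.logb 2 x) := by ring
          nlinarith
  · obtain ⟨hl, hE2⟩ := h.l_eq_one hε hE hx
    have h1 : Λ.card ≤ 1 := Finset.card_le_one.2 fun P hP Q hQ =>
      (hΛ P hP).eq_of_l_eq_one h hl hE2 (hΛ Q hQ)
    refine h1.trans (Nat.le_floor ?_)
    rw [Nat.cast_one]
    refine Real.one_le_rpow hx1 ?_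
    have := Real.logb_nonneg (b := 2) (by norm_num) hx1
    positivity

/-- If `x = ℓ / ε ≥ 2`, then `h ≤ x + 1 ≤ x ^ 2` and `Z ≤ x ^ (1 + 2 t)`, whence the exponent `31 =
1 + 2 * 15`. If `x < 2`, all parameters are bounded: `t ≤ 4 * 4` and `h ≤ 2`, whence `Z ≤ 2 ^ 17`.
-/
theorem Valid.Z_le (h : I.Valid) (hε : 0 < ε) (hE : ε * (I.s * I.n) ≤ I.E) :
    (I.Z : ℝ) ≤ 2 ^ 17 * (((I.l : ℝ) / ε) ^ (Real.logb 2 (I.l / ε) / ε)) ^ 31 := by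
  have hx1 := h.one_le_ratio hε hE
  have hε1 := h.eps_le_one hE
  have hlog0 := Real.logb_nonneg (b := 2) (by norm_num) hx1
  have hε' : 1 ≤ 1 / ε := by rw [le_div_iff₀ hε]; linarith
  have hone : 1 ≤ ((I.l : ℝ) / ε) ^ (Real.logb 2 (I.l / ε) / ε) :=
    Real.one_le_rpow hx1 (by positivity)
  by_cases hx : 2 ≤ (I.l : ℝ) / ε
  · have ht := h.t_le hε hE hx
    have hdiv := h.n_div_le hε hE
    set x := (I.l : ℝ) / ε
    have hlog : 1 ≤ Real.logb 2 x := by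
      rw [Real.le_logb_iff_rpow_le (by norm_num) (by linarith)]
      simpa using hx
    have hh : (I.h : ℝ) ≤ x ^ (2 : ℝ) := by
      have h1 : ((I.n * I.l / (I.n - I.e) : ℕ) : ℝ) ≤ _ := Nat.cast_div_le
      have h2 : x ^ (2 : ℝ) = x * x := by
        rw [show (2 : ℝ) = (2 : ℕ) by norm_num, Real.rpow_natCast, sq]
      rw [h2]
      unfold Inst.h
      rw [Nat.cast_add, Nat.cast_one]
      nlinarith
    have hlogε : Real.logb 2 x / ε = 1 / ε * Real.logb 2 x := by ring
    calc (I.Z : ℝ) = 2 * (I.h : ℝ) ^ I.t := by simp [Z]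
      _ ≤ x ^ (1 : ℝ) * (x ^ (2 : ℝ)) ^ I.t := by
          rw [Real.rpow_one]
          gcongr
      _ = x ^ (1 + 2 * (I.t : ℝ)) := by
          rw [← Real.rpow_natCast, ← Real.rpow_mul (by linarith), ← Real.rpow_add (by linarith)]
      _ ≤ x ^ (Real.logb 2 x / ε * (31 : ℕ)) := by
          refine Real.rpow_le_rpow_of_exponent_le hx1 ?_
          have h3 : 1 ≤ 1 / ε * Real.logb 2 x := by nlinarith
          push_cast
          linarith
      _ = (x ^ (Real.logb 2 x / ε)) ^ 31 := by rw [Real.rpow_mul (by linarith), Real.rpow_natCast]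
      _ ≤ _ := le_mul_of_one_le_left (by positivity) (by norm_num)
  · obtain ⟨hl, hE2⟩ := h.l_eq_one hε hE hx
    have hE0 := h.E_pos
    have hK : I.K ≤ 4 := by
      have : 2 * I.s * I.n / I.E < 4 := (Nat.div_lt_iff_lt_mul hE0).2 (by nlinarith)
      unfold K
      omega
    have hm : I.m ≤ 7 := by
      have : 4 * I.l * I.s * I.n / I.E < 8 := (Nat.div_lt_iff_lt_mul hE0).2 (by rw [hl]; nlinarith)
      unfold m
      omega
    have hsize : Nat.size (2 * I.m) ≤ 4 := Nat.size_le.2 (by omega)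
    have ht : I.t ≤ 16 := Nat.mul_le_mul hK hsize
    have hh : I.h ≤ 2 := by
      have h1 := h.e_lt
      have h2 := h.s_mul_n
      have h3 : I.n < 2 * (I.n - I.e) := by
        refine Nat.lt_of_mul_lt_mul_left (a := I.s) ?_
        rw [show I.s * (2 * (I.n - I.e)) = 2 * (I.s * I.n - I.s * I.e) by
          rw [← Nat.mul_sub]; ring]
        omega
      have : I.n * I.l / (I.n - I.e) < 2 := (Nat.div_lt_iff_lt_mul (by omega)).2 (by rw [hl]; omega)
      unfold Inst.h
      omega
    have hZ : I.Z ≤ 2 ^ 17 := by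
      calc I.Z ≤ 2 * 2 ^ I.t := Nat.mul_le_mul_left _ (Nat.pow_le_pow_left hh _)
        _ ≤ 2 * 2 ^ 16 := Nat.mul_le_mul_left _ (Nat.pow_le_pow_right (by norm_num) ht)
        _ = 2 ^ 17 := by norm_num
    calc (I.Z : ℝ) ≤ 2 ^ 17 := by exact_mod_cast hZ
      _ ≤ _ := le_mul_of_one_le_right (by positivity) (one_le_pow₀ hone)

end bounds

end Inst

end FoldedRS
end

noncomputable section

namespace FoldedRS

universe u

set_option linter.unusedSectionVars false
set_option linter.unusedSimpArgs false

open Polynomial Module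

variable {F : Type u} [Field F]

namespace Prog

/-! ### Linear algebra programs

The arrays `4` and `5` of field elements hold a linear equation and the rows of a square matrix that
span the space of solutions. The other arrays of field elements used here are `6` (pivot row), `7`
(inverse of the value at the pivot row), `8` (accumulator), `9` (power) and `10` (base). -/

/-- Write the values of `e` for `v = 0, …, len - 1` into the cells `off + v`. -/
def fill (A v len : ℕ) (off : NExpr) (e : FExpr) : Prog :=
  for' v len (setF A (.add off (.var v)) e)

@[simp] theorem writesN_fill (A v len off e) : (fill A v len off e).writesN = [v, v] := rfl
@[simp] theorem writesF_fill (A v len off e) : (fill A v len off e).writesF = [A] := rfl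

/-- The value of `e` may depend on the cell about to be overwritten, which still has its old
content. This allows rows to be updated in place. -/
theorem fill_spec {A v len : ℕ} {off : NExpr} {e : FExpr} (σ : State F) (o : ℕ) (g : ℕ → F)
    (hlen : len ≠ v)
    (hoff : ∀ τ : State F, (∀ B, B ≠ v → τ.nat B = σ.nat B) → off.eval τ = o)
    (he : ∀ k < σ.nat len 0, ∀ τ : State F, τ.nat v 0 = k → (∀ B, B ≠ v → τ.nat B = σ.nat B) →
      (∀ B, B ≠ A → τ.fld B = σ.fld B) → τ.fld A (o + k) = σ.fld A (o + k) → e.eval τ = g k) :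
    ((fill A v len off e).det σ).fld A =
      fun i => if o ≤ i ∧ i < o + σ.nat len 0 then g (i - o) else σ.fld A i := by
  refine for'_rule_fld (fun k f => f A =
      fun i => if o ≤ i ∧ i < o + k then g (i - o) else σ.fld A i) v len _ σ (by simp [writesN])
    (by simp [writesN]) hlen ?_ ?_
  · funext i
    rw [if_neg (by omega)]
  · intro k hk τ hv hn hf hI
    have hn' : ∀ B, B ≠ v → τ.nat B = σ.nat B := fun B hB => hn B hB (by simp [writesN])
    have hf' : ∀ B, B ≠ A → τ.fld B = σ.fld B := fun B hB => hf B (by simpa [writesF])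
    have hev := he k hk τ hv hn' hf' (by rw [hI]; exact if_neg (by omega))
    simp only [det_setF_fld, Function.update_self, NExpr.eval, hoff τ hn', hev, NExpr.eval_var, hv]
    funext i
    rw [hI]
    rcases eq_or_ne i (o + k) with rfl | hi
    · rw [Function.update_self, if_pos (by omega), Nat.add_sub_cancel_left]
    · rw [Function.update_of_ne hi]
      by_cases h1 : o ≤ i ∧ i < o + k
      · rw [if_pos h1, if_pos (by omega)]
      · rw [if_neg h1, if_neg (by omega)]

/-- Clear the linear equation. -/
def zeroRow (W : ℕ) : Prog := fill 4 30 W (.const 0) .zero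

@[simp] theorem writesN_zeroRow (W) : (zeroRow W).writesN = [30, 30] := rfl
@[simp] theorem writesF_zeroRow (W) : (zeroRow W).writesF = [4] := rfl

theorem zeroRow_spec {W : ℕ} (hW : W ≠ 30) (σ : State F) {k : ℕ} (hk : k < σ.nat W 0) :
    ((zeroRow W).det σ).fld 4 k = 0 := by
  rw [zeroRow, fill_spec σ 0 (fun _ => 0) hW (fun _ _ => rfl) fun _ _ _ _ _ _ _ => rfl]
  simp [hk]

/-- Add the multiples of the powers of the base to a part of the linear equation. -/
def addPow (off : NExpr) (len : ℕ) : Prog :=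
  for' 30 len (seq
    (setF 4 (.add off (.var 30)) (.add (.read 4 (.add off (.var 30))) (.var 9)))
    (letF 9 (.mul (.var 9) (.var 10))))

@[simp] theorem writesN_addPow (off len) : (addPow off len).writesN = [30, 30] := rfl
@[simp] theorem writesF_addPow (off len) : (addPow off len).writesF = [4, 9] := rfl

/-- Equations are described by their value at every vector `x`, not by their coefficients. Adding
scaled powers of the base then adds a scaled value of the polynomial stored in a block of `x`. -/
theorem addPow_spec {off : NExpr} {len : ℕ} (σ : State F) (o wd : ℕ) (hlen : len ≠ 30)
    (hoff : ∀ τ : State F, (∀ B, B ≠ 30 → τ.nat B = σ.nat B) → off.eval τ = o)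
    (hwd : o + σ.nat len 0 ≤ wd) (x : ℕ → F) :
    ∑ k ∈ Finset.range wd, ((addPow off len).det σ).fld 4 k * x k =
      ∑ k ∈ Finset.range wd, σ.fld 4 k * x k +
        σ.fld 9 0 * (polyOf x o (σ.nat len 0)).eval (σ.fld 10 0) := by
  refine (for'_rule_fld (fun k f => f 9 0 = σ.fld 9 0 * σ.fld 10 0 ^ k ∧
      ∑ i ∈ Finset.range wd, f 4 i * x i = ∑ i ∈ Finset.range wd, σ.fld 4 i * x i +
        σ.fld 9 0 * (polyOf x o k).eval (σ.fld 10 0)) 30 len _ σ (by simp [writesN])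
    (by simp [writesN]) hlen ?_ ?_).2
  · simp [eval_polyOf]
  · rintro k hk τ hv hn hf ⟨h1, h2⟩
    have hn' : ∀ B, B ≠ 30 → τ.nat B = σ.nat B := fun B hB => hn B hB (by simp [writesN])
    have h10 : τ.fld 10 = σ.fld 10 := hf 10 (by simp [writesF])
    constructor
    · simp [FExpr.eval, h1, h10, pow_succ, mul_assoc]
    · have hval : (seq (setF 4 (.add off (.var 30)) (.add (.read 4 (.add off (.var 30))) (.var 9)))
          (letF 9 (.mul (.var 9) (.var 10))) |>.det τ).fld 4 =
          Function.update (τ.fld 4) (o + k) (τ.fld 4 (o + k) + σ.fld 9 0 * σ.fld 10 0 ^ k) := by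
        simp [FExpr.eval, NExpr.eval, hoff τ hn', hv, h1]
      rw [hval]
      have hmem : o + k ∈ Finset.range wd := Finset.mem_range.2 (by omega)
      rw [← Finset.add_sum_erase _ _ hmem] at h2 ⊢
      rw [Function.update_self, Finset.sum_congr rfl fun i hi => by
        rw [Function.update_of_ne (Finset.ne_of_mem_erase hi)], add_mul, add_right_comm, h2]
      simp only [eval_polyOf, Finset.sum_range_succ]
      ring

/-- Evaluate a polynomial at the base. -/
def evalPoly (A : ℕ) (off : NExpr) (len : ℕ) : Prog :=
  seq (letF 8 .zero) (seq (letF 9 .one) (for' 30 len (seq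
    (letF 8 (.add (.var 8) (.mul (.read A (.add off (.var 30))) (.var 9))))
    (letF 9 (.mul (.var 9) (.var 10))))))

@[simp] theorem writesN_evalPoly (A off len) : (evalPoly A off len).writesN = [30, 30] := rfl
@[simp] theorem writesF_evalPoly (A off len) : (evalPoly A off len).writesF = [8, 9, 8, 9] := rfl

theorem evalPoly_spec {A : ℕ} {off : NExpr} {len : ℕ} (σ : State F) (o : ℕ) (hlen : len ≠ 30)
    (hA8 : A ≠ 8) (hA9 : A ≠ 9)
    (hoff : ∀ τ : State F, (∀ B, B ≠ 30 → τ.nat B = σ.nat B) → off.eval τ = o) :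
    ((evalPoly A off len).det σ).fld 8 0 =
      (polyOf (σ.fld A) o (σ.nat len 0)).eval (σ.fld 10 0) := by
  rw [evalPoly, det_seq, det_seq]
  set σ' := (letF 9 .one).det ((letF 8 .zero).det σ)
  have h10 : σ'.fld 10 = σ.fld 10 := rfl
  have hfA : σ'.fld A = σ.fld A := by simp [σ', hA8, hA9]
  have hn0 : σ'.nat = σ.nat := rfl
  refine (for'_rule_fld (fun k f => f 9 0 = σ.fld 10 0 ^ k ∧
      f 8 0 = (polyOf (σ.fld A) o k).eval (σ.fld 10 0)) 30 len _ σ' (by simp [writesN])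
    (by simp [writesN]) hlen ?_ ?_).2
  · simp [σ', eval_polyOf, FExpr.eval]
  · rintro k hk τ hv hn hf ⟨h1, h2⟩
    have hn' : ∀ B, B ≠ 30 → τ.nat B = σ.nat B := fun B hB => hn B hB (by simp [writesN])
    have h10' : τ.fld 10 = σ.fld 10 := (hf 10 (by simp [writesF])).trans h10
    have hA' : τ.fld A = σ.fld A := (hf A (by simp [writesF, hA8, hA9])).trans hfA
    constructor
    · simp [FExpr.eval, h1, h10', pow_succ]
    · simp only [eval_polyOf] at h2 ⊢
      rw [Finset.sum_range_succ, ← h2]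
      simp [FExpr.eval, NExpr.eval, hoff τ hn', hv, h1, hA']

/-- The value of the linear equation at a row of the matrix. -/
def dot (W : ℕ) : Prog :=
  seq (letF 8 .zero) (for' 30 W (letF 8 (.add (.var 8)
    (.mul (.read 4 (.var 30)) (.read 5 (.add (.mul (.var 31) (.var W)) (.var 30)))))))

@[simp] theorem writesN_dot (W) : (dot W).writesN = [30, 30] := rfl
@[simp] theorem writesF_dot (W) : (dot W).writesF = [8, 8] := rfl

theorem dot_spec {W : ℕ} (hW : W ≠ 30) (σ : State F) :
    ((dot W).det σ).fld 8 0 = ∑ k ∈ Finset.range (σ.nat W 0),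
      σ.fld 4 k * σ.fld 5 (σ.nat 31 0 * σ.nat W 0 + k) := by
  rw [dot, det_seq]
  refine for'_rule_fld (fun k f => f 8 0 = ∑ k ∈ Finset.range k,
      σ.fld 4 k * σ.fld 5 (σ.nat 31 0 * σ.nat W 0 + k)) 30 W _ ((letF 8 .zero).det σ)
    (by simp [writesN]) (by simp [writesN]) hW ?_ ?_
  · simp [FExpr.eval]
  · intro k hk τ hv hn hf h
    have h31 : τ.nat 31 = σ.nat 31 := hn 31 (by simp) (by simp [writesN])
    have hWW : τ.nat W = σ.nat W := hn W hW (by simp [writesN])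
    have h4 : τ.fld 4 = σ.fld 4 := hf 4 (by simp [writesF])
    have h5 : τ.fld 5 = σ.fld 5 := hf 5 (by simp [writesF])
    rw [Finset.sum_range_succ, ← h]
    simp [FExpr.eval, NExpr.eval, hv, h31, hWW, h4, h5]

/-- Intersect the span of the rows of the matrix with the solutions of the linear equation. -/
def addEquation (W : ℕ) : Prog :=
  seq (letF 7 .zero) (for' 31 W (seq (dot W) (seq
    (ite (.eq (.var 7) .zero) (seq (letF 7 (.inv (.var 8)))
      (fill 6 30 W (.const 0) (.read 5 (.add (.mul (.var 31) (.var W)) (.var 30))))) skip)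
    (fill 5 30 W (.mul (.var 31) (.var W))
      (.sub (.read 5 (.add (.mul (.var 31) (.var W)) (.var 30)))
        (.mul (.mul (.var 8) (.var 7)) (.read 6 (.var 30))))))))

@[simp] theorem writesN_addEquation (W) :
    (addEquation W).writesN = [31, 30, 30, 30, 30, 30, 30, 31] := rfl
@[simp] theorem writesF_addEquation (W) : (addEquation W).writesF = [7, 8, 8, 7, 6, 5] := rfl

end Prog

/-- A vector of length `wd` as a sequence. -/
def trunc (wd : ℕ) (v : ℕ → F) : ℕ → F := fun k => if k < wd then v k else 0

/-- Row `j` of a square matrix. -/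
def rowOf (B : ℕ → F) (wd j : ℕ) : ℕ → F := trunc wd fun k => B (j * wd + k)

/-- The vectors of length `wd` with the property `P` form the span of the rows of the matrix. -/
def RowsSpan (B : ℕ → F) (wd : ℕ) (P : (ℕ → F) → Prop) : Prop :=
  ∀ x : ℕ → F, x ∈ Submodule.span F (rowOf B wd '' Set.Iio wd) ↔ (∀ k, wd ≤ k → x k = 0) ∧ P x

/-- The value of a linear equation at a vector. -/
def rowVal (R : ℕ → F) (wd : ℕ) : (ℕ → F) →ₗ[F] F where
  toFun x := ∑ k ∈ Finset.range wd, R k * x k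
  map_add' x y := by simp [mul_add, Finset.sum_add_distrib]
  map_smul' c x := by simp [Finset.mul_sum, mul_left_comm]

theorem rowVal_apply (R : ℕ → F) (wd : ℕ) (x : ℕ → F) :
    rowVal R wd x = ∑ k ∈ Finset.range wd, R k * x k := rfl

theorem rowVal_rowOf (R B : ℕ → F) (wd j : ℕ) :
    rowVal R wd (rowOf B wd j) = ∑ k ∈ Finset.range wd, R k * B (j * wd + k) :=
  (rowVal_apply R wd _).trans <| Finset.sum_congr rfl fun k hk => by
    simp [rowOf, trunc, Finset.mem_range.1 hk]

theorem cell_inj {wd i j k l : ℕ} (hk : k < wd) (hl : l < wd)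
    (h : i * wd + k = j * wd + l) : i = j := by
  have h1 := congrArg (· / wd) h
  simpa [Nat.add_div_of_dvd_right, Nat.mul_div_cancel _ (by omega : 0 < wd), Nat.div_eq_of_lt hk,
    Nat.div_eq_of_lt hl, Nat.mul_add_div (by omega : 0 < wd), mul_comm _ wd] using h1

namespace Prog

/-- One step of elimination. The first row `p` with `φ p ≠ 0` is the pivot; it and all later rows
`r` are replaced by `r - (φ r / φ p) • p`, so that the pivot row becomes zero. Earlier rows already
satisfy the equation. -/
theorem addEquation_spec {W : ℕ} (hW : W ≠ 30) (hW' : W ≠ 31) (σ : State F) {P : (ℕ → F) → Prop}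
    (hP : RowsSpan (σ.fld 5) (σ.nat W 0) P) :
    RowsSpan (((addEquation W).det σ).fld 5) (σ.nat W 0)
      (fun x => P x ∧ rowVal (σ.fld 4) (σ.nat W 0) x = 0) := by
  set wd := σ.nat W 0 with hwd
  set B := σ.fld 5 with hB
  set φ := rowVal (σ.fld 4) wd with hφ
  -- Cell `f 7 0` holds the inverse of the value at the pivot, and is zero until a pivot is met.
  -- Since the inverse of zero is zero, rows that satisfy the equation leave it zero and are not
  -- changed.
  let I : ℕ → (ℕ → ℕ → F) → Prop := fun j f =>
      (∀ i, j ≤ i → i < wd → rowOf (f 5) wd i = rowOf B wd i) ∧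
      (f 7 0 = 0 → ∀ i < j, rowOf (f 5) wd i = rowOf B wd i ∧ φ (rowOf B wd i) = 0) ∧
      (f 7 0 ≠ 0 → φ (trunc wd (f 6)) * f 7 0 = 1 ∧
        trunc wd (f 6) ∈ Submodule.span F (rowOf B wd '' Set.Iio wd) ∧
        ∀ i < j, φ (rowOf (f 5) wd i) = 0 ∧
          ∃ c : F, rowOf B wd i = rowOf (f 5) wd i + c • trunc wd (f 6))
  have key : I wd ((addEquation W).det σ).fld := by
    rw [addEquation, det_seq]
    refine for'_rule_fld I 31 W _ ((letF 7 .zero).det σ) (by simp [writesN])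
      (by simp [writesN, hW]) hW' ?_ ?_
    · refine ⟨fun i _ _ => rfl, fun _ i hi => absurd hi (by omega), fun h => ?_⟩
      exact absurd rfl h
    · rintro j hj τ hv hn hf ⟨h1, h2, h3⟩
      have hj' : j < wd := hj
      have hWW : τ.nat W 0 = wd := by rw [hn W hW' (by simp [writesN, hW])]; rfl
      have h4 : τ.fld 4 = σ.fld 4 := hf 4 (by simp [writesF])
      simp only [det_seq]
      set τ₁ := (dot W).det τ with hτ₁
      have hrow : rowOf (τ.fld 5) wd j = rowOf B wd j := h1 j le_rfl hj
      have hdot : τ₁.fld 8 0 = φ (rowOf B wd j) := by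
        rw [dot_spec hW, ← hrow, hφ, rowVal_rowOf, hWW, hv, h4]
      have e5 : τ₁.fld 5 = τ.fld 5 := det_fld_of_notMem _ (by simp) _
      have e6 : τ₁.fld 6 = τ.fld 6 := det_fld_of_notMem _ (by simp) _
      have e7 : τ₁.fld 7 = τ.fld 7 := det_fld_of_notMem _ (by simp) _
      have e31 : τ₁.nat 31 0 = j := by rw [det_nat_of_notMem _ (by simp), hv]
      have eW : τ₁.nat W 0 = wd := by rw [det_nat_of_notMem _ (by simp [hW]), hWW]
      set c₂ := (ite (.eq (.var 7) .zero) (seq (letF 7 (.inv (.var 8)))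
        (fill 6 30 W (.const 0) (.read 5 (.add (.mul (.var 31) (.var W)) (.var 30))))) skip) with hc₂
      set τ₂ := c₂.det τ₁ with hτ₂
      have g5 : τ₂.fld 5 = τ.fld 5 :=
        (det_fld_of_notMem c₂ (by simp [hc₂, writesF]) τ₁).trans e5
      have g8 : τ₂.fld 8 0 = φ (rowOf B wd j) := by
        rw [hτ₂, det_fld_of_notMem c₂ (by simp [hc₂, writesF]) τ₁, hdot]
      have g31 : τ₂.nat 31 0 = j := by
        rw [hτ₂, det_nat_of_notMem c₂ (by simp [hc₂, writesN]) τ₁, e31]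
      have gW : τ₂.nat W 0 = wd := by
        rw [hτ₂, det_nat_of_notMem c₂ (by simp [hc₂, writesN, hW]) τ₁, eW]
      have hfin : (fill 5 30 W (.mul (.var 31) (.var W))
          (.sub (.read 5 (.add (.mul (.var 31) (.var W)) (.var 30)))
            (.mul (.mul (.var 8) (.var 7)) (.read 6 (.var 30)))) |>.det τ₂).fld 5 =
          fun i => if j * wd ≤ i ∧ i < j * wd + wd then
            τ.fld 5 i - φ (rowOf B wd j) * τ₂.fld 7 0 * τ₂.fld 6 (i - j * wd) else τ.fld 5 i := by
        rw [fill_spec τ₂ (j * wd) (fun k => τ.fld 5 (j * wd + k) -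
          φ (rowOf B wd j) * τ₂.fld 7 0 * τ₂.fld 6 k) hW, gW, g5]
        · funext i
          split_ifs with hi
          · rw [Nat.add_sub_cancel' hi.1]
          · rfl
        · intro ρ hρ
          simp [NExpr.eval, hρ 31, hρ W hW, g31, gW]
        · intro k hk ρ hρv hρn hρf hρ5
          simp only [FExpr.eval, NExpr.eval, NExpr.eval_var, FExpr.eval_var, hρn 31 (by simp),
            hρn W hW, g31, gW, hρv, hρ5, g5, hρf 8 (by simp), hρf 7 (by simp), hρf 6 (by simp), g8]
      set τ₃ := (fill 5 30 W (.mul (.var 31) (.var W))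
          (.sub (.read 5 (.add (.mul (.var 31) (.var W)) (.var 30)))
            (.mul (.mul (.var 8) (.var 7)) (.read 6 (.var 30))))).det τ₂ with hτ₃
      have k6 : τ₃.fld 6 = τ₂.fld 6 := det_fld_of_notMem _ (by simp) _
      have k7 : τ₃.fld 7 = τ₂.fld 7 := det_fld_of_notMem _ (by simp) _
      have hother : ∀ i, i ≠ j → rowOf (τ₃.fld 5) wd i = rowOf (τ.fld 5) wd i := by
        intro i hi
        funext k
        simp only [rowOf, trunc, hfin]
        split_ifs with hk hcond
        · exfalso
          obtain ⟨l, hl⟩ := Nat.exists_eq_add_of_le hcond.1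
          exact hi (cell_inj hk (by omega) hl)
        · rfl
        · rfl
      have hself : rowOf (τ₃.fld 5) wd j =
          rowOf B wd j - (φ (rowOf B wd j) * τ₂.fld 7 0) • trunc wd (τ₂.fld 6) := by
        clear_value φ τ₃
        generalize φ (rowOf B wd j) = D at hfin ⊢
        rw [← hrow]
        funext k
        simp only [rowOf, trunc, hfin, Pi.sub_apply, Pi.smul_apply, smul_eq_mul]
        by_cases hk : k < wd
        · simp only [hk, if_true, Nat.le_add_right, true_and, Nat.add_lt_add_iff_left,
            Nat.add_sub_cancel_left]
        · simp [hk]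
      have hmem : rowOf B wd j ∈ Submodule.span F (rowOf B wd '' Set.Iio wd) :=
        Submodule.subset_span ⟨j, hj', rfl⟩
      refine ⟨fun i hi hi' => (hother i (by omega)).trans (h1 i (by omega) hi'), ?_, ?_⟩
      all_goals rw [k7]
      all_goals by_cases h7 : τ.fld 7 0 = 0
      · have h7' : (Test.eq (.var 7) .zero).Holds τ₁ := by
          simp [Test.Holds, FExpr.eval, e7, h7]
        have g7 : τ₂.fld 7 0 = (φ (rowOf B wd j))⁻¹ := by
          simp only [hτ₂, hc₂, det, if_pos h7']
          rw [det_fld_of_notMem _ (by simp)]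
          simp [FExpr.eval, hdot]
        rw [g7]
        intro h0 i hi
        rw [inv_eq_zero] at h0
        rcases eq_or_ne i j with rfl | hij
        · exact ⟨by rw [hself, h0]; simp, h0⟩
        · rw [hother i hij]
          exact h2 h7 i (by omega)
      · have h7' : ¬(Test.eq (.var 7) .zero).Holds τ₁ := by
          simp [Test.Holds, FExpr.eval, e7, h7]
        have g7 : τ₂.fld 7 0 = τ.fld 7 0 := by
          simp only [hτ₂, hc₂, det, if_neg h7']
          simp [e7]
        rw [g7]
        exact fun h => absurd h h7
      · have h7' : (Test.eq (.var 7) .zero).Holds τ₁ := by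
          simp [Test.Holds, FExpr.eval, e7, h7]
        have g7 : τ₂.fld 7 0 = (φ (rowOf B wd j))⁻¹ := by
          simp only [hτ₂, hc₂, det, if_pos h7']
          rw [det_fld_of_notMem _ (by simp)]
          simp [FExpr.eval, hdot]
        have g6 : trunc wd (τ₂.fld 6) = rowOf B wd j := by
          simp only [hτ₂, hc₂, det, if_pos h7']
          rw [fill_spec _ 0 (fun k => τ.fld 5 (j * wd + k)) hW (fun _ _ => rfl)]
          · rw [← hrow]
            funext k
            simp only [rowOf, trunc]
            split_ifs with hk hk2
            · simp
            · exact absurd (by simpa [eW] using hk) hk2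
            · rfl
          · intro k hk ρ hρv hρn hρf _
            simp only [FExpr.eval, NExpr.eval, NExpr.eval_var, hρn 31 (by simp), hρn W hW, hρv,
              hρf 5 (by simp)]
            simp [e31, eW, e5]
        rw [g7, k6, g6]
        intro h0
        have h0' : φ (rowOf B wd j) ≠ 0 := fun h => h0 (by rw [h, inv_zero])
        refine ⟨mul_inv_cancel₀ h0', hmem, fun i hi => ?_⟩
        rcases eq_or_ne i j with rfl | hij
        · rw [hself, g7, g6, mul_inv_cancel₀ h0', one_smul, sub_self]
          exact ⟨map_zero _, 1, by simp⟩
        · rw [hother i hij]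
          obtain ⟨a1, a2⟩ := h2 h7 i (by omega)
          rw [a1]
          exact ⟨a2, 0, by simp⟩
      · have h7' : ¬(Test.eq (.var 7) .zero).Holds τ₁ := by
          simp [Test.Holds, FExpr.eval, e7, h7]
        have g7 : τ₂.fld 7 0 = τ.fld 7 0 := by
          simp only [hτ₂, hc₂, det, if_neg h7']
          simp [e7]
        have g6 : τ₂.fld 6 = τ.fld 6 := by
          simp only [hτ₂, hc₂, det, if_neg h7']
          simp [e6]
        rw [g7, k6, g6]
        intro h0
        obtain ⟨a1, a2, a3⟩ := h3 h7
        refine ⟨a1, a2, fun i hi => ?_⟩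
        rcases eq_or_ne i j with rfl | hij
        · rw [hself, g7, g6]
          refine ⟨?_, φ (rowOf B wd i) * τ.fld 7 0, by simp⟩
          rw [map_sub, map_smul, smul_eq_mul, mul_assoc, mul_comm (τ.fld 7 0), a1, mul_one, sub_self]
        · rw [hother i hij]
          exact a3 i (by omega)
  obtain ⟨-, h2, h3⟩ := key
  set f := ((addEquation W).det σ).fld
  intro x
  by_cases h7 : f 7 0 = 0
  · have hrows : rowOf (f 5) wd '' Set.Iio wd = rowOf B wd '' Set.Iio wd :=
      Set.image_congr fun i hi => (h2 h7 i hi).1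
    rw [hrows, hP x, ← and_assoc, iff_self_and]
    intro hx
    have : x ∈ Submodule.span F (rowOf B wd '' Set.Iio wd) := (hP x).2 hx
    refine Submodule.span_induction (p := fun x _ => φ x = 0) ?_ (map_zero _) ?_ ?_ this
    · rintro _ ⟨i, hi, rfl⟩
      exact (h2 h7 i hi).2
    · intro a b _ _ ha hb
      rw [map_add, ha, hb, add_zero]
    · intro c a _ ha
      rw [map_smul, ha, smul_zero]
  · obtain ⟨a1, a2, a3⟩ := h3 h7
    rw [← and_assoc, ← hP x]
    constructor
    · intro hx
      refine Submodule.span_induction (p := fun x _ =>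
        x ∈ Submodule.span F (rowOf B wd '' Set.Iio wd) ∧ φ x = 0) ?_ ?_ ?_ ?_ hx
      · rintro _ ⟨i, hi, rfl⟩
        obtain ⟨b1, c, b2⟩ := a3 i hi
        refine ⟨?_, b1⟩
        rw [← sub_eq_of_eq_add b2]
        exact sub_mem (Submodule.subset_span ⟨i, hi, rfl⟩) (Submodule.smul_mem _ _ a2)
      · exact ⟨zero_mem _, map_zero _⟩
      · rintro a b _ _ ⟨ha, ha'⟩ ⟨hb, hb'⟩
        exact ⟨add_mem ha hb, by rw [map_add, ha', hb', add_zero]⟩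
      · rintro c a _ ⟨ha, ha'⟩
        exact ⟨Submodule.smul_mem _ _ ha, by rw [map_smul, ha', smul_zero]⟩
    · rintro ⟨hx, hx0⟩
      -- Old rows are new rows plus multiples of the pivot row. The new rows satisfy the equation
      -- and the pivot row does not, so a solution has `c = 0`.
      obtain ⟨z, hz, c, rfl⟩ : ∃ z ∈ Submodule.span F (rowOf (f 5) wd '' Set.Iio wd),
          ∃ c : F, x = z + c • trunc wd (f 6) := by
        refine Submodule.span_induction (p := fun x _ =>
          ∃ z ∈ Submodule.span F (rowOf (f 5) wd '' Set.Iio wd),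
            ∃ c : F, x = z + c • trunc wd (f 6)) ?_ ?_ ?_ ?_ hx
        · rintro _ ⟨i, hi, rfl⟩
          obtain ⟨-, c, b2⟩ := a3 i hi
          exact ⟨_, Submodule.subset_span ⟨i, hi, rfl⟩, c, b2⟩
        · exact ⟨0, zero_mem _, 0, by simp⟩
        · rintro _ _ _ _ ⟨z, hz, c, rfl⟩ ⟨z', hz', c', rfl⟩
          exact ⟨z + z', add_mem hz hz', c + c', by rw [add_smul]; abel⟩
        · rintro b _ _ ⟨z, hz, c, rfl⟩
          exact ⟨b • z, Submodule.smul_mem _ _ hz, b * c, by rw [smul_add, smul_smul]⟩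
      have hz0 : φ z = 0 := by
        refine Submodule.span_induction (p := fun x _ => φ x = 0) ?_ (map_zero _) ?_ ?_ hz
        · rintro _ ⟨i, hi, rfl⟩
          exact (a3 i hi).1
        · intro a b _ _ ha hb
          rw [map_add, ha, hb, add_zero]
        · intro c a _ ha
          rw [map_smul, ha, smul_zero]
      rw [map_add, hz0, zero_add, map_smul, smul_eq_mul] at hx0
      have hne : φ (trunc wd (f 6)) ≠ 0 := fun h => by rw [h, zero_mul] at a1; exact zero_ne_one a1
      obtain rfl : c = 0 := (mul_eq_zero.1 hx0).resolve_right hne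
      simpa using hz

end Prog

end FoldedRS
end

/-! ### Initial matrix, extraction of a solution, and parameters in memory -/

noncomputable section

namespace FoldedRS

universe u

set_option linter.unusedSectionVars false
set_option linter.unusedSimpArgs false

open Polynomial Module

variable {F : Type u} [Field F]

namespace Prog

/-- Make the matrix the identity matrix. -/
def initMatrix (W : ℕ) : Prog :=
  for' 31 W (seq (fill 5 30 W (.mul (.var 31) (.var W)) .zero)
    (setF 5 (.add (.mul (.var 31) (.var W)) (.var 31)) .one))

@[simp] theorem writesN_initMatrix (W) : (initMatrix W).writesN = [31, 30, 30, 31] := rfl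
@[simp] theorem writesF_initMatrix (W) : (initMatrix W).writesF = [5, 5] := rfl

theorem initMatrix_spec {W : ℕ} (hW : W ≠ 30) (hW' : W ≠ 31) (σ : State F) :
    RowsSpan (((initMatrix W).det σ).fld 5) (σ.nat W 0) (fun _ => True) := by
  set wd := σ.nat W 0 with hwd
  let I : ℕ → (ℕ → ℕ → F) → Prop := fun j f =>
    ∀ i < j, ∀ k < wd, f 5 (i * wd + k) = if k = i then 1 else 0
  have key : I wd ((initMatrix W).det σ).fld := by
    refine for'_rule_fld I 31 W _ σ (by simp [writesN]) (by simp [writesN, hW]) hW'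
      (fun i hi => absurd hi (by omega)) ?_
    intro j hj τ hv hn hf hI
    have hWW : τ.nat W 0 = wd := by rw [hn W hW' (by simp [writesN, hW])]
    have hfill := fill_spec (A := 5) (v := 30) (len := W) (off := .mul (.var 31) (.var W))
      (e := .zero) τ (j * wd) (fun _ => 0) hW (fun ρ hρ => by simp [NExpr.eval, hρ, hW, hv, hWW])
      fun _ _ _ _ _ _ _ => rfl
    have e31 : ((fill 5 30 W (.mul (.var 31) (.var W)) .zero).det τ).nat 31 0 = j := by
      rw [det_nat_of_notMem _ (by simp), hv]
    have eW : ((fill 5 30 W (.mul (.var 31) (.var W)) .zero).det τ).nat W 0 = wd := by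
      rw [det_nat_of_notMem _ (by simp [hW]), hWW]
    intro i hi k hk
    simp only [det_seq, det_setF_fld, Function.update_self, NExpr.eval, NExpr.eval_var, e31, eW,
      hfill, hWW, FExpr.eval]
    rcases eq_or_ne i j with rfl | hij
    · rcases eq_or_ne k i with rfl | hki
      · simp
      · rw [Function.update_of_ne (by omega), if_pos (by omega), if_neg hki]
    · have hne : ∀ l < wd, i * wd + k ≠ j * wd + l := fun l hl h => hij (cell_inj hk hl h)
      rw [Function.update_of_ne (hne j hj), if_neg, hI i (by omega) k hk]
      rintro ⟨h1, h2⟩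
      obtain ⟨l, hl⟩ := Nat.exists_eq_add_of_le h1
      exact hne l (by omega) hl
  set B := ((initMatrix W).det σ).fld 5
  have hrow : ∀ i < wd, rowOf B wd i = Pi.single i 1 := by
    intro i hi
    funext k
    simp only [rowOf, trunc, Pi.single_apply]
    split_ifs with hk hki hki
    · exact (key i hi k hk).trans (if_pos hki)
    · exact (key i hi k hk).trans (if_neg hki)
    · omega
    · rfl
  intro x
  rw [and_true]
  constructor
  · intro hx k hk
    refine Submodule.span_induction (p := fun x _ => x k = 0) ?_ rfl ?_ ?_ hx
    · rintro _ ⟨i, hi, rfl⟩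
      exact if_neg (by omega)
    · intro a b _ _ ha hb
      rw [Pi.add_apply, ha, hb, add_zero]
    · intro c a _ ha
      rw [Pi.smul_apply, ha, smul_zero]
  · intro hx
    have : x = ∑ i ∈ Finset.range wd, x i • rowOf B wd i := by
      funext k
      rw [Finset.sum_apply, Finset.sum_congr rfl fun i hi => by
        rw [hrow i (Finset.mem_range.1 hi)]]
      simp only [Pi.smul_apply, Pi.single_apply, smul_eq_mul, mul_ite, mul_one, mul_zero,
        Finset.sum_ite_eq, Finset.mem_range]
      split_ifs with hk
      · rfl
      · exact hx k (by omega)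
    rw [this]
    exact sum_mem fun i hi => Submodule.smul_mem _ _
      (Submodule.subset_span ⟨i, Finset.mem_range.1 hi, rfl⟩)

/-- Copy a nonzero row of the matrix into the array `T`. -/
def extractRow (W T : ℕ) : Prog :=
  for' 31 W (for' 29 W (ite (.eq (.read 5 (.add (.mul (.var 31) (.var W)) (.var 29))) .zero) skip
    (fill T 30 W (.const 0) (.read 5 (.add (.mul (.var 31) (.var W)) (.var 30))))))

@[simp] theorem writesN_extractRow (W T) :
    (extractRow W T).writesN = [31, 29, 30, 30, 29, 31] := rfl
@[simp] theorem writesF_extractRow (W T) : (extractRow W T).writesF = [T] := rfl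

/-- Each nonzero entry met in the scan causes its row to be copied, so the last nonzero row remains.
If none were met, the span would be zero, against `hex`. -/
theorem extractRow_spec {W T : ℕ} (hW : W ≠ 30) (hW' : W ≠ 31) (hW'' : W ≠ 29) (hT : T ≠ 5)
    (σ : State F) {P : (ℕ → F) → Prop} (hP : RowsSpan (σ.fld 5) (σ.nat W 0) P)
    (hex : ∃ x : ℕ → F, x ≠ 0 ∧ (∀ k, σ.nat W 0 ≤ k → x k = 0) ∧ P x) :
    ∃ x : ℕ → F, x ≠ 0 ∧ (∀ k, σ.nat W 0 ≤ k → x k = 0) ∧ P x ∧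
      ∀ k < σ.nat W 0, ((extractRow W T).det σ).fld T k = x k := by
  set wd := σ.nat W 0 with hwd
  set B := σ.fld 5 with hB
  let Found : (ℕ → ℕ → F) → Prop := fun f =>
    ∃ i < wd, rowOf B wd i ≠ 0 ∧ ∀ k < wd, f T k = B (i * wd + k)
  let I : ℕ → (ℕ → ℕ → F) → Prop := fun j f => Found f ∨ ∀ i < j, rowOf B wd i = 0
  have key : I wd ((extractRow W T).det σ).fld := by
    refine for'_rule_fld I 31 W _ σ (by simp [writesN]) (by simp [writesN, hW, hW'']) hW'
      (Or.inr fun i hi => absurd hi (by omega)) ?_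
    intro j hj τ hv hn hf hI
    have hWW : τ.nat W 0 = wd := by rw [hn W hW' (by simp [writesN, hW, hW''])]
    have h5 : τ.fld 5 = B := hf 5 (by simp [writesF, hT.symm])
    rcases hI with hI | hI
    swap
    · have hj' : j < wd := hj
      let J : ℕ → (ℕ → ℕ → F) → Prop := fun k f => Found f ∨ ∀ l < k, B (j * wd + l) = 0
      have := for'_rule_fld J 29 W (ite (.eq (.read 5 (.add (.mul (.var 31) (.var W)) (.var 29)))
        .zero) skip (fill T 30 W (.const 0) (.read 5 (.add (.mul (.var 31) (.var W)) (.var 30)))))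
        τ (by simp [writesN]) (by simp [writesN, hW]) hW''
        (Or.inr fun i hi => absurd hi (by omega)) ?_
      · rw [hWW] at this
        refine this.imp_right fun h i hi => ?_
        rcases Nat.lt_succ_iff_lt_or_eq.1 hi with hi | rfl
        · exact hI i hi
        · funext k
          simp only [rowOf, trunc, Pi.zero_apply]
          split_ifs with hk
          · exact h k hk
          · rfl
      · intro k hk ρ hρv hρn hρf hJ
        have e31 : ρ.nat 31 0 = j := by rw [hρn 31 (by simp) (by simp [writesN]), hv]
        have eW : ρ.nat W 0 = wd := by rw [hρn W hW'' (by simp [writesN, hW]), hWW]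
        have e5 : ρ.fld 5 = B := (hρf 5 (by simp [writesF, hT.symm])).trans h5
        have hk' : k < wd := hWW ▸ hk
        by_cases hz : (Test.eq (.read 5 (.add (.mul (.var 31) (.var W)) (.var 29))) .zero).Holds ρ
        · simp only [det, if_pos hz]
          refine hJ.imp_right fun h l hl => ?_
          rcases Nat.lt_succ_iff_lt_or_eq.1 hl with hl | rfl
          · exact h l hl
          · simpa [Test.Holds, FExpr.eval, NExpr.eval, e31, eW, hρv, e5] using hz
        · simp only [det, if_neg hz]
          refine Or.inl ⟨j, hj', ?_, ?_⟩
          · intro h0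
            apply hz
            have := congrFun h0 k
            simp only [rowOf, trunc, hk', if_true, Pi.zero_apply] at this
            simpa [Test.Holds, FExpr.eval, NExpr.eval, e31, eW, hρv, e5] using this
          · intro l hl
            rw [fill_spec _ 0 (fun l => B (j * wd + l)) hW (fun _ _ => rfl)]
            · simp only [State.tick_nat, eW]
              rw [if_pos (by omega), Nat.sub_zero]
            · intro l hl κ hκv hκn hκf _
              simp [FExpr.eval, NExpr.eval, hκn, hκf, hT.symm, hW, hκv, e31, eW, e5]
    · refine Or.inl ?_
      let J : ℕ → (ℕ → ℕ → F) → Prop := fun _ f => Found f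
      refine for'_rule_fld J 29 W _ τ (by simp [writesN]) (by simp [writesN, hW]) hW'' hI ?_
      intro k hk ρ hρv hρn hρf hJ
      have e31 : ρ.nat 31 0 = j := by rw [hρn 31 (by simp) (by simp [writesN]), hv]
      have eW : ρ.nat W 0 = wd := by rw [hρn W hW'' (by simp [writesN, hW]), hWW]
      have e5 : ρ.fld 5 = B := (hρf 5 (by simp [writesF, hT.symm])).trans h5
      have hk' : k < wd := hWW ▸ hk
      by_cases hz : (Test.eq (.read 5 (.add (.mul (.var 31) (.var W)) (.var 29))) .zero).Holds ρ
      · simp only [det, if_pos hz]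
        exact hJ
      · simp only [det, if_neg hz]
        refine ⟨j, hj, ?_, ?_⟩
        · intro h0
          apply hz
          have := congrFun h0 k
          simp only [rowOf, trunc, hk', if_true, Pi.zero_apply] at this
          simpa [Test.Holds, FExpr.eval, NExpr.eval, e31, eW, hρv, e5] using this
        · intro l hl
          rw [fill_spec _ 0 (fun l => B (j * wd + l)) hW (fun _ _ => rfl)]
          · simp only [State.tick_nat, eW]
            rw [if_pos (by omega), Nat.sub_zero]
          · intro l hl κ hκv hκn hκf _
            simp [FExpr.eval, NExpr.eval, hκn, hκf, hT.symm, hW, hκv, e31, eW, e5]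
  rcases key with ⟨i, hi, hne, hT⟩ | h0
  · obtain ⟨h1, h2⟩ := (hP (rowOf B wd i)).1 (Submodule.subset_span ⟨i, hi, rfl⟩)
    refine ⟨_, hne, h1, h2, fun k hk => ?_⟩
    rw [hT k hk, rowOf, trunc, if_pos hk]
  · obtain ⟨x, hx0, hx⟩ := hex
    refine absurd ?_ hx0
    have hmem := (hP x).2 hx
    have : rowOf B wd '' Set.Iio wd ⊆ {0} := by
      rintro _ ⟨i, hi, rfl⟩
      exact h0 i hi
    exact (Submodule.mem_bot F).1 ((Submodule.span_mono this).trans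
      (Submodule.span_zero_singleton F).le hmem)

end Prog

/-- The parameters and the input of an instance are in memory: the variables `2, …, 15` hold `s`,
`d + 1`, `n`, `ℓ`, `e`, `m`, `D + 1`, `t`, the number of trials, the width of the interpolation
system, `w`, `D + d + 1`, `n ℓ` and `d + 2`. -/
structure Loaded (I : Inst F) (σ : State F) : Prop where
  n2 : σ.nat 2 0 = I.s
  n3 : σ.nat 3 0 = I.d + 1
  n4 : σ.nat 4 0 = I.n
  n5 : σ.nat 5 0 = I.l
  n6 : σ.nat 6 0 = I.e
  n7 : σ.nat 7 0 = I.m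
  n8 : σ.nat 8 0 = I.D + 1
  n9 : σ.nat 9 0 = I.t
  n10 : σ.nat 10 0 = I.Z * (I.Z + 5)
  n11 : σ.nat 11 0 = I.width
  n12 : σ.nat 12 0 = I.w
  n13 : σ.nat 13 0 = I.D + I.d + 1
  n14 : σ.nat 14 0 = I.n * I.l
  n15 : σ.nat 15 0 = I.d + 2
  f0 : σ.fld 0 0 = I.g
  f1 : σ.fld 1 = I.a
  f2 : σ.fld 2 = I.y

variable {I : Inst F}

theorem Loaded.of_eq {σ τ : State F} (h : Loaded I σ)
    (hn : ∀ A, 2 ≤ A → A ≤ 15 → τ.nat A = σ.nat A) (hf : ∀ A ≤ 2, τ.fld A = σ.fld A) :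
    Loaded I τ where
  n2 := by rw [hn _ (by norm_num) (by norm_num), h.n2]
  n3 := by rw [hn _ (by norm_num) (by norm_num), h.n3]
  n4 := by rw [hn _ (by norm_num) (by norm_num), h.n4]
  n5 := by rw [hn _ (by norm_num) (by norm_num), h.n5]
  n6 := by rw [hn _ (by norm_num) (by norm_num), h.n6]
  n7 := by rw [hn _ (by norm_num) (by norm_num), h.n7]
  n8 := by rw [hn _ (by norm_num) (by norm_num), h.n8]
  n9 := by rw [hn _ (by norm_num) (by norm_num), h.n9]
  n10 := by rw [hn _ (by norm_num) (by norm_num), h.n10]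
  n11 := by rw [hn _ (by norm_num) (by norm_num), h.n11]
  n12 := by rw [hn _ (by norm_num) (by norm_num), h.n12]
  n13 := by rw [hn _ (by norm_num) (by norm_num), h.n13]
  n14 := by rw [hn _ (by norm_num) (by norm_num), h.n14]
  n15 := by rw [hn _ (by norm_num) (by norm_num), h.n15]
  f0 := by rw [hf _ (by norm_num), h.f0]
  f1 := by rw [hf _ (by norm_num), h.f1]
  f2 := by rw [hf _ (by norm_num), h.f2]

theorem Loaded.det {σ : State F} (h : Loaded I σ) (c : Prog)
    (hn : ∀ A ∈ c.writesN, ¬(2 ≤ A ∧ A ≤ 15)) (hf : ∀ A ∈ c.writesF, 2 < A) :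
    Loaded I (c.det σ) :=
  h.of_eq (fun A h2 h15 => c.det_nat_of_notMem (fun hA => hn A hA ⟨h2, h15⟩) σ)
    fun A h2 => c.det_fld_of_notMem (fun hA => absurd (hf A hA) (by omega)) σ

/-- The loop body leaves the parameters in place. -/
theorem Loaded.body {σ τ : State F} (h : Loaded I σ) {v : ℕ} {c : Prog}
    (hτn : ∀ A, A ≠ v → A ∉ c.writesN → τ.nat A = σ.nat A)
    (hτf : ∀ A, A ∉ c.writesF → τ.fld A = σ.fld A) (hv : ¬(2 ≤ v ∧ v ≤ 15))
    (hn : ∀ A ∈ c.writesN, ¬(2 ≤ A ∧ A ≤ 15)) (hf : ∀ A ∈ c.writesF, 2 < A) :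
    Loaded I τ :=
  h.of_eq (fun A h2 h15 => hτn A (fun h => hv (h ▸ ⟨h2, h15⟩)) fun hA => hn A hA ⟨h2, h15⟩)
    fun A h2 => hτf A fun hA => absurd (hf A hA) (by omega)

end FoldedRS
end

noncomputable section

namespace FoldedRS

universe u

set_option linter.unusedSectionVars false
set_option linter.unusedSimpArgs false

open Polynomial Module

variable {F : Type u} [Field F] {I : Inst F}

theorem RowsSpan.congr {B : ℕ → F} {wd : ℕ} {P Q : (ℕ → F) → Prop} (h : RowsSpan B wd P)
    (hPQ : ∀ x, P x ↔ Q x) : RowsSpan B wd Q := fun x => by rw [h x, hPQ x]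

theorem polyOf_congr {x y : ℕ → F} {off len : ℕ} (h : ∀ k < len, x (off + k) = y (off + k)) :
    polyOf x off len = polyOf y off len :=
  Finset.sum_congr rfl fun k hk => by rw [h k (Finset.mem_range.1 hk)]

theorem Inst.block_le_width {b : ℕ} (hb : b ≤ I.m) :
    b * (I.D + 1) + (I.D + 1) ≤ I.width := by
  unfold Inst.width
  nlinarith

namespace Prog

/-! ### Interpolation

The variable `35` is the index of a list entry and `34` the position of a window. The array `11` of
field elements holds the current evaluation point, the array `12` the interpolation polynomial. -/

/-- Multiply the current evaluation point by the generator. -/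
def nextPoint : Prog := letF 11 (.mul (.var 11) (.read 0 (.const 0)))

/-- The linear equation for one window of one list entry. -/
def interpRow : Prog :=
  seq (zeroRow 11) (seq (letF 10 (.var 11)) (seq (letF 9 .one) (seq (addPow (.const 0) 8)
    (for' 33 7 (seq
      (letF 9 (.read 2 (.add (.mul (.var 35) (.var 2)) (.add (.var 34) (.var 33)))))
      (addPow (.mul (.add (.var 33) (.const 1)) (.var 8)) 8))))))

@[simp] theorem writesN_interpRow : interpRow.writesN = [30, 30, 30, 30, 33, 30, 30, 33] := rfl
@[simp] theorem writesF_interpRow : interpRow.writesF = [4, 10, 9, 4, 9, 9, 4, 9] := rfl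
@[simp] theorem writesN_nextPoint : nextPoint.writesN = [] := rfl
@[simp] theorem writesF_nextPoint : nextPoint.writesF = [11] := rfl

theorem rowVal_zeroRow {W : ℕ} (hW : W ≠ 30) (σ : State F) {wd : ℕ} (hwd : wd = σ.nat W 0)
    (x : ℕ → F) : rowVal (((zeroRow W).det σ).fld 4) wd x = 0 := by
  subst hwd
  exact (rowVal_apply _ _ _).trans <| Finset.sum_eq_zero fun k hk => by
    rw [zeroRow_spec hW σ (Finset.mem_range.1 hk), zero_mul]

/-- Block `0` of the unknowns receives the powers of the point, and block `b + 1` the same powers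
times the list value at position `j + b`. -/
theorem interpRow_spec {σ : State F} (h : Loaded I σ) {u j : ℕ} (hu : σ.nat 35 0 = u)
    (hj : σ.nat 34 0 = j) (hpt : σ.fld 11 0 = I.g ^ j * I.a (u / I.l)) (x : ℕ → F) :
    rowVal ((interpRow.det σ).fld 4) I.width x = I.interpEval (I.interpPoly x) u j := by
  rw [interpRow, det_seq, det_seq, det_seq, det_seq]
  set σ₁ := (letF 9 .one).det ((letF 10 (.var 11)).det ((zeroRow 11).det σ)) with hσ₁
  have h₁ : Loaded I σ₁ := ((h.det _ (by simp) (by simp)).det _ (by simp) (by simp)).det _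
    (by simp) (by simp)
  have hz : rowVal (σ₁.fld 4) I.width x = 0 := by
    have : σ₁.fld 4 = ((zeroRow 11).det σ).fld 4 := rfl
    rw [this]
    exact rowVal_zeroRow (by norm_num) σ h.n11.symm x
  have h10 : σ₁.fld 10 0 = I.g ^ j * I.a (u / I.l) := by
    simp [hσ₁, det_fld_of_notMem, hpt]
  have h9 : σ₁.fld 9 0 = 1 := by simp [hσ₁, FExpr.eval]
  have hn : ∀ A, A ≠ 30 → σ₁.nat A = σ.nat A := fun A hA => by
    simp [hσ₁, det_nat_of_notMem, hA]
  set σ₂ := (addPow (.const 0) 8).det σ₁ with hσ₂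
  have h₂ : Loaded I σ₂ := h₁.det _ (by simp) (by simp)
  have hA0 : rowVal (σ₂.fld 4) I.width x = (I.interpPoly x 0).eval (I.g ^ j * I.a (u / I.l)) := by
    have := addPow_spec (off := .const 0) (len := 8) σ₁ 0 I.width (by norm_num) (fun _ _ => rfl)
      (by rw [h₁.n8]; simpa using Inst.block_le_width (I := I) (Nat.zero_le _)) x
    rw [h9, h10, h₁.n8, one_mul] at this
    rw [rowVal_apply, this, ← rowVal_apply, hz, zero_add, Inst.interpPoly, zero_mul]
  have key := for'_rule_fld (fun b f => rowVal (f 4) I.width x =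
      (I.interpPoly x 0).eval (I.g ^ j * I.a (u / I.l)) + ∑ b ∈ Finset.range b,
        (I.interpPoly x (b + 1)).eval (I.g ^ j * I.a (u / I.l)) * I.y (u * I.s + (j + b))) 33 7
      (seq (letF 9 (.read 2 (.add (.mul (.var 35) (.var 2)) (.add (.var 34) (.var 33)))))
        (addPow (.mul (.add (.var 33) (.const 1)) (.var 8)) 8)) σ₂
      (by simp [writesN]) (by simp [writesN]) (by norm_num) (by simpa using hA0) ?_
  · rw [h₂.n7] at key
    exact key
  · intro b hb τ hv hτn hτf hI
    have hτ : Loaded I τ := h₂.body hτn hτf (by norm_num) (by simp [writesN]) (by simp [writesF])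
    have hb' : b < I.m := h₂.n7 ▸ hb
    have e35 : τ.nat 35 0 = u := by
      rw [hτn 35 (by simp) (by simp [writesN]), hσ₂, det_nat_of_notMem _ (by simp),
        hn _ (by simp), hu]
    have e34 : τ.nat 34 0 = j := by
      rw [hτn 34 (by simp) (by simp [writesN]), hσ₂, det_nat_of_notMem _ (by simp),
        hn _ (by simp), hj]
    have e10 : τ.fld 10 0 = I.g ^ j * I.a (u / I.l) := by
      rw [hτf 10 (by simp [writesF]), hσ₂, det_fld_of_notMem _ (by simp), h10]
    rw [det_seq]
    set τ₁ := (letF 9 (.read 2 (.add (.mul (.var 35) (.var 2)) (.add (.var 34) (.var 33))))).det τ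
      with hτ₁
    have hτ₁' : Loaded I τ₁ := hτ.det _ (by simp) (by simp)
    have e9 : τ₁.fld 9 0 = I.y (u * I.s + (j + b)) := by
      simp [hτ₁, FExpr.eval, NExpr.eval, e35, e34, hv, hτ.n2, hτ.f2]
    have := addPow_spec (off := .mul (.add (.var 33) (.const 1)) (.var 8)) (len := 8) τ₁
      ((b + 1) * (I.D + 1)) I.width (by norm_num)
      (fun ρ hρ => by simp [NExpr.eval, hρ, hτ₁'.n8, hτ₁, hv, hτ.n8])
      (by rw [hτ₁'.n8]; exact Inst.block_le_width (by omega)) x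
    rw [rowVal_apply, this, ← rowVal_apply, Finset.sum_range_succ, ← add_assoc, ← hI, e9, hτ₁'.n8]
    simp only [hτ₁, det_letF_fld, Inst.interpPoly]
    rw [Function.update_of_ne (by norm_num), Function.update_of_ne (by norm_num), e10, mul_comm (I.y _)]

/-- The equations for all windows of a list entry. -/
def interpEntry : Prog :=
  seq (letF 11 (.read 1 (.div (.var 35) (.var 5))))
    (for' 34 12 (seq interpRow (seq (addEquation 11) nextPoint)))

/-- Compute an interpolation polynomial. -/
def interpolate : Prog :=
  seq (initMatrix 11) (seq (for' 35 14 interpEntry) (extractRow 11 12))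

@[simp] theorem writesN_interpEntry : interpEntry.writesN =
    [34, 30, 30, 30, 30, 33, 30, 30, 33, 31, 30, 30, 30, 30, 30, 30, 31, 34] := rfl
@[simp] theorem writesF_interpEntry : interpEntry.writesF =
    [11, 4, 10, 9, 4, 9, 9, 4, 9, 7, 8, 8, 7, 6, 5, 11] := rfl
@[simp] theorem writesN_interpolate : interpolate.writesN =
    [31, 30, 30, 31] ++ 35 :: (interpEntry.writesN ++ [35]) ++ (extractRow 11 12).writesN := rfl
@[simp] theorem writesF_interpolate : interpolate.writesF =
    [5, 5, 11, 4, 10, 9, 4, 9, 9, 4, 9, 7, 8, 8, 7, 6, 5, 11, 12] := rfl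

theorem interpEntry_spec {σ : State F} (h : Loaded I σ) {u : ℕ} (hu : σ.nat 35 0 = u)
    {P : (ℕ → F) → Prop} (hP : RowsSpan (σ.fld 5) I.width P) :
    RowsSpan ((interpEntry.det σ).fld 5) I.width
      (fun x => P x ∧ ∀ j < I.w, I.interpEval (I.interpPoly x) u j = 0) := by
  rw [interpEntry, det_seq]
  set σ₁ := (letF 11 (.read 1 (.div (.var 35) (.var 5)))).det σ with hσ₁
  have h₁ : Loaded I σ₁ := h.det _ (by simp) (by simp)
  have h11 : σ₁.fld 11 0 = I.a (u / I.l) := by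
    simp [hσ₁, FExpr.eval, NExpr.eval, hu, h.n5, h.f1]
  have key := for'_rule_fld (fun j f => f 11 0 = I.g ^ j * I.a (u / I.l) ∧
      RowsSpan (f 5) I.width (fun x => P x ∧ ∀ i < j, I.interpEval (I.interpPoly x) u i = 0)) 34 12
      (seq interpRow (seq (addEquation 11) nextPoint)) σ₁ (by simp [writesN]) (by simp [writesN])
      (by norm_num) ⟨by simpa using h11, hP.congr fun x => by simp⟩ ?_
  · rw [h₁.n12] at key
    exact key.2
  · rintro j hj τ hv hτn hτf ⟨hpt, hI⟩
    have hτ : Loaded I τ := h₁.body hτn hτf (by norm_num) (by simp [writesN]) (by simp [writesF])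
    have e35 : τ.nat 35 0 = u := (congrFun (hτn 35 (by simp) (by simp [writesN])) 0).trans hu
    have hrow := interpRow_spec hτ e35 hv hpt
    set τ₁ := interpRow.det τ with hτ₁
    have hτ₁' : Loaded I τ₁ := hτ.det _ (by simp) (by simp)
    have e5 : τ₁.fld 5 = τ.fld 5 := det_fld_of_notMem _ (by simp) _
    have e11 : τ₁.fld 11 = τ.fld 11 := det_fld_of_notMem _ (by simp) _
    have hadd := addEquation_spec (W := 11) (by norm_num) (by norm_num) τ₁ (P := fun x =>
      P x ∧ ∀ i < j, I.interpEval (I.interpPoly x) u i = 0) (by rw [hτ₁'.n11, e5]; exact hI)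
    rw [hτ₁'.n11] at hadd
    have hτ₂ : Loaded I ((addEquation 11).det τ₁) := hτ₁'.det _ (by simp) (by simp)
    refine ⟨?_, ?_⟩
    · simp [nextPoint, FExpr.eval, det_fld_of_notMem, e11, hpt, hτ₂.f0, pow_succ, NExpr.eval,
        hτ.f0, hτ₁'.f0]
      ring
    · refine RowsSpan.congr (P := fun x => (P x ∧ ∀ i < j, I.interpEval (I.interpPoly x) u i = 0) ∧
        rowVal (τ₁.fld 4) I.width x = 0) ?_ fun x => ?_
      · simpa [nextPoint] using hadd
      · simp only [hrow]
        rw [and_assoc, Nat.forall_lt_succ_right]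

/-- The array `12` of field elements holds the interpolation polynomial `q`. -/
def HasInterp (I : Inst F) (q : ℕ → F) (σ : State F) : Prop := ∀ k < I.width, σ.fld 12 k = q k

/-- The rows span the solutions of all interpolation equations, and `exists_interp` provides the
nonzero solution that `extractRow` needs. -/
theorem interpolate_spec {σ : State F} (h : Loaded I σ) :
    ∃ q, I.IsInterp (I.interpPoly q) ∧ HasInterp I q (interpolate.det σ) := by
  rw [interpolate, det_seq, det_seq]
  set σ₁ := (initMatrix 11).det σ with hσ₁
  have h₁ : Loaded I σ₁ := h.det _ (by simp) (by simp)
  have hinit := initMatrix_spec (W := 11) (by norm_num) (by norm_num) σ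
  rw [h.n11] at hinit
  have key := for'_rule_fld (fun u f => RowsSpan (f 5) I.width (fun x =>
      ∀ i < u, ∀ j < I.w, I.interpEval (I.interpPoly x) i j = 0)) 35 14 interpEntry σ₁
      (by simp [writesN]) (by simp [writesN]) (by norm_num) (hinit.congr fun x => by simp) ?_
  · rw [h₁.n14] at key
    set σ₂ := (for' 35 14 interpEntry).det σ₁ with hσ₂
    have h₂ : Loaded I σ₂ := h₁.det _ (by simp [writesN]) (by simp [writesF])
    obtain ⟨x, hx0, hx, hev, hfld⟩ := extractRow_spec (W := 11) (T := 12) (by norm_num)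
      (by norm_num) (by norm_num) (by norm_num) σ₂ (by rw [h₂.n11]; exact key) (by
        obtain ⟨x, hx, hx0, hev⟩ := Inst.exists_interp I
        rw [h₂.n11]
        exact ⟨x, hx0, hx, hev⟩)
    rw [h₂.n11] at hx hfld
    exact ⟨x, Inst.isInterp_interpPoly hx hx0 hev, hfld⟩
  · intro u hu τ hv hτn hτf hI
    have hτ : Loaded I τ := h₁.body hτn hτf (by norm_num) (by simp [writesN]) (by simp [writesF])
    refine (interpEntry_spec hτ hv hI).congr fun x => ?_
    rw [Nat.forall_lt_succ_right]

end Prog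

end FoldedRS
end

noncomputable section

namespace FoldedRS

universe u

set_option linter.unusedSectionVars false
set_option linter.unusedSimpArgs false

open Polynomial Module

variable {F : Type u} [Field F] {I : Inst F}

theorem HasInterp.det {q : ℕ → F} {σ : State F} (h : Prog.HasInterp I q σ) (c : Prog)
    (hc : 12 ∉ c.writesF) : Prog.HasInterp I q (c.det σ) := fun k hk => by
  rw [c.det_fld_of_notMem hc, h k hk]

theorem HasInterp.of_eq {q : ℕ → F} {σ τ : State F} (h : Prog.HasInterp I q σ)
    (hc : τ.fld 12 = σ.fld 12) : Prog.HasInterp I q τ := fun k hk => by rw [hc, h k hk]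

theorem HasInterp.interpPoly_eq {q : ℕ → F} {σ : State F} (h : Prog.HasInterp I q σ) {b : ℕ}
    (hb : b ≤ I.m) : polyOf (σ.fld 12) (b * (I.D + 1)) (I.D + 1) = I.interpPoly q b :=
  polyOf_congr fun k hk => h _ (by have := Inst.block_le_width (I := I) hb; omega)

/-- The list entry that is guessed for slot `v` of trial `k`. -/
def Inst.guess (I : Inst F) (σ : State F) (k v : ℕ) : ℕ := σ.nat 40 (k * I.t + v)

namespace Prog

/-! ### Guessing a polynomial

The variable `36` is the index of the trial, `35` the number of a slot in the trial, and `34` the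
index of an equation. The array `40` of natural numbers holds the guesses. The array `14` of field
elements receives the coefficients of the polynomial. -/

/-- The linear equation that expresses that the combination vanishes at the current point. -/
def combineRow : Prog :=
  seq (letF 10 (.var 11)) (seq (evalPoly 12 (.const 0) 8) (seq (zeroRow 15)
    (seq (setF 4 (.var 3) (.var 8)) (seq (letF 15 (.var 11)) (for' 33 7
      (seq (letF 10 (.var 11)) (seq (evalPoly 12 (.mul (.add (.var 33) (.const 1)) (.var 8)) 8)
        (seq (letF 9 (.var 8)) (seq (letF 10 (.var 15)) (seq (addPow (.const 0) 3)
          (letF 15 (.mul (.var 15) (.read 0 (.const 0))))))))))))))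

@[simp] theorem writesN_combineRow :
    combineRow.writesN = [30, 30, 30, 30, 33, 30, 30, 30, 30, 33] := rfl
@[simp] theorem writesF_combineRow : combineRow.writesF =
    [10, 8, 9, 8, 9, 4, 4, 15, 10, 8, 9, 8, 9, 9, 10, 4, 9, 15] := rfl

theorem rowVal_update (R : ℕ → F) {wd k : ℕ} (hk : k < wd) (c : F) (x : ℕ → F)
    (h : R k = 0) : rowVal (Function.update R k c) wd x = rowVal R wd x + c * x k := by
  rw [rowVal_apply, rowVal_apply, ← Finset.add_sum_erase _ _ (Finset.mem_range.2 hk),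
    ← Finset.add_sum_erase (Finset.range wd) (fun k => R k * x k) (Finset.mem_range.2 hk), h,
    Function.update_self, Finset.sum_congr rfl fun i hi => by
      rw [Function.update_of_ne (Finset.ne_of_mem_erase hi)]]
  ring

/-- The unknowns are the coefficients of the polynomial in cells `0, …, d` and the homogenizing
factor `z` in cell `d + 1`. Array `15` runs through the points `g ^ b * pt`. -/
theorem combineRow_spec {σ : State F} (h : Loaded I σ) {q : ℕ → F} (hq : HasInterp I q σ)
    {pt : F} (hpt : σ.fld 11 0 = pt) (x : ℕ → F) :
    rowVal ((combineRow.det σ).fld 4) (I.d + 2) x =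
      (I.combine (I.interpPoly q) (x (I.d + 1)) (polyOf x 0 (I.d + 1))).eval pt := by
  rw [combineRow, det_seq, det_seq, det_seq, det_seq, det_seq, Inst.eval_combine]
  set σ₁ := (letF 10 (.var 11)).det σ with hσ₁
  have h₁ : Loaded I σ₁ := h.det _ (by simp) (by simp)
  have hq₁ : HasInterp I q σ₁ := HasInterp.det hq _ (by simp)
  set σ₂ := (evalPoly 12 (.const 0) 8).det σ₁ with hσ₂
  have h₂ : Loaded I σ₂ := h₁.det _ (by simp) (by simp)
  have e8 : σ₂.fld 8 0 = (I.interpPoly q 0).eval pt := by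
    rw [hσ₂, evalPoly_spec σ₁ 0 (by norm_num) (by norm_num) (by norm_num) (fun _ _ => rfl), h₁.n8,
      ← HasInterp.interpPoly_eq hq₁ (Nat.zero_le _), zero_mul]
    simp [hσ₁, hpt]
  set σ₃ := (zeroRow 15).det σ₂ with hσ₃
  have h₃ : Loaded I σ₃ := h₂.det _ (by simp) (by simp)
  have hz : rowVal (σ₃.fld 4) (I.d + 2) x = 0 := rowVal_zeroRow (by norm_num) σ₂ h₂.n15.symm x
  set σ₄ := (setF 4 (.var 3) (.var 8)).det σ₃ with hσ₄
  have h₄ : Loaded I σ₄ := h₃.det _ (by simp [writesN]) (by simp [writesF])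
  have hA0 : rowVal (σ₄.fld 4) (I.d + 2) x = x (I.d + 1) * (I.interpPoly q 0).eval pt := by
    have : σ₄.fld 4 = Function.update (σ₃.fld 4) (I.d + 1) ((I.interpPoly q 0).eval pt) := by
      rw [hσ₄, det_setF_fld, Function.update_self, NExpr.eval_var, h₃.n3, FExpr.eval_var,
        ← e8, hσ₃, det_fld_of_notMem (A := 8) _ (by simp)]
    rw [this, rowVal_update _ (by omega) _ _ (zeroRow_spec (by norm_num) σ₂ (by rw [h₂.n15]; omega)),
      hz, zero_add, mul_comm]
  set σ₅ := (letF 15 (.var 11)).det σ₄ with hσ₅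
  have h₅ : Loaded I σ₅ := h₄.det _ (by simp) (by simp)
  have e11 : σ₅.fld 11 0 = pt := by
    simp [hσ₅, hσ₄, hσ₃, hσ₂, hσ₁, det_fld_of_notMem, hpt]
  have e15 : σ₅.fld 15 0 = pt := by
    simp [hσ₅, hσ₄, hσ₃, hσ₂, hσ₁, det_fld_of_notMem, hpt]
  have hq₅ : HasInterp I q σ₅ := HasInterp.of_eq hq (by
    simp [hσ₅, hσ₄, hσ₃, hσ₂, hσ₁, det_fld_of_notMem])
  have key := for'_rule_fld (fun b f => f 15 0 = I.g ^ b * pt ∧ rowVal (f 4) (I.d + 2) x =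
      x (I.d + 1) * (I.interpPoly q 0).eval pt + ∑ b ∈ Finset.range b,
        (I.interpPoly q (b + 1)).eval pt * (polyOf x 0 (I.d + 1)).eval (I.g ^ b * pt)) 33 7
      (seq (letF 10 (.var 11)) (seq (evalPoly 12 (.mul (.add (.var 33) (.const 1)) (.var 8)) 8)
        (seq (letF 9 (.var 8)) (seq (letF 10 (.var 15)) (seq (addPow (.const 0) 3)
          (letF 15 (.mul (.var 15) (.read 0 (.const 0))))))))) σ₅
      (by simp [writesN]) (by simp [writesN]) (by norm_num)
      ⟨by simpa using e15, by simpa [hσ₅] using hA0⟩ ?_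
  · rw [h₅.n7] at key
    exact key.2
  · rintro b hb τ hv hτn hτf ⟨i15, hI⟩
    have hτ : Loaded I τ := h₅.body hτn hτf (by norm_num) (by simp [writesN]) (by simp [writesF])
    have hb' : b < I.m := h₅.n7 ▸ hb
    have i11 : τ.fld 11 0 = pt := by rw [hτf 11 (by simp [writesF]), e11]
    have hqτ : HasInterp I q τ := HasInterp.of_eq hq₅ (hτf 12 (by simp [writesF]))
    simp only [det_seq]
    set τ₁ := (letF 10 (.var 11)).det τ with hτ₁
    have k₁ : Loaded I τ₁ := hτ.det _ (by simp) (by simp)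
    have hq₁ : HasInterp I q τ₁ := HasInterp.det hqτ _ (by simp)
    set τ₂ := (evalPoly 12 (.mul (.add (.var 33) (.const 1)) (.var 8)) 8).det τ₁ with hτ₂
    have k₂ : Loaded I τ₂ := k₁.det _ (by simp) (by simp)
    have j8 : τ₂.fld 8 0 = (I.interpPoly q (b + 1)).eval pt := by
      rw [hτ₂, evalPoly_spec τ₁ ((b + 1) * (I.D + 1)) (by norm_num) (by norm_num) (by norm_num), k₁.n8,
        ← HasInterp.interpPoly_eq hq₁ (by omega : b + 1 ≤ I.m)]
      · simp [hτ₁, i11]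
      · intro ρ hρ
        simp [NExpr.eval, hρ, hτ₁, hv, hτ.n8]
    set τ₃ := (letF 10 (.var 15)).det ((letF 9 (.var 8)).det τ₂) with hτ₃
    have k₃ : Loaded I τ₃ := (k₂.det _ (by simp) (by simp)).det _ (by simp) (by simp)
    have l9 : τ₃.fld 9 0 = (I.interpPoly q (b + 1)).eval pt := by simp [hτ₃, j8]
    have l10 : τ₃.fld 10 0 = I.g ^ b * pt := by
      simp [hτ₃, hτ₂, hτ₁, det_fld_of_notMem, i15]
    have l4 : τ₃.fld 4 = τ.fld 4 := by simp [hτ₃, hτ₂, hτ₁, det_fld_of_notMem]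
    have l15 : τ₃.fld 15 0 = I.g ^ b * pt := by simp [hτ₃, hτ₂, hτ₁, det_fld_of_notMem, i15]
    have := addPow_spec (off := .const 0) (len := 3) τ₃ 0 (I.d + 2) (by norm_num)
      (fun _ _ => rfl) (by rw [k₃.n3]; omega) x
    rw [l9, l10, l4, k₃.n3] at this
    constructor
    · have k₄ : Loaded I ((addPow (.const 0) 3).det τ₃) := k₃.det _ (by simp) (by simp)
      simp [FExpr.eval, NExpr.eval, k₄.f0, det_fld_of_notMem, l15, k₃.f0]
      ring
    · rw [Finset.sum_range_succ, ← add_assoc, ← hI, rowVal_apply, rowVal_apply, ← this]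
      simp

/-- The linear equation that expresses that the polynomial has a prescribed value. -/
def valueRow : Prog :=
  seq (zeroRow 15) (seq
    (setF 4 (.var 3) (.sub .zero (.read 2 (.add (.mul
      (.read 40 (.add (.mul (.var 36) (.var 9)) (.var 35))) (.var 2)) (.var 34)))))
    (seq (letF 10 (.var 11)) (seq (letF 9 .one) (addPow (.const 0) 3))))

@[simp] theorem writesN_valueRow : valueRow.writesN = [30, 30, 30, 30] := rfl
@[simp] theorem writesF_valueRow : valueRow.writesF = [4, 4, 10, 9, 4, 9] := rfl

theorem valueRow_spec {σ : State F} (h : Loaded I σ) {k v j : ℕ} (hk : σ.nat 36 0 = k)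
    (hv : σ.nat 35 0 = v) (hj : σ.nat 34 0 = j) (x : ℕ → F) :
    rowVal ((valueRow.det σ).fld 4) (I.d + 2) x =
      (polyOf x 0 (I.d + 1)).eval (σ.fld 11 0) -
        x (I.d + 1) * I.y (I.guess σ k v * I.s + j) := by
  rw [valueRow, det_seq, det_seq, det_seq, det_seq]
  set σ₁ := (zeroRow 15).det σ with hσ₁
  have h₁ : Loaded I σ₁ := h.det _ (by simp) (by simp)
  have hz : rowVal (σ₁.fld 4) (I.d + 2) x = 0 := rowVal_zeroRow (by norm_num) σ h.n15.symm x
  have hn : ∀ A, A ≠ 30 → σ₁.nat A = σ.nat A := fun A hA => by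
    simp [hσ₁, det_nat_of_notMem, hA]
  set σ₂ := (letF 9 .one).det ((letF 10 (.var 11)).det (Prog.det (setF 4 (.var 3)
    (.sub .zero (.read 2 (.add (.mul
      (.read 40 (.add (.mul (.var 36) (.var 9)) (.var 35))) (.var 2)) (.var 34))))) σ₁)) with hσ₂
  have h₂ : Loaded I σ₂ := ((h₁.det _ (by simp [writesN]) (by simp [writesF])).det _ (by simp)
    (by simp)).det _ (by simp) (by simp)
  have e4 : σ₂.fld 4 = Function.update (σ₁.fld 4) (I.d + 1) (-I.y (I.guess σ k v * I.s + j)) := by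
    simp [hσ₂, FExpr.eval, NExpr.eval, h₁.n3, h₁.f2, h₁.n2, hn, hk, hv, hj, h.n9, h.n2, Inst.guess]
  have := addPow_spec (off := .const 0) (len := 3) σ₂ 0 (I.d + 2) (by norm_num)
    (fun _ _ => rfl) (by rw [h₂.n3]; omega) x
  rw [rowVal_apply, this, ← rowVal_apply, e4,
    rowVal_update _ (by omega) _ _ (zeroRow_spec (by norm_num) σ (by rw [h.n15]; omega)), hz,
    h₂.n3]
  simp [hσ₂, FExpr.eval, hσ₁, det_fld_of_notMem]
  ring

/-- The linear equations for one slot. -/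
def slotEquations : Prog :=
  seq (letF 11 (.read 1 (.div (.read 40 (.add (.mul (.var 36) (.var 9)) (.var 35))) (.var 5))))
    (for' 34 2 (seq valueRow (seq (addEquation 15) nextPoint)))

/-- The matrix of the solutions of the linear equations of a trial. -/
def system : Prog :=
  seq (initMatrix 15) (seq (letF 11 .one) (seq
    (for' 34 13 (seq combineRow (seq (addEquation 15) nextPoint))) (for' 35 9 slotEquations)))

/-- Store the normalized solution of the linear equations of a trial. -/
def candidate : Prog :=
  seq system (seq (extractRow 15 13)
    (fill 14 30 3 (.const 0) (.mul (.read 13 (.var 30)) (.inv (.read 13 (.var 3))))))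

@[simp] theorem writesN_slotEquations : slotEquations.writesN =
    34 :: ((valueRow.writesN ++ (addEquation 15).writesN) ++ [34]) := rfl
@[simp] theorem writesF_slotEquations : slotEquations.writesF =
    11 :: (valueRow.writesF ++ (addEquation 15).writesF ++ [11]) := rfl
@[simp] theorem writesN_system : system.writesN = [31, 30, 30, 31] ++
    34 :: ((combineRow.writesN ++ (addEquation 15).writesN) ++ [34]) ++
    35 :: (slotEquations.writesN ++ [35]) := rfl
@[simp] theorem writesF_system : system.writesF = [5, 5] ++ 11 :: (combineRow.writesF ++
    (addEquation 15).writesF ++ [11]) ++ slotEquations.writesF := rfl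
@[simp] theorem writesN_candidate : candidate.writesN =
    system.writesN ++ ((extractRow 15 13).writesN ++ [30, 30]) := rfl
@[simp] theorem writesF_candidate : candidate.writesF =
    system.writesF ++ [13, 14] := rfl

theorem slotEquations_spec {σ : State F} (h : Loaded I σ) {k v : ℕ} (hk : σ.nat 36 0 = k)
    (hv : σ.nat 35 0 = v) {P : (ℕ → F) → Prop} (hP : RowsSpan (σ.fld 5) (I.d + 2) P) :
    RowsSpan ((slotEquations.det σ).fld 5) (I.d + 2) (fun x => P x ∧ ∀ j < I.s,
      (polyOf x 0 (I.d + 1)).eval (I.g ^ j * I.a (I.guess σ k v / I.l)) =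
        x (I.d + 1) * I.y (I.guess σ k v * I.s + j)) := by
  rw [slotEquations, det_seq]
  set u := I.guess σ k v with hu
  set σ₁ := (letF 11 (.read 1 (.div (.read 40 (.add (.mul (.var 36) (.var 9)) (.var 35)))
    (.var 5)))).det σ with hσ₁
  have h₁ : Loaded I σ₁ := h.det _ (by simp) (by simp)
  have h11 : σ₁.fld 11 0 = I.a (u / I.l) := by
    simp [hσ₁, FExpr.eval, NExpr.eval, hk, hv, h.n5, h.f1, hu, Inst.guess, h.n9]
  have key := for'_rule_fld (fun j f => f 11 0 = I.g ^ j * I.a (u / I.l) ∧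
      RowsSpan (f 5) (I.d + 2) (fun x => P x ∧ ∀ i < j,
      (polyOf x 0 (I.d + 1)).eval (I.g ^ i * I.a (u / I.l)) =
        x (I.d + 1) * I.y (u * I.s + i))) 34 2
      (seq valueRow (seq (addEquation 15) nextPoint)) σ₁ (by simp [writesN]) (by simp [writesN])
      (by norm_num) ⟨by simpa using h11, hP.congr fun x => by simp⟩ ?_
  · rw [h₁.n2] at key
    exact key.2
  · rintro j hj τ hjτ hτn hτf ⟨hpt, hI⟩
    have hτ : Loaded I τ := h₁.body hτn hτf (by norm_num) (by simp [writesN]) (by simp [writesF])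
    have e35 : τ.nat 35 0 = v := (congrFun (hτn 35 (by simp) (by simp [writesN])) 0).trans hv
    have e36 : τ.nat 36 0 = k := (congrFun (hτn 36 (by simp) (by simp [writesN])) 0).trans hk
    have e40 : I.guess τ k v = u := congrFun (hτn 40 (by simp) (by simp [writesN])) _
    have hrow := valueRow_spec hτ e36 e35 hjτ
    set τ₁ := valueRow.det τ with hτ₁
    have hτ₁' : Loaded I τ₁ := hτ.det _ (by simp) (by simp)
    have e5 : τ₁.fld 5 = τ.fld 5 := det_fld_of_notMem _ (by simp) _
    have e11 : τ₁.fld 11 = τ.fld 11 := det_fld_of_notMem _ (by simp) _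
    have hadd := addEquation_spec (W := 15) (by norm_num) (by norm_num) τ₁ (by
      rw [hτ₁'.n15, e5]; exact hI)
    rw [hτ₁'.n15] at hadd
    have hτ₂ : Loaded I ((addEquation 15).det τ₁) := hτ₁'.det _ (by simp) (by simp)
    refine ⟨?_, ?_⟩
    · simp [nextPoint, FExpr.eval, det_fld_of_notMem, e11, hpt, hτ₂.f0, pow_succ, NExpr.eval,
        hτ.f0, hτ₁'.f0]
      ring
    · refine RowsSpan.congr (by simpa [nextPoint] using hadd) fun x => ?_
      simp only [hrow, hpt, e40, sub_eq_zero]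
      rw [and_assoc, Nat.forall_lt_succ_right]

/-- The vanishing of a polynomial of degree at most `D + d` is imposed through its values at the `D
+ d + 1` powers `g ^ j`. -/
theorem system_spec {σ : State F} (h : Loaded I σ) {q : ℕ → F} (hq : HasInterp I q σ) {k : ℕ}
    (hk : σ.nat 36 0 = k) :
    RowsSpan ((system.det σ).fld 5) (I.d + 2) (fun x =>
      (∀ j < I.D + I.d + 1,
        (I.combine (I.interpPoly q) (x (I.d + 1)) (polyOf x 0 (I.d + 1))).eval (I.g ^ j) = 0) ∧
      ∀ v < I.t, ∀ j < I.s, (polyOf x 0 (I.d + 1)).eval (I.g ^ j * I.a (I.guess σ k v / I.l)) =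
        x (I.d + 1) * I.y (I.guess σ k v * I.s + j)) := by
  rw [system, det_seq, det_seq, det_seq]
  set σ₁ := (letF 11 .one).det ((initMatrix 15).det σ) with hσ₁
  have h₁ : Loaded I σ₁ := (h.det _ (by simp) (by simp)).det _ (by simp) (by simp)
  have hq₁ : HasInterp I q σ₁ := HasInterp.det (HasInterp.det hq _ (by simp)) _ (by simp)
  have hinit := initMatrix_spec (W := 15) (by norm_num) (by norm_num) σ
  rw [h.n15] at hinit
  have key₁ := for'_rule_fld (fun i f => f 11 0 = I.g ^ i ∧ RowsSpan (f 5) (I.d + 2) (fun x =>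
      ∀ j < i, (I.combine (I.interpPoly q) (x (I.d + 1)) (polyOf x 0 (I.d + 1))).eval (I.g ^ j) = 0))
      34 13 (seq combineRow (seq (addEquation 15) nextPoint)) σ₁ (by simp [writesN])
      (by simp [writesN]) (by norm_num) ⟨by simp [hσ₁, FExpr.eval], hinit.congr fun x => by simp⟩ ?_
  · rw [h₁.n13] at key₁
    set σ₂ := (for' 34 13 (seq combineRow (seq (addEquation 15) nextPoint))).det σ₁ with hσ₂
    have h₂ : Loaded I σ₂ := h₁.det _ (by simp [writesN]) (by simp [writesF])
    have e36 : ∀ A, 36 ≤ A → σ₂.nat A = σ.nat A := fun A hA => by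
      rw [hσ₂, det_nat_of_notMem _ (by simp [writesN]; omega), hσ₁, det_letF_nat,
        det_nat_of_notMem _ (by simp; omega)]
    have key₂ := for'_rule_fld (fun i f => RowsSpan (f 5) (I.d + 2) (fun x =>
        (∀ j < I.D + I.d + 1,
          (I.combine (I.interpPoly q) (x (I.d + 1)) (polyOf x 0 (I.d + 1))).eval (I.g ^ j) = 0) ∧
        ∀ v < i, ∀ j < I.s, (polyOf x 0 (I.d + 1)).eval (I.g ^ j * I.a (I.guess σ k v / I.l)) =
          x (I.d + 1) * I.y (I.guess σ k v * I.s + j))) 35 9 slotEquations σ₂ (by simp) (by simp)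
        (by norm_num) (key₁.2.congr fun x => by simp) ?_
    · rw [h₂.n9] at key₂
      exact key₂
    · intro v hv τ hvτ hτn hτf hI
      have hτ : Loaded I τ := h₂.body hτn hτf (by norm_num) (by simp [writesN]) (by simp [writesF])
      have e40 : I.guess τ k v = I.guess σ k v :=
        congrFun ((hτn 40 (by simp) (by simp)).trans (e36 40 (by norm_num))) _
      have := slotEquations_spec hτ (k := k) (by
        rw [hτn 36 (by simp) (by simp), e36 _ le_rfl, hk]) hvτ hI
      rw [e40] at this
      refine this.congr fun x => ?_
      simp only [and_assoc, Nat.forall_lt_succ_right]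
  · rintro i hi τ hiτ hτn hτf ⟨hpt, hI⟩
    have hτ : Loaded I τ := h₁.body hτn hτf (by norm_num) (by simp [writesN]) (by simp [writesF])
    have hqτ : HasInterp I q τ := HasInterp.of_eq hq₁ (hτf 12 (by simp [writesF]))
    have hrow := combineRow_spec hτ hqτ hpt
    set τ₁ := combineRow.det τ with hτ₁
    have hτ₁' : Loaded I τ₁ := hτ.det _ (by simp) (by simp)
    have e5 : τ₁.fld 5 = τ.fld 5 := det_fld_of_notMem _ (by simp) _
    have e11 : τ₁.fld 11 = τ.fld 11 := det_fld_of_notMem _ (by simp) _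
    have hadd := addEquation_spec (W := 15) (by norm_num) (by norm_num) τ₁ (by
      rw [hτ₁'.n15, e5]; exact hI)
    rw [hτ₁'.n15] at hadd
    have hτ₂ : Loaded I ((addEquation 15).det τ₁) := hτ₁'.det _ (by simp) (by simp)
    refine ⟨?_, ?_⟩
    · simp [nextPoint, FExpr.eval, det_fld_of_notMem, e11, hpt, hτ₂.f0, pow_succ, NExpr.eval,
        hτ.f0, hτ₁'.f0]
    · refine RowsSpan.congr (by simpa [nextPoint] using hadd) fun x => ?_
      simp only [hrow]
      rw [Nat.forall_lt_succ_right]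

/-- A trial with good guesses for `P` finds `P`. -/
theorem candidate_spec (hV : I.Valid) {σ : State F} (h : Loaded I σ) {q : ℕ → F}
    (hA : I.IsInterp (I.interpPoly q)) (hq : HasInterp I q σ) {k : ℕ} (hk : σ.nat 36 0 = k)
    {P : F[X]} (hP : I.InList P) {u : Fin I.t → Fin (I.n * I.l)}
    (hu : I.Good (I.interpPoly q) P u) (huk : ∀ v : Fin I.t, I.guess σ k v = u v) :
    polyOf ((candidate.det σ).fld 14) 0 (I.d + 1) = P := by
  classical
  rw [candidate, det_seq, det_seq]
  set σ₁ := system.det σ with hσ₁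
  have h₁ : Loaded I σ₁ := h.det _ (by simp) (by simp)
  have hsys := system_spec h hq hk
  have hcomb := hA.combine_eq_zero hV hP
  have hPc := polyOf_coeff_self hP.1
  obtain ⟨x, hx0, hxl, ⟨hx1, hx2⟩, hfld⟩ := extractRow_spec (W := 15) (T := 13) (by norm_num)
    (by norm_num) (by norm_num) (by norm_num) σ₁ (by rw [h₁.n15]; exact hsys) (by
      have hpx : polyOf (Function.update P.coeff (I.d + 1) 1 : ℕ → F) 0 (I.d + 1) = P :=
        (polyOf_congr fun k hk => Function.update_of_ne (by omega) _ _).trans hPc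
      -- The coefficients of `P` followed by `z = 1` solve the system; the last entry makes the
      -- vector nonzero.
      refine ⟨Function.update P.coeff (I.d + 1) 1, fun h0 => ?_, fun i hi => ?_, fun j _ => ?_,
        fun v hv j hj => ?_⟩
      · have := congrFun h0 (I.d + 1)
        simp at this
      · rw [h₁.n15] at hi
        rw [Function.update_of_ne (by omega)]
        exact coeff_eq_zero_of_natDegree_lt (by have := hP.1; omega)
      · rw [hpx, Function.update_self, hcomb, eval_zero]
      · rw [hpx, Function.update_self, one_mul]
        have := hu.1 ⟨v, hv⟩ j hj
        rwa [← huk] at this)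
  rw [h₁.n15] at hxl hfld
  set σ₂ := (extractRow 15 13).det σ₁ with hσ₂
  have h₂ : Loaded I σ₂ := h₁.det _ (by simp) (by simp)
  set R := polyOf x 0 (I.d + 1) with hR
  have hRd : R.natDegree ≤ I.d := natDegree_polyOf_le _ _ _
  have hRz : I.combine (I.interpPoly q) (x (I.d + 1)) R = 0 := by
    refine eq_zero_of_natDegree_lt_card_of_eval_eq_zero' _
      ((Finset.range (I.D + I.d + 1)).image fun j => I.g ^ j) ?_ ?_
    · intro z hz
      obtain ⟨j, hj, rfl⟩ := Finset.mem_image.1 hz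
      exact hx1 j (Finset.mem_range.1 hj)
    · rw [Finset.card_image_of_injOn, Finset.card_range]
      · exact Nat.lt_succ_of_le (hA.combine_natDegree_le _ hRd)
      · refine hV.g_inj.mono fun j hj => ?_
        have := hV.D_add_d_lt'
        simp only [Finset.coe_range, Set.mem_Iio] at hj ⊢
        omega
  have hRP : R = x (I.d + 1) • P := by
    refine hu.unique hP.1 hcomb hRd hRz fun v j hj => ?_
    rw [← huk]
    exact hx2 v v.2 j hj
  -- With `z = 0`, the extracted solution would be `0 • P` and hence the zero vector. So dividing by
  -- `z` is legitimate and returns `P`.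
  have hz0 : x (I.d + 1) ≠ 0 := by
    intro hz
    rw [hz, zero_smul] at hRP
    refine hx0 (funext fun i => ?_)
    rcases lt_trichotomy i (I.d + 1) with hi | rfl | hi
    · have := polyOf_coeff x 0 (I.d + 1) i
      rw [← hR, hRP, if_pos hi, zero_add] at this
      simpa using this.symm
    · exact hz
    · exact hxl i hi
  rw [fill_spec σ₂ 0 (fun i => x i * (x (I.d + 1))⁻¹) (by norm_num) (fun _ _ => rfl), h₂.n3]
  · ext i
    rw [polyOf_coeff]
    by_cases hi : i < I.d + 1
    · have := polyOf_coeff x 0 (I.d + 1) i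
      rw [← hR, hRP, if_pos hi, zero_add, coeff_smul, smul_eq_mul] at this
      simp [hi, ← this]
      field_simp
    · rw [if_neg hi]
      exact (coeff_eq_zero_of_natDegree_lt (by have := hP.1; omega)).symm
  · intro i hi ρ hρv hρn hρf _
    rw [h₂.n3] at hi
    simp only [FExpr.eval, NExpr.eval, NExpr.eval_var, hρv, hρf 13 (by norm_num), hρn 3 (by norm_num),
      h₂.n3]
    rw [hfld _ (by omega), hfld _ (by omega)]

end Prog

end FoldedRS
end

noncomputable section

namespace FoldedRS

universe u

set_option linter.unusedSectionVars false
set_option linter.unusedSimpArgs false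

open Polynomial Module

variable {F : Type u} [Field F] {I : Inst F}

/-- The polynomial found in the current trial. -/
def Inst.found (I : Inst F) (σ : State F) : F[X] := polyOf (σ.fld 14) 0 (I.d + 1)

/-- Entry `j` of the output list. -/
def Inst.out (I : Inst F) (σ : State F) (j : ℕ) : F[X] :=
  polyOf (σ.fld 3) (j * (I.d + 1)) (I.d + 1)

namespace Prog

/-! ### Testing and storing a polynomial

The array `50` of natural numbers holds the result of a comparison, `51` tells whether the current
coordinate is hit, `52` is the number of missed coordinates, and `53` tells whether the polynomial is
already in the output list. -/

/-- Whether the polynomial agrees with a list entry. -/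
def testEntry : Prog :=
  seq (letN 50 (.const 1)) (seq (letF 10 (.read 1 (.var 35))) (for' 33 2
    (seq (evalPoly 14 (.const 0) 3) (seq
      (ite (.eq (.var 8) (.read 2 (.add (.mul (.add (.mul (.var 35) (.var 5)) (.var 34)) (.var 2))
        (.var 33)))) skip (letN 50 (.const 0)))
      (letF 10 (.mul (.var 10) (.read 0 (.const 0))))))))

/-- Whether the polynomial agrees with an entry of a list. -/
def testCoordinate : Prog :=
  seq (letN 51 (.const 0)) (for' 34 5 (seq testEntry
    (ite (.le (.const 1) (.var 50)) (letN 51 (.const 1)) skip)))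

/-- Count the missed coordinates. -/
def countMissed : Prog :=
  seq (letN 52 (.const 0)) (for' 35 4 (seq testCoordinate
    (ite (.le (.const 1) (.var 51)) skip (incr 52 4))))

/-- Whether the polynomial is equal to an entry of the output list. -/
def testEqual : Prog :=
  seq (letN 50 (.const 1)) (for' 33 3
    (ite (.eq (.read 3 (.add (.mul (.var 35) (.var 3)) (.var 33))) (.read 14 (.var 33)))
      skip (letN 50 (.const 0))))

/-- Whether the polynomial is in the output list. -/
def testStored : Prog :=
  seq (letN 53 (.const 0)) (for' 35 1 (seq testEqual
    (ite (.le (.const 1) (.var 50)) (letN 53 (.const 1)) skip)))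

/-- Store a new polynomial that misses few coordinates. -/
def store : Prog :=
  ite (.le (.var 52) (.var 6)) (ite (.le (.const 1) (.var 53)) skip
    (seq (fill 3 30 3 (.mul (.var 1) (.var 3)) (.read 14 (.var 30))) (incr 1 10))) skip

/-- One trial. -/
def trial : Prog := seq candidate (seq countMissed (seq testStored store))

/-- All trials. -/
def trials : Prog := for' 36 10 trial

@[simp] theorem writesN_testEntry : testEntry.writesN = [50, 33, 30, 30, 50, 33] := rfl
@[simp] theorem writesF_testEntry : testEntry.writesF = [10, 8, 9, 8, 9, 10] := rfl
@[simp] theorem writesN_testCoordinate : testCoordinate.writesN =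
    [51, 34, 50, 33, 30, 30, 50, 33, 51, 34] := rfl
@[simp] theorem writesF_testCoordinate : testCoordinate.writesF = [10, 8, 9, 8, 9, 10] := rfl
@[simp] theorem writesN_countMissed : countMissed.writesN =
    [52, 35, 51, 34, 50, 33, 30, 30, 50, 33, 51, 34, 52, 35] := rfl
@[simp] theorem writesF_countMissed : countMissed.writesF = [10, 8, 9, 8, 9, 10] := rfl
@[simp] theorem writesN_testEqual : testEqual.writesN = [50, 33, 50, 33] := rfl
@[simp] theorem writesF_testEqual : testEqual.writesF = [] := rfl
@[simp] theorem writesN_testStored : testStored.writesN = [53, 35, 50, 33, 50, 33, 53, 35] := rfl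
@[simp] theorem writesF_testStored : testStored.writesF = [] := rfl
@[simp] theorem writesN_store : store.writesN = [30, 30, 1] := rfl
@[simp] theorem writesF_store : store.writesF = [3] := rfl
@[simp] theorem writesN_trial : trial.writesN = candidate.writesN ++ (countMissed.writesN ++
    (testStored.writesN ++ store.writesN)) := rfl
@[simp] theorem writesF_trial : trial.writesF = candidate.writesF ++ (countMissed.writesF ++
    (testStored.writesF ++ store.writesF)) := rfl

theorem testEntry_spec {σ : State F} (h : Loaded I σ) {i j : ℕ} (hi : σ.nat 35 0 = i)
    (hj : σ.nat 34 0 = j) (hjl : j < I.l) :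
    1 ≤ (testEntry.det σ).nat 50 0 ↔ I.Agree (I.found σ) (i * I.l + j) := by
  rw [testEntry, det_seq, det_seq]
  set σ₁ := (letF 10 (.read 1 (.var 35))).det ((letN 50 (.const 1)).det σ) with hσ₁
  have h₁ : Loaded I σ₁ := (h.det _ (by simp) (by simp)).det _ (by simp) (by simp)
  have hdiv : (i * I.l + j) / I.l = i := by
    rw [mul_comm, Nat.mul_add_div (by omega), Nat.div_eq_of_lt hjl, add_zero]
  have key := for'_rule (fun k (τ : State F) => τ.fld 10 0 = I.g ^ k * I.a i ∧ (1 ≤ τ.nat 50 0 ↔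
      ∀ k' < k, (I.found σ).eval (I.g ^ k' * I.a i) = I.y ((i * I.l + j) * I.s + k'))) 33 2
      (seq (evalPoly 14 (.const 0) 3) (seq
        (ite (.eq (.var 8) (.read 2 (.add (.mul (.add (.mul (.var 35) (.var 5)) (.var 34)) (.var 2))
          (.var 33)))) skip (letN 50 (.const 0)))
        (letF 10 (.mul (.var 10) (.read 0 (.const 0)))))) σ₁
      (fun k τ τ' hf hn hk => by rw [← hf, ← hn 50 (by norm_num)]; exact hk)
      (by simp [writesN]) (by simp [writesN]) (by norm_num)
      ⟨by simp [hσ₁, FExpr.eval, NExpr.eval, h.f1, hi], by simp [hσ₁, NExpr.eval]⟩ ?_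
  · rw [h₁.n2] at key
    rw [key.2, Inst.Agree, hdiv]
  · rintro k hk τ hv hτn hτf ⟨h10, hI⟩
    have hτ : Loaded I τ := h₁.body hτn hτf (by norm_num) (by simp [writesN]) (by simp [writesF])
    have e35 : τ.nat 35 0 = i := (congrFun (hτn 35 (by simp) (by simp [writesN])) 0).trans hi
    have e34 : τ.nat 34 0 = j := (congrFun (hτn 34 (by simp) (by simp [writesN])) 0).trans hj
    have e14 : τ.fld 14 = σ.fld 14 := (hτf 14 (by simp [writesF])).trans (by simp [hσ₁])
    have hev := evalPoly_spec (A := 14) (off := .const 0) (len := 3) τ 0 (by norm_num)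
      (by norm_num) (by norm_num) (fun _ _ => rfl)
    rw [hτ.n3, e14, h10] at hev
    simp only [det_seq]
    set τ₁ := (evalPoly 14 (.const 0) 3).det τ with hτ₁
    have hτ₁' : Loaded I τ₁ := hτ.det _ (by simp) (by simp)
    have hn : ∀ A, A ≠ 30 → τ₁.nat A = τ.nat A := fun A hA => by
      simp [hτ₁, det_nat_of_notMem, hA]
    have k10 : τ₁.fld 10 0 = I.g ^ k * I.a i := by rw [hτ₁, det_fld_of_notMem _ (by simp), h10]
    have htest : (Test.eq (.var 8) (.read 2 (.add (.mul (.add (.mul (.var 35) (.var 5)) (.var 34))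
        (.var 2)) (.var 33)))).Holds τ₁ ↔
        (I.found σ).eval (I.g ^ k * I.a i) = I.y ((i * I.l + j) * I.s + k) := by
      simp [Test.Holds, FExpr.eval, NExpr.eval, hev, hn, e35, e34, hv, hτ.n5, hτ.n2, hτ₁'.f2,
        Inst.found]
    rw [Nat.forall_lt_succ_right, ← htest, ← hI, ← hn 50 (by norm_num)]
    by_cases ht : (Test.eq (.var 8) (.read 2 (.add (.mul (.add (.mul (.var 35) (.var 5)) (.var 34))
        (.var 2)) (.var 33)))).Holds τ₁
    · simp [det, if_pos ht, ht, FExpr.eval, NExpr.eval, k10, hτ₁'.f0]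
      ring
    · simp only [det, if_neg ht, ht]
      simp [det, FExpr.eval, NExpr.eval, k10, hτ₁'.f0, letN]
      ring

theorem testCoordinate_spec {σ : State F} (h : Loaded I σ) {i : ℕ} (hi : σ.nat 35 0 = i) :
    1 ≤ (testCoordinate.det σ).nat 51 0 ↔ I.Hit (I.found σ) i := by
  rw [testCoordinate, det_seq]
  have h₁ : Loaded I ((letN 51 (.const 0)).det σ) := h.det _ (by simp) (by simp)
  have key := for'_rule (fun j (τ : State F) => 1 ≤ τ.nat 51 0 ↔
      ∃ j' < j, I.Agree (I.found σ) (i * I.l + j')) 34 5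
      (seq testEntry (ite (.le (.const 1) (.var 50)) (letN 51 (.const 1)) skip))
      ((letN 51 (.const 0)).det σ)
      (fun k τ τ' hf hn hk => by rw [← hn 51 (by norm_num)]; exact hk)
      (by simp [writesN]) (by simp [writesN]) (by norm_num)
      (by simp [NExpr.eval]) ?_
  · rw [h₁.n5] at key
    exact key
  · intro j hj τ hv hτn hτf hI
    have hτ : Loaded I τ := h₁.body hτn hτf (by norm_num) (by simp [writesN]) (by simp [writesF])
    have e35 : τ.nat 35 0 = i := (congrFun (hτn 35 (by simp) (by simp [writesN])) 0).trans (by simpa)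
    have e14 : I.found τ = I.found σ := by
      rw [Inst.found, hτf 14 (by simp [writesF])]; rfl
    have hent := testEntry_spec hτ e35 hv (h₁.n5 ▸ hj)
    rw [e14] at hent
    have e51 : (testEntry.det τ).nat 51 0 = τ.nat 51 0 := by rw [det_nat_of_notMem _ (by simp)]
    rw [det_seq, Nat.exists_lt_succ_right, ← hI, ← hent, ← e51]
    by_cases ht : (Test.le (.const 1) (.var 50)).Holds (testEntry.det τ)
    · have ht' : 1 ≤ (testEntry.det τ).nat 50 0 := ht
      simp only [det, if_pos ht]
      simp [letN, det, NExpr.eval, ht']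
    · have ht' : ¬ 1 ≤ (testEntry.det τ).nat 50 0 := ht
      simp only [det, if_neg ht]
      simp [det, NExpr.eval, ht']

theorem countMissed_spec {σ : State F} (h : Loaded I σ) :
    (countMissed.det σ).nat 52 0 = I.miss (I.found σ) := by
  classical
  rw [countMissed, det_seq]
  have h₁ : Loaded I ((letN 52 (.const 0)).det σ) := h.det _ (by simp) (by simp)
  have key := for'_rule (fun i (τ : State F) => τ.nat 52 0 =
      ((Finset.range i).filter fun i => ¬I.Hit (I.found σ) i).card) 35 4
      (seq testCoordinate (ite (.le (.const 1) (.var 51)) skip (incr 52 4)))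
      ((letN 52 (.const 0)).det σ)
      (fun k τ τ' hf hn hk => by rw [← hn 52 (by norm_num)]; exact hk)
      (by simp [writesN]) (by simp [writesN]) (by norm_num) (by simp [NExpr.eval]) ?_
  · rw [h₁.n4] at key
    rw [key, Inst.miss]
  · intro i hi τ hv hτn hτf hI
    have hτ : Loaded I τ := h₁.body hτn hτf (by norm_num) (by simp [writesN]) (by simp [writesF])
    have e14 : I.found τ = I.found σ := by
      rw [Inst.found, hτf 14 (by simp [writesF])]; rfl
    have hent := testCoordinate_spec hτ hv
    rw [e14] at hent
    have e52 : (testCoordinate.det τ).nat 52 0 = τ.nat 52 0 := by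
      rw [det_nat_of_notMem _ (by simp)]
    have e4 : (testCoordinate.det τ).nat 4 0 = I.n := by
      rw [det_nat_of_notMem _ (by simp), hτ.n4]
    rw [h₁.n4] at hi
    have hle : ((Finset.range i).filter fun i => ¬I.Hit (I.found σ) i).card ≤ i :=
      (Finset.card_filter_le _ _).trans (by simp)
    rw [det_seq, Finset.range_add_one, Finset.filter_insert]
    by_cases ht : (Test.le (.const 1) (.var 51)).Holds (testCoordinate.det τ)
    · have ht' : I.Hit (I.found σ) i := hent.1 ht
      simp only [det, if_pos ht, if_neg (not_not.2 ht')]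
      simp [e52, hI]
    · have ht' : ¬I.Hit (I.found σ) i := fun hh => ht (hent.2 hh)
      simp only [det, if_neg ht, if_pos ht']
      rw [Finset.card_insert_of_notMem (by simp), det_incr_nat, Function.update_self,
        Function.update_self, State.tick_nat, e52, hI, e4]
      -- The counter is at most `i < n`, so the reduction modulo `n + 1` has no effect.
      exact Nat.mod_eq_of_lt (by omega)

theorem testEqual_spec {σ : State F} (h : Loaded I σ) {j : ℕ} (hj : σ.nat 35 0 = j) :
    1 ≤ (testEqual.det σ).nat 50 0 ↔ I.out σ j = I.found σ := by
  rw [testEqual, det_seq]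
  have h₁ : Loaded I ((letN 50 (.const 1)).det σ) := h.det _ (by simp) (by simp)
  have key := for'_rule (fun k (τ : State F) => 1 ≤ τ.nat 50 0 ↔
      ∀ k' < k, σ.fld 3 (j * (I.d + 1) + k') = σ.fld 14 k') 33 3
      (ite (.eq (.read 3 (.add (.mul (.var 35) (.var 3)) (.var 33))) (.read 14 (.var 33)))
        skip (letN 50 (.const 0)))
      ((letN 50 (.const 1)).det σ)
      (fun k τ τ' hf hn hk => by rw [← hn 50 (by norm_num)]; exact hk)
      (by simp [writesN]) (by simp [writesN]) (by norm_num) (by simp [NExpr.eval]) ?_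
  · rw [h₁.n3] at key
    rw [key]
    constructor
    · intro hk
      rw [Inst.out, Inst.found, polyOf, polyOf]
      refine Finset.sum_congr rfl fun k hkd => ?_
      rw [hk k (Finset.mem_range.1 hkd), zero_add]
    · intro hk k hkd
      have := congrArg (fun P => P.coeff k) hk
      simpa [Inst.out, Inst.found, polyOf_coeff, hkd] using this
  · intro k hk τ hv hτn hτf hI
    have hτ : Loaded I τ := h₁.body hτn hτf (by norm_num) (by simp [writesN]) (by simp [writesF])
    have e35 : τ.nat 35 0 = j := (congrFun (hτn 35 (by simp) (by simp [writesN])) 0).trans (by simpa)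
    have e14 : τ.fld 14 = σ.fld 14 := hτf 14 (by simp [writesF])
    have e3 : τ.fld 3 = σ.fld 3 := hτf 3 (by simp [writesF])
    have htest : (Test.eq (.read 3 (.add (.mul (.var 35) (.var 3)) (.var 33)))
        (.read 14 (.var 33))).Holds τ ↔ σ.fld 3 (j * (I.d + 1) + k) = σ.fld 14 k := by
      simp [Test.Holds, FExpr.eval, NExpr.eval, e35, hv, e14, e3, hτ.n3]
    rw [Nat.forall_lt_succ_right, ← htest, ← hI]
    by_cases ht : (Test.eq (.read 3 (.add (.mul (.var 35) (.var 3)) (.var 33)))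
        (.read 14 (.var 33))).Holds τ
    · simp [det, if_pos ht, ht]
    · simp only [det, if_neg ht, ht]
      simp [det, NExpr.eval, letN]

theorem testStored_spec {σ : State F} (h : Loaded I σ) :
    1 ≤ (testStored.det σ).nat 53 0 ↔ ∃ j < σ.nat 1 0, I.out σ j = I.found σ := by
  rw [testStored, det_seq]
  have h₁ : Loaded I ((letN 53 (.const 0)).det σ) := h.det _ (by simp) (by simp)
  have key := for'_rule (fun k (τ : State F) => 1 ≤ τ.nat 53 0 ↔
      ∃ j < k, I.out σ j = I.found σ) 35 1
      (seq testEqual (ite (.le (.const 1) (.var 50)) (letN 53 (.const 1)) skip))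
      ((letN 53 (.const 0)).det σ)
      (fun k τ τ' hf hn hk => by rw [← hn 53 (by norm_num)]; exact hk)
      (by simp [writesN]) (by simp [writesN]) (by norm_num) (by simp [NExpr.eval]) ?_
  · simpa using key
  · intro j hj τ hv hτn hτf hI
    have hτ : Loaded I τ := h₁.body hτn hτf (by norm_num) (by simp [writesN]) (by simp [writesF])
    have e14 : I.found τ = I.found σ := by
      rw [Inst.found, hτf 14 (by simp [writesF])]; rfl
    have e3 : I.out τ j = I.out σ j := by
      rw [Inst.out, hτf 3 (by simp [writesF])]; rfl
    have hent := testEqual_spec hτ hv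
    rw [e14, e3] at hent
    have e53 : (testEqual.det τ).nat 53 0 = τ.nat 53 0 := by rw [det_nat_of_notMem _ (by simp)]
    rw [det_seq, Nat.exists_lt_succ_right, ← hI, ← hent, ← e53]
    by_cases ht : (Test.le (.const 1) (.var 50)).Holds (testEqual.det τ)
    · have ht' : 1 ≤ (testEqual.det τ).nat 50 0 := ht
      simp only [det, if_pos ht]
      simp [letN, det, NExpr.eval, ht']
    · have ht' : ¬ 1 ≤ (testEqual.det τ).nat 50 0 := ht
      simp only [det, if_neg ht]
      simp [det, NExpr.eval, ht']

/-- Acceptance is decided by an exact test, so a bad guess can only be useless, never harmful. The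
assumption `hlen` keeps the length counter from wrapping around. -/
theorem trial_spec {σ : State F} (h : Loaded I σ) (hlen : σ.nat 1 0 < σ.nat 10 0) :
    (I.InList (I.found (candidate.det σ)) ∧
      (∀ j < σ.nat 1 0, I.out σ j ≠ I.found (candidate.det σ)) ∧
      (trial.det σ).nat 1 0 = σ.nat 1 0 + 1 ∧ (∀ j < σ.nat 1 0, I.out (trial.det σ) j = I.out σ j) ∧
      I.out (trial.det σ) (σ.nat 1 0) = I.found (candidate.det σ)) ∨
    ((I.InList (I.found (candidate.det σ)) →
        ∃ j < σ.nat 1 0, I.out σ j = I.found (candidate.det σ)) ∧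
      (trial.det σ).nat 1 0 = σ.nat 1 0 ∧ ∀ j, I.out (trial.det σ) j = I.out σ j) := by
  rw [trial, det_seq, det_seq, det_seq]
  set σ₁ := candidate.det σ with hσ₁
  have h₁ : Loaded I σ₁ := h.det _ (by simp) (by simp)
  have hmiss := countMissed_spec h₁
  set σ₂ := countMissed.det σ₁ with hσ₂
  have h₂ : Loaded I σ₂ := h₁.det _ (by simp) (by simp)
  have hst := testStored_spec h₂
  set σ₃ := testStored.det σ₂ with hσ₃
  have h₃ : Loaded I σ₃ := h₂.det _ (by simp) (by simp)
  have n1₂ : σ₂.nat 1 = σ.nat 1 := by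
    rw [hσ₂, det_nat_of_notMem _ (by simp), hσ₁, det_nat_of_notMem _ (by simp)]
  have n1 : σ₃.nat 1 = σ.nat 1 := by rw [hσ₃, det_nat_of_notMem _ (by simp), n1₂]
  have n52 : σ₃.nat 52 0 = I.miss (I.found σ₁) := by
    rw [hσ₃, det_nat_of_notMem _ (by simp), hmiss]
  have f3 : σ₂.fld 3 = σ.fld 3 := by
    rw [hσ₂, det_fld_of_notMem _ (by simp), hσ₁, det_fld_of_notMem _ (by simp)]
  have f3' : σ₃.fld 3 = σ.fld 3 := by rw [hσ₃, det_fld_of_notMem _ (by simp), f3]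
  have f14 : σ₂.fld 14 = σ₁.fld 14 := by rw [hσ₂, det_fld_of_notMem _ (by simp)]
  have f14' : σ₃.fld 14 = σ₁.fld 14 := by rw [hσ₃, det_fld_of_notMem _ (by simp), f14]
  have hfound : I.found σ₂ = I.found σ₁ := by rw [Inst.found, f14, Inst.found]
  have hout₂ : ∀ j, I.out σ₂ j = I.out σ j := fun j => by rw [Inst.out, f3, Inst.out]
  have hout₃ : ∀ j, I.out σ₃ j = I.out σ j := fun j => by rw [Inst.out, f3', Inst.out]
  simp only [n1₂, hfound, hout₂] at hst
  have t1 : (Test.le (.var 52) (.var 6)).Holds σ₃ ↔ I.InList (I.found σ₁) := by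
    rw [Inst.InList, and_iff_right (show (I.found σ₁).natDegree ≤ I.d from natDegree_polyOf_le _ _ _)]
    simp [Test.Holds, n52, h₃.n6]
  have t2 : (Test.le (.const 1) (.var 53)).Holds σ₃ ↔
      ∃ j < σ.nat 1 0, I.out σ j = I.found σ₁ := hst
  have t2' : ∀ c, (Test.le (.const 1) (.var 53)).Holds (σ₃.tick c) ↔
      ∃ j < σ.nat 1 0, I.out σ j = I.found σ₁ := fun c => (Test.holds_tick _ _ _).trans t2
  clear_value σ₃ σ₂ σ₁
  by_cases hin : I.InList (I.found σ₁)
  swap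
  · right
    simp only [store, det, if_neg (mt t1.1 hin)]
    refine ⟨fun hh => absurd hh hin, by simp [n1], fun j => hout₃ j⟩
  by_cases hold : ∃ j < σ.nat 1 0, I.out σ j = I.found σ₁
  · right
    simp only [store, det, if_pos (t1.2 hin), if_pos ((t2' _).2 hold)]
    exact ⟨fun _ => hold, by simp [n1], fun j => hout₃ j⟩
  · left
    simp only [store, det, if_pos (t1.2 hin), if_neg (mt (t2' _).1 hold)]
    push Not at hold
    set σ₄ := (σ₃.tick ((Test.le (.var 52) (.var 6)).cost σ₃)).tick
      ((Test.le (.const 1) (.var 53)).cost (σ₃.tick ((Test.le (.var 52) (.var 6)).cost σ₃)))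
      with hσ₄
    have g1 : ((fill 3 30 3 (.mul (.var 1) (.var 3)) (.read 14 (.var 30))).det σ₄).nat 1 =
      σ.nat 1 := by rw [det_nat_of_notMem _ (by simp)]; exact n1
    have g10 : ((fill 3 30 3 (.mul (.var 1) (.var 3)) (.read 14 (.var 30))).det σ₄).nat 10 =
      σ₃.nat 10 := by rw [det_nat_of_notMem _ (by simp)]; rfl
    have hfill : ((fill 3 30 3 (.mul (.var 1) (.var 3)) (.read 14 (.var 30))).det σ₄).fld 3 =
        fun i => if σ.nat 1 0 * (I.d + 1) ≤ i ∧ i < σ.nat 1 0 * (I.d + 1) + (I.d + 1) then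
          σ₁.fld 14 (i - σ.nat 1 0 * (I.d + 1)) else σ.fld 3 i := by
      rw [fill_spec σ₄ (σ.nat 1 0 * (I.d + 1)) (σ₁.fld 14) (by norm_num)]
      · have : σ₄.nat 3 0 = I.d + 1 := h₃.n3
        have h3 : σ₄.fld 3 = σ.fld 3 := f3'
        rw [this, h3]
      · intro ρ hρ
        have e1 : σ₄.nat 1 = σ.nat 1 := n1
        have e3 : σ₄.nat 3 0 = I.d + 1 := h₃.n3
        simp [NExpr.eval, hρ, e1, e3]
      · intro k hk ρ hρv hρn hρf _
        have e14 : σ₄.fld 14 = σ₁.fld 14 := f14'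
        simp [FExpr.eval, hρv, hρf 14, e14]
    refine ⟨hin, hold, ?_, fun j hj => ?_, ?_⟩
    · simp only [det_incr_nat, Function.update_self, g1, g10, h₃.n10]
      rw [h.n10] at hlen
      exact Nat.mod_eq_of_lt (by omega)
    · simp only [Inst.out, det_incr_fld, hfill]
      refine polyOf_congr fun k hk => if_neg ?_
      rintro ⟨hc, -⟩
      have : j * (I.d + 1) + (I.d + 1) ≤ σ.nat 1 0 * (I.d + 1) := by
        rw [← Nat.succ_mul]; exact Nat.mul_le_mul_right _ hj
      omega
    · simp only [Inst.out, Inst.found, det_incr_fld, hfill]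
      refine Finset.sum_congr rfl fun k hk => ?_
      rw [Finset.mem_range] at hk
      simp only
      rw [if_pos (by omega), Nat.add_sub_cancel_left, zero_add]

/-- The output of the trials consists of polynomials of the list, without repetitions. It contains
every polynomial of the list that was guessed in some trial. -/
theorem trials_spec (hV : I.Valid) {σ : State F} (h : Loaded I σ) {q : ℕ → F}
    (hA : I.IsInterp (I.interpPoly q)) (hq : HasInterp I q σ) (h0 : σ.nat 1 0 = 0) :
    (∀ j < (trials.det σ).nat 1 0, I.InList (I.out (trials.det σ) j)) ∧
    Set.InjOn (I.out (trials.det σ)) (Set.Iio ((trials.det σ).nat 1 0)) ∧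
    ∀ P, I.InList P → ∀ k < I.Z * (I.Z + 5), ∀ u : Fin I.t → Fin (I.n * I.l),
      I.Good (I.interpPoly q) P u → (∀ v : Fin I.t, I.guess σ k v = u v) →
      ∃ j < (trials.det σ).nat 1 0, I.out (trials.det σ) j = P := by
  -- At most one polynomial is stored per trial; the first clause supplies the assumption `hlen` of
  -- `trial_spec`.
  let J : ℕ → State F → Prop := fun k τ => τ.nat 1 0 ≤ k ∧
    (∀ j < τ.nat 1 0, I.InList (I.out τ j)) ∧ Set.InjOn (I.out τ) (Set.Iio (τ.nat 1 0)) ∧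
    ∀ P, I.InList P → ∀ k' < k, ∀ u : Fin I.t → Fin (I.n * I.l),
      I.Good (I.interpPoly q) P u → (∀ v : Fin I.t, I.guess σ k' v = u v) →
      ∃ j < τ.nat 1 0, I.out τ j = P
  have key := for'_rule J 36 10 trial σ ?_ (by simp) (by simp) (by norm_num) ?_ ?_
  · rw [h.n10] at key
    exact key.2
  · intro k τ τ' hf hn hk
    have e : I.out τ' = I.out τ := by funext j; rw [Inst.out, Inst.out, hf]
    simp only [J, ← hn 1 (by norm_num), e]
    exact hk
  · refine ⟨h0.le, fun j hj => absurd hj (by omega), ?_, fun P _ k hk => absurd hk (by omega)⟩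
    rw [h0]
    intro j hj
    simp at hj
  · rintro k hk τ hv hτn hτf ⟨i1, i2, i3, i4⟩
    have hτ : Loaded I τ := h.body hτn hτf (by norm_num) (by simp) (by simp)
    have hqτ : HasInterp I q τ := HasInterp.of_eq hq (hτf 12 (by simp))
    have hg : ∀ v, I.guess τ k v = I.guess σ k v := fun v => congrFun (hτn 40 (by simp) (by simp)) _
    have hfound : ∀ P, I.InList P → ∀ u : Fin I.t → Fin (I.n * I.l),
        I.Good (I.interpPoly q) P u → (∀ v : Fin I.t, I.guess σ k v = u v) →
        I.found (candidate.det τ) = P := fun P hP u hu huk =>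
      candidate_spec hV hτ hA hqτ hv hP hu fun v => by rw [hg, huk]
    rcases trial_spec hτ (by rw [hτ.n10, ← h.n10]; omega) with
      ⟨c1, c2, c3, c4, c5⟩ | ⟨c1, c2, c3⟩
    · refine ⟨by omega, fun j hj => ?_, ?_, fun P hP k' hk' u hu huk => ?_⟩
      · rw [c3, Nat.lt_succ_iff_lt_or_eq] at hj
        rcases hj with hj | rfl
        · rw [c4 j hj]; exact i2 j hj
        · rw [c5]; exact c1
      · intro j hj j' hj' hjj
        rw [Set.mem_Iio, c3, Nat.lt_succ_iff_lt_or_eq] at hj hj'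
        rcases hj with hj | rfl <;> rcases hj' with hj' | rfl
        · rw [c4 j hj, c4 j' hj'] at hjj
          exact i3 hj hj' hjj
        · rw [c4 j hj, c5] at hjj
          exact absurd hjj (c2 j hj)
        · rw [c4 j' hj', c5] at hjj
          exact absurd hjj.symm (c2 j' hj')
        · rfl
      · rcases Nat.lt_succ_iff_lt_or_eq.1 hk' with hk' | rfl
        · obtain ⟨j, hj, hjP⟩ := i4 P hP k' hk' u hu huk
          exact ⟨j, by omega, by rw [c4 j hj, hjP]⟩
        · exact ⟨τ.nat 1 0, by omega, by rw [c5, hfound P hP u hu huk]⟩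
    · have e : I.out (trial.det τ) = I.out τ := funext c3
      simp only [J, c2, e]
      refine ⟨by omega, i2, i3, fun P hP k' hk' u hu huk => ?_⟩
      rcases Nat.lt_succ_iff_lt_or_eq.1 hk' with hk' | rfl
      · exact i4 P hP k' hk' u hu huk
      · have := hfound P hP u hu huk
        rw [this] at c1
        exact c1 hP

end Prog

end FoldedRS
end

/-! ### Sequences of assignments and the computation of the parameters -/

noncomputable section

namespace FoldedRS

universe u

set_option linter.unusedSectionVars false
set_option linter.unusedSimpArgs false

open Polynomial Module

variable {F : Type u}

/-- The arrays that are read by an expression. -/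
def NExpr.reads : NExpr → List ℕ
  | const _ => []
  | read A i => A :: i.reads
  | add x y => x.reads ++ y.reads
  | sub x y => x.reads ++ y.reads
  | mul x y => x.reads ++ y.reads
  | div x y => x.reads ++ y.reads
  | mod x y => x.reads ++ y.reads

theorem NExpr.eval_congr_reads {σ τ : State F} (e : NExpr) (h : ∀ A ∈ e.reads, σ.nat A = τ.nat A) :
    e.eval σ = e.eval τ := by
  induction e with
  | const => rfl
  | read A i ih =>
    simp only [reads, List.mem_cons, forall_eq_or_imp] at h
    rw [eval, eval, ih h.2, h.1]
  | _ x y hx hy =>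
    simp only [reads, List.mem_append] at h
    rw [eval, eval, hx fun A hA => h A (Or.inl hA), hy fun A hA => h A (Or.inr hA)]

variable [Field F]

namespace Prog

/-- A sequence of assignments to variables. -/
def assign : List (ℕ × NExpr) → Prog
  | [] => skip
  | p :: l => seq (letN p.1 p.2) (assign l)

theorem writesN_assign (l : List (ℕ × NExpr)) : (assign l).writesN = l.map Prod.fst := by
  induction l with
  | nil => rfl
  | cons p l ih => simp [assign, writesN, ih]

theorem writesF_assign (l : List (ℕ × NExpr)) : (assign l).writesF = [] := by
  induction l with
  | nil => rfl
  | cons p l ih => simp [assign, writesF, ih]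

theorem noRand_assign (l : List (ℕ × NExpr)) : (assign l).noRand = true := by
  induction l with
  | nil => rfl
  | cons p l ih => simp [assign, noRand, ih, letN]

/-- Every variable is assigned once, and is not read before or in its assignment. -/
def single : List (ℕ × NExpr) → Bool
  | [] => true
  | p :: l => p.2.reads.all (fun A => A != p.1 && !(l.map Prod.fst).contains A) &&
      !(l.map Prod.fst).contains p.1 && single l

/-- After a sequence of single assignments, the assignments are equations. -/
theorem assign_spec {l : List (ℕ × NExpr)} (hl : single l = true) (σ : State F) :
    ∀ p ∈ l, ((assign l).det σ).nat p.1 0 = p.2.eval ((assign l).det σ) := by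
  induction l generalizing σ with
  | nil => simp
  | cons p l ih =>
    simp only [single, Bool.and_eq_true, List.all_eq_true, Bool.not_eq_true',
      List.contains_eq_mem, decide_eq_false_iff_not, bne_iff_ne] at hl
    obtain ⟨⟨h1, h2⟩, h3⟩ := hl
    simp only [List.mem_cons, forall_eq_or_imp, assign, det_seq]
    refine ⟨?_, ih h3 _⟩
    rw [det_nat_of_notMem _ (by rwa [writesN_assign])]
    simp only [det_letN_nat, Function.update_self]
    refine NExpr.eval_congr_reads _ fun A hA => ?_
    rw [det_nat_of_notMem _ (by rw [writesN_assign]; exact (h1 A hA).2), det_letN_nat,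
      Function.update_of_ne (h1 A hA).1]

/-- The degree of a polynomial bound for the running time of a sequence of assignments. -/
def assignWt : List (ℕ × NExpr) → ℕ
  | [] => 1
  | p :: l => ((p.2.wt + 3) + 1) * (assignWt l + 1) * 2

theorem polyBounded_assign {l : List (ℕ × NExpr)} (hl : l.all (fun p => p.2.safe) = true) :
    PolyBounded F (assign l) (assignWt l) := by
  induction l with
  | nil => exact polyBounded_of_tame (c := skip) rfl
  | cons p l ih =>
    simp only [List.all_cons, Bool.and_eq_true] at hl
    exact (polyBounded_letN hl.1).seq (ih hl.2)

/-! ### Computing the parameters -/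

open NExpr in
/-- The assignments of the parameters that do not depend on a logarithm. -/
def paramList : List (ℕ × NExpr) :=
  [(2, read 0 (const 1)), (3, add (read 0 (const 2)) (const 1)), (4, read 0 (const 3)),
    (5, read 0 (const 4)), (6, read 0 (const 5)),
    (16, sub (sub (mul (var 2) (var 4)) (read 0 (const 2))) (mul (var 2) (var 6))),
    (7, div (mul (mul (mul (const 4) (var 5)) (var 2)) (var 4)) (var 16)),
    (12, add (sub (var 2) (var 7)) (const 1)),
    (14, mul (var 4) (var 5)),
    (8, add (div (mul (var 14) (var 12)) (add (var 7) (const 1))) (const 1)),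
    (17, add (div (mul (mul (const 2) (var 2)) (var 4)) (var 16)) (const 1)),
    (18, mul (const 2) (var 7)),
    (11, mul (add (var 7) (const 1)) (var 8)),
    (13, add (var 8) (read 0 (const 2))),
    (15, add (var 3) (const 1)),
    (19, add (div (var 14) (sub (var 4) (var 6))) (const 1)),
    (20, sub (var 14) (const 1)),
    (21, const 0), (22, var 18)]

/-- One round of the computation of the bit length. -/
def halve : Prog :=
  seq (letN 21 (.mod (.add (.var 21) (.sub (.const 1) (.sub (.const 1) (.var 22))))
    (.add (.var 18) (.const 1)))) (letN 22 (.div (.var 22) (.const 2)))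

open NExpr in
/-- The assignment of the number of guesses in a trial. -/
def guessList : List (ℕ × NExpr) := [(9, mul (var 17) (var 21)), (24, const 2)]

/-- The parameters that are bounded by a polynomial in the input. -/
def smallParams : Prog := seq (assign paramList) (seq (for' 23 18 halve) (assign guessList))

/-- The computation of the inverse of the success probability. -/
def powLoop : Prog := loop (.var 9) (letN 24 (.mul (.var 24) (.var 19)))

open NExpr in
/-- The assignment of the number of trials and the number of guesses. -/
def trialList : List (ℕ × NExpr) :=
  [(10, mul (var 24) (add (var 24) (const 5))), (25, mul (var 10) (var 9))]

theorem size_div_two {y : ℕ} (hy : 0 < y) : Nat.size (y / 2) + 1 = Nat.size y := by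
  conv_rhs => rw [← Nat.bit_bodd_div2 y]
  rw [Nat.size_bit (by rw [Nat.bit_bodd_div2]; omega), Nat.div2_val]

/-- The counter plus the bit length of the current quotient is invariant: `1 - (1 - y)` is one
exactly when `y` is nonzero. After `x` halvings the quotient is zero, because `x < 2 ^ x`. -/
theorem halve_spec {σ : State F} {x : ℕ} (hx : σ.nat 18 0 = x) (h21 : σ.nat 21 0 = 0)
    (h22 : σ.nat 22 0 = x) : ((for' 23 18 halve).det σ).nat 21 0 = Nat.size x := by
  have key := for'_rule (fun k (τ : State F) => τ.nat 22 0 = x / 2 ^ k ∧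
    τ.nat 21 0 + Nat.size (τ.nat 22 0) = Nat.size x) 23 18 halve σ
    (fun k τ τ' _ hn hk => by rw [← hn 22 (by norm_num), ← hn 21 (by norm_num)]; exact hk)
    (by simp [halve, writesN]) (by simp [halve, writesN]) (by norm_num)
    ⟨by simp [h22], by simp [h21, h22]⟩ ?_
  · rw [hx] at key
    rw [← key.2, key.1, Nat.div_eq_of_lt Nat.lt_two_pow_self]
    simp
  · rintro k hk τ hv hτn hτf ⟨h1, h2⟩
    have e18 : τ.nat 18 0 = x := by rw [hτn 18 (by simp) (by simp [halve, writesN]), hx]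
    have hsx := natSize_le_self x
    simp only [halve, det_seq, det_letN_nat, Function.update_self, NExpr.eval, NExpr.eval_var,
      ne_eq, Nat.reduceEqDiff, not_false_eq_true, Function.update_of_ne]
    refine ⟨by rw [h1, Nat.div_div_eq_div_mul, pow_succ], ?_⟩
    rw [e18]
    rcases Nat.eq_zero_or_pos (τ.nat 22 0) with h0 | h0
    · rw [h0] at h2 ⊢
      simp only [Nat.size_zero, Nat.sub_zero, Nat.sub_self, Nat.add_zero, Nat.zero_div] at h2 ⊢
      rw [h2]
      exact Nat.mod_eq_of_lt (by omega)
    · have := size_div_two h0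
      rw [show 1 - (1 - τ.nat 22 0) = 1 by omega, Nat.mod_eq_of_lt (by omega)]
      omega

theorem powLoop_spec (σ : State F) :
    (powLoop.det σ).nat 24 0 = σ.nat 24 0 * σ.nat 19 0 ^ σ.nat 9 0 := by
  have key : ∀ k, ∀ τ : State F, τ.nat = σ.nat → ((fun σ' => (letN 24 (.mul (.var 24)
      (.var 19))).det (σ'.tick 1))^[k] τ).nat 24 0 = σ.nat 24 0 * σ.nat 19 0 ^ k ∧
      ((fun σ' => (letN 24 (.mul (.var 24) (.var 19))).det (σ'.tick 1))^[k] τ).nat 19 0 =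
        σ.nat 19 0 := by
    intro k τ hτ
    induction k with
    | zero => simp [hτ]
    | succ k ih =>
      rw [Function.iterate_succ_apply']
      simp only [det_letN_nat, State.tick_nat, Function.update_self, NExpr.eval, NExpr.eval_var,
        ne_eq, Nat.reduceEqDiff, not_false_eq_true, Function.update_of_ne, ih, and_true]
      ring
  exact (key (σ.nat 9 0) (σ.tick ((NExpr.var 9).cost σ + 1)) rfl).1

/-- The input of an instance is in memory. -/
structure HasInput (I : Inst F) (σ : State F) : Prop where
  n1 : σ.nat 0 1 = I.s
  n2 : σ.nat 0 2 = I.d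
  n3 : σ.nat 0 3 = I.n
  n4 : σ.nat 0 4 = I.l
  n5 : σ.nat 0 5 = I.e
  f0 : σ.fld 0 0 = I.g
  f1 : σ.fld 1 = I.a
  f2 : σ.fld 2 = I.y

variable {I : Inst F}

theorem smallParams_spec {σ : State F} (h : HasInput I σ) {τ : State F}
    (hτ : smallParams.det σ = τ) :
    τ.nat 2 0 = I.s ∧ τ.nat 3 0 = I.d + 1 ∧ τ.nat 4 0 = I.n ∧ τ.nat 5 0 = I.l ∧ τ.nat 6 0 = I.e ∧
    τ.nat 7 0 = I.m ∧ τ.nat 8 0 = I.D + 1 ∧ τ.nat 9 0 = I.t ∧ τ.nat 11 0 = I.width ∧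
    τ.nat 12 0 = I.w ∧ τ.nat 13 0 = I.D + I.d + 1 ∧ τ.nat 14 0 = I.n * I.l ∧
    τ.nat 15 0 = I.d + 2 ∧ τ.nat 19 0 = I.h ∧ τ.nat 20 0 = I.n * I.l - 1 ∧ τ.nat 24 0 = 2 := by
  rw [smallParams, det_seq, det_seq] at hτ
  set σ₁ := (assign paramList).det σ with hσ₁
  have heq := assign_spec (F := F) (l := paramList) rfl σ
  rw [← hσ₁] at heq
  have h0 : σ₁.nat 0 = σ.nat 0 := det_nat_of_notMem _ (by rw [writesN_assign]; decide) _
  simp only [paramList, List.mem_cons, List.not_mem_nil, or_false, forall_eq_or_imp, forall_eq,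
    NExpr.eval, NExpr.eval_var, h0, h.n1, h.n2, h.n3, h.n4, h.n5] at heq
  obtain ⟨e2, e3, e4, e5, e6, e16, e7, e12, e14, e8, e17, e18, e11, e13, e15, e19, e20, e21, e22⟩ :=
    heq
  -- The assignments are now equations; solving them in the order of dependence turns each variable
  -- into a parameter of the instance.
  rw [e2, e4, e6, ← Inst.E] at e16
  rw [e5, e2, e4, e16, ← Inst.m] at e7
  rw [e2, e7, ← Inst.w] at e12
  rw [e4, e5] at e14
  rw [e14, e12, e7, ← Inst.D] at e8
  rw [e2, e4, e16, ← Inst.K] at e17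
  rw [e7] at e18
  rw [e7, e8, ← Inst.width] at e11
  rw [e8] at e13
  rw [e3] at e15
  rw [e14, e4, e6, ← Inst.h] at e19
  rw [e14] at e20
  rw [e18] at e22
  have hlog := halve_spec e18 e21 e22
  set σ₂ := (for' 23 18 halve).det σ₁ with hσ₂
  have hn : ∀ A, A ∉ [23, 21, 22, 9, 24] → τ.nat A = σ₁.nat A := fun A hA => by
    simp only [List.mem_cons, List.not_mem_nil, or_false, not_or] at hA
    rw [← hτ, det_nat_of_notMem _ (by rw [writesN_assign]; simp [guessList, hA]), hσ₂,
      det_nat_of_notMem _ (by simp [halve, writesN, hA])]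
  have heq' := assign_spec (F := F) (l := guessList) rfl σ₂
  rw [hτ] at heq'
  have k21 : τ.nat 21 0 = Nat.size (2 * I.m) := by
    rw [← hτ, det_nat_of_notMem _ (by rw [writesN_assign]; decide), hlog]
  simp only [guessList, List.mem_cons, List.not_mem_nil, or_false, forall_eq_or_imp, forall_eq,
    NExpr.eval, NExpr.eval_var, k21, hn 17 (by simp), e17] at heq'
  obtain ⟨k9, k24⟩ := heq'
  rw [← Inst.t] at k9
  simp only [hn 2 (by simp), hn 3 (by simp), hn 4 (by simp), hn 5 (by simp), hn 6 (by simp),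
    hn 7 (by simp), hn 8 (by simp), hn 11 (by simp), hn 12 (by simp), hn 13 (by simp),
    hn 14 (by simp), hn 15 (by simp), hn 19 (by simp), hn 20 (by simp), e2, e3, e4, e5, e6, e7, e8,
    e11, e12, e13, e14, e15, e19, e20, k9, k24, true_and, and_true]
  omega

/-- The computation of the parameters. -/
def params : Prog := seq smallParams (seq powLoop (assign trialList))

theorem noRand_params : params.noRand = true := by
  simp [params, noRand, smallParams, noRand_assign, powLoop, letN, for', halve, incr]

theorem params_spec {σ : State F} (h : HasInput I σ) (h1 : σ.nat 1 0 = 0) :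
    Loaded I (params.det σ) ∧ (params.det σ).nat 1 0 = 0 ∧
      (params.det σ).nat 20 0 = I.n * I.l - 1 ∧
      (params.det σ).nat 25 0 = I.Z * (I.Z + 5) * I.t := by
  obtain ⟨e2, e3, e4, e5, e6, e7, e8, e9, e11, e12, e13, e14, e15, e19, e20, e24⟩ :=
    smallParams_spec h rfl
  have hf : (params.det σ).fld = σ.fld := funext fun A => det_fld_of_notMem _
    (by simp [params, smallParams, powLoop, halve, writesF, writesF_assign]) _
  have hn1 : (params.det σ).nat 1 = σ.nat 1 := det_nat_of_notMem _
    (by simp [params, smallParams, powLoop, halve, writesN, writesN_assign, paramList, guessList,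
      trialList]) _
  rw [params, det_seq, det_seq] at hf hn1 ⊢
  set σ₁ := smallParams.det σ
  have hpow := powLoop_spec σ₁
  rw [e24, e19, e9, ← Inst.Z] at hpow
  have heq := assign_spec (F := F) (l := trialList) rfl (powLoop.det σ₁)
  have hn : ∀ A, A ∉ [24, 10, 25] → ((assign trialList).det (powLoop.det σ₁)).nat A = σ₁.nat A :=
    fun A hA => by
      simp only [List.mem_cons, List.not_mem_nil, or_false, not_or] at hA
      rw [det_nat_of_notMem _ (by rw [writesN_assign]; simp [trialList, hA]),
        det_nat_of_notMem _ (by simp [powLoop, writesN, hA])]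
  have k24 : ((assign trialList).det (powLoop.det σ₁)).nat 24 0 = I.Z := by
    rw [det_nat_of_notMem _ (by rw [writesN_assign]; decide), hpow]
  set τ := (assign trialList).det (powLoop.det σ₁)
  clear_value τ σ₁
  simp only [trialList, List.mem_cons, List.not_mem_nil, or_false, forall_eq_or_imp, forall_eq,
    NExpr.eval, NExpr.eval_var, k24, hn 9 (by simp), e9] at heq
  obtain ⟨g10, g25⟩ := heq
  refine ⟨⟨?_, ?_, ?_, ?_, ?_, ?_, ?_, ?_, g10, ?_, ?_, ?_, ?_, ?_, ?_, ?_, ?_⟩, ?_, ?_, ?_⟩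
  iterate 13 rw [hn _ (by simp)]; assumption
  · rw [hf, h.f0]
  · rw [hf, h.f1]
  · rw [hf, h.f2]
  · rw [hn1, h1]
  · rw [hn _ (by simp), e20]
  · rw [g25, g10]

/-- The bound for the loop that computes a power. -/
theorem powLoop_bound {σ : State F} {M : ℕ} (hσ : σ.Bdd M)
    (hM : σ.nat 24 0 * σ.nat 19 0 ^ σ.nat 9 0 + 2 ≤ M) (h19 : 0 < σ.nat 19 0) :
    ∀ σ' ∈ (powLoop.run σ).support, σ'.Bdd M ∧ σ'.time + 1 ≤ σ.time + M ^ 20 := by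
  have h3 := hσ.1
  rw [run_eq_pure _ rfl]
  simp only [PMF.support_pure, Set.mem_singleton_iff, forall_eq]
  have hval : ∀ ρ : State F, (NExpr.mul (.var 24) (.var 19)).eval ρ = ρ.nat 24 0 * ρ.nat 19 0 :=
    fun ρ => rfl
  have key : ∀ k ≤ σ.nat 9 0, ∀ ρ : State F, ρ = ((fun σ' => (letN 24 (.mul (.var 24)
      (.var 19))).det (σ'.tick 1))^[k] (σ.tick ((NExpr.var 9).cost σ + 1))) →
      ρ.Bdd M ∧ ρ.nat 19 0 = σ.nat 19 0 ∧ ρ.nat 24 0 = σ.nat 24 0 * σ.nat 19 0 ^ k ∧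
      ρ.time ≤ σ.time + ((NExpr.var 9).cost σ + 1) + k * M ^ 16 := by
    intro k
    induction k with
    | zero => rintro - _ rfl; exact ⟨hσ, rfl, by simp, by simp⟩
    | succ k ih =>
      rintro hk _ rfl
      rw [Function.iterate_succ_apply']
      obtain ⟨i1, i2, i3, i4⟩ := ih (by omega) _ rfl
      set ρ := ((fun σ' => (letN 24 (.mul (.var 24)
        (.var 19))).det (σ'.tick 1))^[k] (σ.tick ((NExpr.var 9).cost σ + 1)))
      -- The loop is not tame. Its partial products are bounded by the final one, as the base is
      -- positive.
      have hv : ρ.nat 24 0 * ρ.nat 19 0 + 2 ≤ M := by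
        rw [i2, i3, mul_assoc, ← pow_succ]
        exact le_trans (Nat.add_le_add_right
          (Nat.mul_le_mul_left _ (Nat.pow_le_pow_right h19 hk)) 2) hM
      have i1' : (ρ.tick 1).Bdd M := i1
      have hcost := (NExpr.eval_lt_pow i1' (.mul (.var 24) (.var 19)) rfl).2
      refine ⟨Bdd.writeN i1 _ hv, ?_, ?_, ?_⟩
      · simp [i2]
      · simp only [det_letN_nat, Function.update_self, hval, State.tick_nat, i2, i3]
        ring
      · have hs := natSize_le_self (ρ.nat 24 0 * ρ.nat 19 0)
        have h8 : M ≤ M ^ 8 := Nat.le_self_pow (by norm_num) M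
        have h16 : M ^ 8 * 81 ≤ M ^ 16 := by
          rw [show 16 = 8 + 8 by rfl, pow_add]
          exact Nat.mul_le_mul_left _ (le_trans (by norm_num) (Nat.pow_le_pow_left h3 8))
        simp only [letN, det, State.tick_time, State.writeN_time, NExpr.eval, hval, NExpr.eval_var,
          State.tick_nat]
        rw [show (NExpr.mul (.var 24) (.var 19)).wt = 8 from rfl] at hcost
        rw [show (NExpr.const 0).cost (ρ.tick 1) = 1 from rfl, Nat.size_zero, add_one_mul]
        omega
  obtain ⟨k1, k2, k3, k4⟩ := key _ le_rfl _ rfl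
  refine ⟨k1, ?_⟩
  have hle : σ.nat 9 0 + 2 ≤ M := hσ.2 9 0 (by norm_num)
  have hcost := (NExpr.eval_lt_pow hσ (.var 9) rfl).2
  rw [show (NExpr.var 9).wt = 3 from rfl] at hcost
  have e1 : σ.nat 9 0 * M ^ 16 ≤ M ^ 17 := by
    rw [pow_succ' M 16]
    exact Nat.mul_le_mul_right _ (by omega)
  have e2 : M ^ 3 ≤ M ^ 17 := Nat.pow_le_pow_right (by omega) (by norm_num)
  have e3 : M ^ 17 * 27 ≤ M ^ 20 := by
    rw [show 20 = 17 + 3 by rfl, pow_add]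
    exact Nat.mul_le_mul_left _ (le_trans (by norm_num) (Nat.pow_le_pow_left h3 3))
  have e4 : M ≤ M ^ 17 := Nat.le_self_pow (by norm_num) M
  show ((fun σ' => (letN 24 (.mul (.var 24) (.var 19))).det (σ'.tick 1))^[σ.nat 9 0]
    (σ.tick ((NExpr.var 9).cost σ + 1))).time + 1 ≤ _
  omega

end Prog

end FoldedRS
end

noncomputable section

namespace FoldedRS

universe u

set_option linter.unusedSectionVars false
set_option linter.unusedSimpArgs false

open Polynomial Module

/-! ### The success probability of independent trials -/

/-- The number of outcomes of `N` trials that all fail. -/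
theorem card_all_fail_le {N t : ℕ} {α : Type*} [Fintype α] [DecidableEq α]
    (G : Finset (Fin t → α)) :
    (Finset.univ.filter fun ω : Fin (N * t) → α =>
      ∀ k : Fin N, (fun v => ω (finProdFinEquiv (k, v))) ∉ G).card ≤ Gᶜ.card ^ N := by
  have hpi : (Fintype.piFinset fun _ : Fin N => Gᶜ).card = Gᶜ.card ^ N := by simp
  rw [← hpi]
  refine Finset.card_le_card_of_injOn (fun ω k v => ω (finProdFinEquiv (k, v))) ?_ ?_
  · intro ω hω
    simpa using hω
  · intro ω _ ω' _ h
    funext i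
    obtain ⟨p, rfl⟩ := finProdFinEquiv.surjective i
    exact congrFun (congrFun h p.1) p.2

/-- The source of the number `Z (Z + 5)` of trials: one factor `exp (-Z)` pays for the union bound
over `Z` targets, and `exp (-5)` for the failure probability. -/
theorem mul_exp_neg_le (Z : ℝ) : Z * Real.exp (-(Z + 5)) ≤ 1 / 100 := by
  have h1 : Z ≤ Real.exp Z := by linarith [Real.add_one_le_exp Z]
  have h2 : Real.exp (-(Z + 5)) = Real.exp (-Z) * Real.exp (-5) := by
    rw [← Real.exp_add]; ring_nf
  have h3 : Z * Real.exp (-Z) ≤ 1 := by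
    calc Z * Real.exp (-Z) ≤ Real.exp Z * Real.exp (-Z) :=
          mul_le_mul_of_nonneg_right h1 (Real.exp_pos _).le
      _ = 1 := by rw [← Real.exp_add, add_neg_cancel, Real.exp_zero]
  have h4 : Real.exp (-5) ≤ 1 / 100 := by
    rw [Real.exp_neg, inv_eq_one_div]
    refine one_div_le_one_div_of_le (by norm_num) ?_
    have h5 : Real.exp 5 = Real.exp 1 ^ 5 := by rw [← Real.exp_nat_mul]; norm_num
    rw [h5]
    calc (100 : ℝ) ≤ 2.7 ^ 5 := by norm_num
      _ ≤ _ := pow_le_pow_left₀ (by norm_num) (by linarith [Real.exp_one_gt_d9]) 5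
  rw [h2, ← mul_assoc]
  calc Z * Real.exp (-Z) * Real.exp (-5) ≤ 1 * Real.exp (-5) :=
        mul_le_mul_of_nonneg_right h3 (Real.exp_pos _).le
    _ ≤ _ := by linarith

/-- Among at most `Z` targets, each of which is met by a trial with probability at least `1 / Z`,
some target is missed by `Z (Z + 5)` trials with probability at most `1 / 100`. -/
theorem card_fail_le {ι α : Type*} [Fintype α] [DecidableEq α] {t Z : ℕ} (Λ : Finset ι)
    (hΛ : Λ.card ≤ Z) (G : ι → Finset (Fin t → α))
    (hG : ∀ P ∈ Λ, Fintype.card α ^ t ≤ Z * (G P).card) :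
    100 * (Finset.univ.filter fun ω : Fin (Z * (Z + 5) * t) → α => ∃ P ∈ Λ,
      ∀ k : Fin (Z * (Z + 5)), (fun v => ω (finProdFinEquiv (k, v))) ∉ G P).card ≤
      Fintype.card α ^ (Z * (Z + 5) * t) := by
  classical
  set N := Z * (Z + 5) with hN
  set X := Fintype.card α ^ t with hX
  have h1 : (Finset.univ.filter fun ω : Fin (N * t) → α => ∃ P ∈ Λ,
      ∀ k : Fin N, (fun v => ω (finProdFinEquiv (k, v))) ∉ G P).card ≤
      ∑ P ∈ Λ, (G P)ᶜ.card ^ N := by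
    have : (Finset.univ.filter fun ω : Fin (N * t) → α => ∃ P ∈ Λ,
        ∀ k : Fin N, (fun v => ω (finProdFinEquiv (k, v))) ∉ G P) ⊆ Λ.biUnion fun P =>
        Finset.univ.filter fun ω : Fin (N * t) → α =>
          ∀ k : Fin N, (fun v => ω (finProdFinEquiv (k, v))) ∉ G P := by
      intro ω hω
      simpa using hω
    exact (Finset.card_le_card this).trans (Finset.card_biUnion_le.trans
      (Finset.sum_le_sum fun P _ => card_all_fail_le _))
  -- A trial misses `P` with probability at most `1 - 1 / Z ≤ exp (-1 / Z)`, and the `Z (Z + 5)`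
  -- trials are independent.
  have h2 : ∀ P ∈ Λ, ((G P)ᶜ.card : ℝ) ^ N ≤ X ^ N * Real.exp (-(Z + 5 : ℝ)) := by
    intro P hP
    rcases Nat.eq_zero_or_pos Z with h0 | h0
    · have := Finset.card_pos.2 ⟨P, hP⟩
      omega
    have h0' : (0 : ℝ) < Z := by exact_mod_cast h0
    have hc : ((G P)ᶜ.card : ℝ) = X - (G P).card := by
      have := Finset.card_compl_add_card (G P)
      rw [Fintype.card_fun, Fintype.card_fin, ← hX] at this
      rw [← this]
      push_cast
      ring
    have hg : (X : ℝ) / Z ≤ (G P).card := by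
      rw [div_le_iff₀ h0']
      have := hG P hP
      rw [mul_comm]
      exact_mod_cast this
    have hle : ((G P)ᶜ.card : ℝ) ≤ X * Real.exp (-(1 / Z)) := by
      calc ((G P)ᶜ.card : ℝ) ≤ X * (1 - 1 / Z) := by rw [hc]; ring_nf at hg ⊢; linarith
        _ ≤ _ := mul_le_mul_of_nonneg_left (Real.one_sub_le_exp_neg _) (Nat.cast_nonneg _)
    calc ((G P)ᶜ.card : ℝ) ^ N ≤ (X * Real.exp (-(1 / Z))) ^ N :=
          pow_le_pow_left₀ (Nat.cast_nonneg _) hle _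
      _ = _ := by
        rw [mul_pow, ← Real.exp_nat_mul, hN]
        congr 2
        push_cast
        field_simp
  have h3 : ((100 * (Finset.univ.filter fun ω : Fin (N * t) → α => ∃ P ∈ Λ,
      ∀ k : Fin N, (fun v => ω (finProdFinEquiv (k, v))) ∉ G P).card : ℕ) : ℝ) ≤ (X : ℝ) ^ N := by
    calc ((100 * (Finset.univ.filter fun ω : Fin (N * t) → α => ∃ P ∈ Λ,
          ∀ k : Fin N, (fun v => ω (finProdFinEquiv (k, v))) ∉ G P).card : ℕ) : ℝ)
        ≤ ((100 * ∑ P ∈ Λ, (G P)ᶜ.card ^ N : ℕ) : ℝ) := by exact_mod_cast Nat.mul_le_mul_left _ h1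
      _ = 100 * ∑ P ∈ Λ, ((G P)ᶜ.card : ℝ) ^ N := by push_cast; rfl
      _ ≤ 100 * (Λ.card * (X ^ N * Real.exp (-(Z + 5 : ℝ)))) := by
        refine mul_le_mul_of_nonneg_left ?_ (by norm_num)
        rw [← nsmul_eq_mul]
        exact Finset.sum_le_card_nsmul _ _ _ h2
      _ ≤ 100 * (Z * (X ^ N * Real.exp (-(Z + 5 : ℝ)))) := by
        have : (Λ.card : ℝ) ≤ Z := by exact_mod_cast hΛ
        gcongr
      _ = 100 * X ^ N * (Z * Real.exp (-(Z + 5 : ℝ))) := by ring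
      _ ≤ 100 * X ^ N * (1 / 100) :=
        mul_le_mul_of_nonneg_left (mul_exp_neg_le _) (by positivity)
      _ = _ := by ring
  have h4 : Fintype.card α ^ (N * t) = X ^ N := by rw [mul_comm N t, pow_mul]
  rw [h4]
  exact_mod_cast h3

variable {F : Type u} [Field F] {I : Inst F}

namespace Inst

theorem Valid.total_le (h : I.Valid) : (I.n * I.l) ^ I.t ≤ I.h ^ I.t * (I.n - I.e) ^ I.t := by
  rw [← mul_pow]
  refine Nat.pow_le_pow_left ?_ _
  have := h.e_lt
  exact ((Nat.div_lt_iff_lt_mul (by omega)).1 (Nat.lt_succ_self (I.n * I.l / (I.n - I.e)))).le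

/-- The counting bound `2 (n ℓ / (n - e)) ^ t` again, with the ratio rounded up to `h`. So `Z` also
bounds the number of targets in the union bound. -/
theorem Valid.card_le_Z (h : I.Valid) (Λ : Finset F[X]) (hΛ : ∀ P ∈ Λ, I.InList P) :
    Λ.card ≤ I.Z := by
  have h1 := h.card_mul_pow_le Λ hΛ
  have h2 := h.total_le
  have h3 := h.e_lt
  refine Nat.le_of_mul_le_mul_right
    (?_ : Λ.card * (I.n - I.e) ^ I.t ≤ I.Z * (I.n - I.e) ^ I.t)
    (pow_pos (Nat.sub_pos_of_lt h3) _)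
  calc _ ≤ 2 * (I.n * I.l) ^ I.t := h1
    _ ≤ 2 * (I.h ^ I.t * (I.n - I.e) ^ I.t) := Nat.mul_le_mul_left 2 h2
    _ = _ := by rw [Z, mul_assoc]

theorem Valid.finite_inList (h : I.Valid) : {P : F[X] | I.InList P}.Finite := by
  by_contra hinf
  obtain ⟨Λ, hΛ, hcard⟩ := (Set.not_finite.1 hinf).exists_subset_card_eq (I.Z + 1)
  have := h.card_le_Z Λ fun P hP => hΛ hP
  omega

end Inst

namespace Prog

/-- A version of `run_fill_tape` for given values of the bounds. -/
theorem run_fill_tape_of_eq (T v x y : ℕ) (hTv : T ≠ v) (hTx : T ≠ x) (hTy : T ≠ y) (hvx : v ≠ x)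
    (hvy : v ≠ y) (σ : State F) {A B : ℕ} [Nonempty (Fin A → Fin B)] (hA : σ.nat x 0 = A)
    (hB : σ.nat y 0 + 1 = B) :
    ∃ f : (Fin A → Fin B) → State F,
      (for' v x (rand T (.var v) (.var y))).run σ = (PMF.uniformOfFintype _).map f ∧
      ∀ ω, (f ω).fld = σ.fld ∧ (∀ A, A ≠ v → A ≠ T → (f ω).nat A = σ.nat A) ∧
        ∀ i : Fin _, (f ω).nat T i = ω i := by
  subst hA hB
  exact run_fill_tape T v x y hTv hTx hTy hvx hvy σ

/-- Choose the guesses of all trials. -/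
def drawGuesses : Prog := for' 26 25 (rand 40 (.var 26) (.var 20))

/-- The list recovery algorithm. -/
def recover : Prog := seq params (seq interpolate (seq drawGuesses trials))

theorem noRand_interpolate : interpolate.noRand = true := rfl

theorem noRand_trials : trials.noRand = true := rfl

/-- Only `drawGuesses` is random. The interpolation polynomial is computed before it, so the notion
of a good tuple is fixed independently of the tape `ω`. -/
theorem recover_run (hV : I.Valid) {σ : State F} (h : HasInput I σ) (h1 : σ.nat 1 0 = 0) :
    ∃ f : (Fin (I.Z * (I.Z + 5) * I.t) → Fin (I.n * I.l)) → State F,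
      ∃ _ : Nonempty (Fin (I.Z * (I.Z + 5) * I.t) → Fin (I.n * I.l)),
      ∃ A : ℕ → F[X], I.IsInterp A ∧ recover.run σ = (PMF.uniformOfFintype _).map f ∧ ∀ ω,
        (∀ j < (f ω).nat 1 0, I.InList (I.out (f ω) j)) ∧
        Set.InjOn (I.out (f ω)) (Set.Iio ((f ω).nat 1 0)) ∧
        ∀ P, I.InList P → ∀ k : Fin (I.Z * (I.Z + 5)),
          I.Good A P (fun v => ω (finProdFinEquiv (k, v))) →
          ∃ j < (f ω).nat 1 0, I.out (f ω) j = P := by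
  obtain ⟨l₁, p1, p20, p25⟩ := params_spec h h1
  set σ₁ := params.det σ with hσ₁
  obtain ⟨q, hA, hq⟩ := interpolate_spec l₁
  set σ₂ := interpolate.det σ₁ with hσ₂
  have l₂ : Loaded I σ₂ := l₁.det _ (by simp) (by simp)
  have hpos : 0 < I.n * I.l := Nat.mul_pos hV.n_pos hV.l_pos
  have : NeZero (I.n * I.l) := ⟨hpos.ne'⟩
  have e1 : σ₂.nat 1 0 = 0 := by rw [hσ₂, det_nat_of_notMem _ (by simp), p1]
  have e20 : σ₂.nat 20 0 + 1 = I.n * I.l := by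
    rw [hσ₂, det_nat_of_notMem _ (by simp), p20]; omega
  have e25 : σ₂.nat 25 0 = I.Z * (I.Z + 5) * I.t := by
    rw [hσ₂, det_nat_of_notMem _ (by simp), p25]
  obtain ⟨f, hf, hω⟩ := run_fill_tape_of_eq 40 26 25 20 (by norm_num) (by norm_num) (by norm_num)
    (by norm_num) (by norm_num) σ₂ e25 e20
  refine ⟨fun ω => trials.det (f ω), inferInstance, I.interpPoly q, hA, ?_, fun ω => ?_⟩
  · rw [recover, run, run_eq_pure _ noRand_params, PMF.pure_bind, run,
      run_eq_pure _ noRand_interpolate, PMF.pure_bind, run, drawGuesses, hf, PMF.bind_map]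
    simp only [Function.comp_def, run_eq_pure _ noRand_trials]
    exact PMF.bind_pure_comp (fun ω => trials.det (f ω)) _
  · obtain ⟨hfld, hn, htape⟩ := hω ω
    have l₃ : Loaded I (f ω) := l₂.of_eq (fun A h2 h15 => hn A (by omega) (by omega))
      fun A _ => by rw [hfld]
    obtain ⟨t1, t2, t3⟩ := trials_spec hV l₃ hA (HasInterp.of_eq hq (by rw [hfld]))
      (by rw [hn 1 (by norm_num) (by norm_num), e1])
    refine ⟨t1, t2, fun P hP k hgood => t3 P hP k k.2 _ hgood fun v => ?_⟩
    rw [Inst.guess, ← htape]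
    simp only [finProdFinEquiv_apply_val]
    rw [mul_comm, add_comm]

/-- The output list has no repetitions and consists of polynomials of the list that is to be
found. -/
theorem recover_sound (hV : I.Valid) {σ : State F} (h : HasInput I σ) (h1 : σ.nat 1 0 = 0) :
    ∀ σ' ∈ (recover.run σ).support, (∀ j < σ'.nat 1 0, I.InList (I.out σ' j)) ∧
      Set.InjOn (I.out σ') (Set.Iio (σ'.nat 1 0)) := by
  obtain ⟨f, _, A, -, hrun, hf⟩ := recover_run hV h h1
  intro σ' hσ'
  rw [hrun, PMF.support_map] at hσ'
  obtain ⟨ω, -, rfl⟩ := hσ'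
  exact ⟨(hf ω).1, (hf ω).2.1⟩

/-- With high probability, the output list is complete. -/
theorem recover_complete (hV : I.Valid) {σ : State F} (h : HasInput I σ) (h1 : σ.nat 1 0 = 0) :
    (99 / 100 : ENNReal) ≤ (recover.run σ).toOuterMeasure
      {σ' | ∀ P, I.InList P → ∃ j < σ'.nat 1 0, I.out σ' j = P} := by
  classical
  obtain ⟨f, hne, A, hA, hrun, hf⟩ := recover_run hV h h1
  set Λ := hV.finite_inList.toFinset with hΛ
  have hmem : ∀ P, P ∈ Λ ↔ I.InList P := fun P => by simp [hΛ]
  have hfail := card_fail_le (α := Fin (I.n * I.l)) (t := I.t) (Z := I.Z) Λ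
    (hV.card_le_Z Λ fun P hP => (hmem P).1 hP)
    (fun P => Finset.univ.filter fun u => I.Good A P u) (by
      intro P hP
      have h2 := hA.pow_le_card_good hV ((hmem P).1 hP)
      have h3 := hV.total_le
      rw [Fintype.card_fin]
      refine h3.trans ((Nat.mul_le_mul_left (I.h ^ I.t) h2).trans (le_of_eq ?_))
      rw [Inst.Z, ← mul_assoc, mul_comm (I.h ^ I.t) 2])
  set bad := Finset.univ.filter fun ω : Fin (I.Z * (I.Z + 5) * I.t) → Fin (I.n * I.l) => ∃ P ∈ Λ,
    ∀ k : Fin (I.Z * (I.Z + 5)), (fun v => ω (finProdFinEquiv (k, v))) ∉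
      Finset.univ.filter fun u => I.Good A P u with hbad
  rw [hrun, PMF.toOuterMeasure_map_apply]
  have hsub : ((badᶜ : Finset _) : Set (Fin (I.Z * (I.Z + 5) * I.t) → Fin (I.n * I.l))) ⊆
      f ⁻¹' {σ' | ∀ P, I.InList P → ∃ j < σ'.nat 1 0, I.out σ' j = P} := by
    intro ω hω P hP
    simp only [hbad, Finset.coe_compl, Set.mem_compl_iff, Finset.mem_coe, Finset.mem_filter,
      Finset.mem_univ, true_and, not_exists, not_and, not_forall, not_not] at hω
    obtain ⟨k, hk⟩ := hω P ((hmem P).2 hP)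
    exact (hf ω).2.2 P hP k hk
  refine le_trans ?_ (MeasureTheory.measure_mono hsub)
  rw [PMF.toOuterMeasure_uniformOfFintype_apply]
  have hcard : bad.card + badᶜ.card = Fintype.card (Fin (I.Z * (I.Z + 5) * I.t) → Fin (I.n * I.l)) :=
    Finset.card_add_card_compl bad
  have htot : 0 < Fintype.card (Fin (I.Z * (I.Z + 5) * I.t) → Fin (I.n * I.l)) := Fintype.card_pos
  have hfail' : 100 * bad.card ≤ Fintype.card (Fin (I.Z * (I.Z + 5) * I.t) → Fin (I.n * I.l)) := by
    rw [Fintype.card_fun, Fintype.card_fin (I.Z * (I.Z + 5) * I.t)]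
    exact hfail
  rw [ENNReal.le_div_iff_mul_le (Or.inl (by exact_mod_cast htot.ne')) (Or.inl (ENNReal.natCast_ne_top _)), mul_comm,
    ← mul_div_assoc, ENNReal.div_le_iff (by norm_num) (by norm_num)]
  simp only [SetLike.coe_sort_coe, Fintype.card_coe]
  exact_mod_cast (by omega : Fintype.card (Fin (I.Z * (I.Z + 5) * I.t) → Fin (I.n * I.l)) * 99 ≤
    badᶜ.card * 100)

end Prog

end FoldedRS
end

/-! ### Running time of the algorithm -/

noncomputable section

namespace FoldedRS

universe u

set_option linter.unusedSectionVars false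
set_option linter.unusedSimpArgs false

open Polynomial Module

variable {F : Type u} [Field F] {I : Inst F}

namespace Prog

/-- The degree of the bound for the first part of the computation of the parameters. -/
def smallWt : ℕ :=
  (assignWt paramList + 1) * (((for' 23 18 halve).wt + 1) * (assignWt guessList + 1) * 2 + 1) * 2

/-- The degree of the bound for the part of the algorithm that follows the computation of the power. -/
def largeWt : ℕ :=
  (assignWt trialList + 1) * ((seq interpolate (seq drawGuesses trials)).wt + 1) * 2

/-- The degree of the bound for the running time. -/
def recoverWt : ℕ := (smallWt + 1) * (largeWt + 21)

theorem polyBounded_smallParams : PolyBounded F smallParams smallWt :=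
  (polyBounded_assign rfl).seq ((polyBounded_of_tame rfl).seq (polyBounded_assign rfl))

theorem polyBounded_large :
    PolyBounded F (seq (assign trialList) (seq interpolate (seq drawGuesses trials))) largeWt :=
  (polyBounded_assign rfl).seq (polyBounded_of_tame rfl)

theorem noRand_smallParams : smallParams.noRand = true := by
  simp [noRand, smallParams, noRand_assign, letN, for', halve, incr]

theorem mem_support_recover {σ σ' : State F} (h : σ' ∈ (recover.run σ).support) :
    ∃ τ ∈ (powLoop.run (smallParams.det σ)).support,
      σ' ∈ ((seq (assign trialList) (seq interpolate (seq drawGuesses trials))).run τ).support := by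
  simp only [recover, params, run, run_eq_pure _ noRand_smallParams, PMF.pure_bind, PMF.bind_bind,
    PMF.mem_support_bind_iff] at h ⊢
  obtain ⟨τ, hτ, ρ, hρ, h⟩ := h
  exact ⟨τ, hτ, ρ, hρ, h⟩

/-- The cut is at the power loop. The parameters before it are bounded by a power of `M`; the loop
itself is controlled through `hZ`, since its result is `Z`; what follows is a few assignments and a
tame program. -/
theorem recover_time {σ : State F} (h : HasInput I σ) (h0 : σ.time = 0) {M : ℕ}
    (hM : σ.Bdd M) (hF : fieldOpCost F + 1 ≤ M) (hZ : I.Z + 2 ≤ M) :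
    ∀ σ' ∈ (recover.run σ).support, σ'.time ≤ M ^ recoverWt := by
  intro σ' hσ'
  obtain ⟨τ, hτ, hσ'⟩ := mem_support_recover hσ'
  obtain ⟨-, -, -, -, -, -, -, e9, -, -, -, -, -, e19, -, e24⟩ := smallParams_spec h rfl
  obtain ⟨a1, a2⟩ := polyBounded_smallParams σ M hM hF (smallParams.det σ) (by
    rw [run_eq_pure _ noRand_smallParams]; simp)
  set σ₁ := smallParams.det σ
  have h3 := hM.1
  have hle : M ≤ M ^ (smallWt + 1) := Nat.le_self_pow (by omega) M
  have hle' : M ^ smallWt ≤ M ^ (smallWt + 1) := Nat.pow_le_pow_right (by omega) (by omega)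
  set M₁ := M ^ (smallWt + 1) with hM₁
  obtain ⟨b1, b2⟩ := powLoop_bound (σ := σ₁) (M := M₁) (a1.mono hle') (by
    rw [e9, e19, e24, ← Inst.Z]; omega) (by rw [e19]; exact Nat.succ_pos _) τ hτ
  obtain ⟨-, c2⟩ := polyBounded_large τ M₁ b1 (hF.trans hle) σ' hσ'
  rw [recoverWt, pow_mul, ← hM₁]
  have k1 : M₁ ^ 20 ≤ M₁ ^ (largeWt + 20) := Nat.pow_le_pow_right (by omega) (by omega)
  have k2 : M₁ ^ largeWt ≤ M₁ ^ (largeWt + 20) := Nat.pow_le_pow_right (by omega) (by omega)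
  have k3 : M₁ ≤ M₁ ^ (largeWt + 20) := Nat.le_self_pow (by omega) _
  have k4 : M₁ ^ (largeWt + 20) * 3 ≤ M₁ ^ (largeWt + 21) := by
    rw [show largeWt + 21 = largeWt + 20 + 1 by rfl, pow_succ _ (largeWt + 20)]
    exact Nat.mul_le_mul_left _ (by omega)
  omega

end Prog

end FoldedRS
end

noncomputable section

namespace FoldedRS

universe u

set_option linter.unusedSectionVars false
set_option linter.unusedSimpArgs false

open Polynomial Module

variable {F : Type u} [Field F]

/-! ### The instance given by an input -/

/-- The instance that is described by an input. -/
def instOf (γ : F) (s d ℓ e : ℕ) {n : ℕ} (a : Fin n → F) (y : Fin n → Fin ℓ → Fin s → F) :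
    Inst F where
  g := γ
  a := (inputState γ s d ℓ e a y).fld 1
  y := (inputState γ s d ℓ e a y).fld 2
  s := s
  d := d
  n := n
  l := ℓ
  e := e

variable {γ : F} {s d ℓ e n : ℕ} {a : Fin n → F} {y : Fin n → Fin ℓ → Fin s → F}

theorem hasInput_inputState :
    Prog.HasInput (instOf γ s d ℓ e a y) (inputState γ s d ℓ e a y) where
  n1 := rfl
  n2 := rfl
  n3 := rfl
  n4 := rfl
  n5 := rfl
  f0 := rfl
  f1 := rfl
  f2 := rfl

theorem instOf_a (i : Fin n) : (instOf γ s d ℓ e a y).a i = a i := by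
  simp [instOf, inputState]

theorem instOf_y (i : Fin n) (j : Fin ℓ) (k : Fin s) :
    (instOf γ s d ℓ e a y).y ((i * ℓ + j) * s + k) = y i j k := by
  have h1 : (i : ℕ) * ℓ + j < n * ℓ := by
    calc (i : ℕ) * ℓ + j < i * ℓ + ℓ := Nat.add_lt_add_left j.2 _
      _ = (i + 1) * ℓ := by ring
      _ ≤ n * ℓ := Nat.mul_le_mul_right _ i.2
  have h2 : ((i : ℕ) * ℓ + j) * s + k < n * ℓ * s := by
    calc ((i : ℕ) * ℓ + j) * s + k < (i * ℓ + j) * s + s := Nat.add_lt_add_left k.2 _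
      _ = (i * ℓ + j + 1) * s := by ring
      _ ≤ n * ℓ * s := Nat.mul_le_mul_right _ h1
  have hs : 0 < s := k.pos
  have hl : 0 < ℓ := j.pos
  have e1 : (((i : ℕ) * ℓ + j) * s + k) / s = i * ℓ + j := by
    rw [mul_comm, Nat.mul_add_div hs, Nat.div_eq_of_lt k.2, add_zero]
  have e2 : (((i : ℕ) * ℓ + j) * s + k) % s = k := by
    rw [mul_comm, Nat.mul_add_mod, Nat.mod_eq_of_lt k.2]
  have e3 : ((i : ℕ) * ℓ + j) / ℓ = i := by
    rw [mul_comm, Nat.mul_add_div hl, Nat.div_eq_of_lt j.2, add_zero]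
  have e4 : ((i : ℕ) * ℓ + j) % ℓ = j := by
    rw [mul_comm, Nat.mul_add_mod, Nat.mod_eq_of_lt j.2]
  simp only [instOf, inputState, h2, dif_pos, if_neg, OfNat.ofNat_ne_zero, OfNat.ofNat_ne_one,
    if_false, if_true]
  refine congr (congr (congrArg y (Fin.ext ?_)) (Fin.ext ?_)) (Fin.ext ?_)
  · simp [Fin.divNat, e1, e3]
  · simp only [Fin.divNat, Fin.modNat, e1, e4]
  · simp [Fin.modNat, e2]

theorem agree_instOf (P : F[X]) (i : Fin n) (j : Fin ℓ) :
    (instOf γ s d ℓ e a y).Agree P (i * ℓ + j) ↔ frsEnc γ s a P i = y i j := by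
  have hl : 0 < ℓ := j.pos
  have e3 : ((i : ℕ) * ℓ + j) / ℓ = i := by
    rw [mul_comm, Nat.mul_add_div hl, Nat.div_eq_of_lt j.2, add_zero]
  rw [funext_iff]
  change (∀ k < s, P.eval (γ ^ k * (instOf γ s d ℓ e a y).a (((i : ℕ) * ℓ + j) / ℓ)) =
    (instOf γ s d ℓ e a y).y ((i * ℓ + j) * s + k)) ↔ _
  rw [e3, instOf_a, Fin.forall_iff]
  refine forall₂_congr fun k hk => ?_
  rw [instOf_y i j ⟨k, hk⟩]
  rfl

theorem hit_instOf (P : F[X]) (i : Fin n) :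
    (instOf γ s d ℓ e a y).Hit P i ↔ ∃ j, frsEnc γ s a P i = y i j := by
  simp only [← agree_instOf (d := d) (e := e), Fin.exists_iff, exists_prop]
  rfl

theorem miss_instOf (P : F[X]) :
    (instOf γ s d ℓ e a y).miss P = Set.ncard {i : Fin n | ¬∃ j, frsEnc γ s a P i = y i j} := by
  classical
  rw [Set.ncard_eq_toFinset_card', Inst.miss]
  symm
  refine Finset.card_bij (fun i _ => (i : ℕ)) ?_ ?_ ?_
  · intro i hi
    simp only [Set.mem_toFinset, Set.mem_ofPred_eq] at hi
    exact Finset.mem_filter.2 ⟨Finset.mem_range.2 i.2, by rwa [hit_instOf]⟩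
  · intro i _ j _ h
    exact Fin.ext h
  · intro i hi
    obtain ⟨hi, hi'⟩ := Finset.mem_filter.1 hi
    refine ⟨⟨i, Finset.mem_range.1 hi⟩, ?_, rfl⟩
    rw [Set.mem_toFinset, Set.mem_ofPred_eq, ← hit_instOf (d := d) (e := e)]
    exact hi'

section

variable {S : Fin n → Finset (Fin s → F)} (y : (i : Fin n) → Fin ℓ ≃ {z // z ∈ S i}) {α : ℝ}

/-- The polynomials of the list are the ones whose encodings are close to the lists. -/
theorem inList_instOf (hn : 0 < n) (hα : 0 ≤ α) (P : F[X]) :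
    (instOf γ s d ℓ ⌊α * n⌋₊ a fun i j => (y i j : Fin s → F)).InList P ↔
      P.natDegree ≤ d ∧ distToLists (frsEnc γ s a P) S ≤ α := by
  have hn' : (0 : ℝ) < n := by exact_mod_cast hn
  have h : ∀ i, (∃ j, frsEnc γ s a P i = y i j) ↔ frsEnc γ s a P i ∈ S i := fun i => by
    constructor
    · rintro ⟨j, hj⟩
      rw [hj]
      exact (y i j).2
    · intro hmem
      exact ⟨(y i).symm ⟨_, hmem⟩, by simp⟩
  rw [Inst.InList, miss_instOf, distToLists, div_le_iff₀ hn']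
  simp only [h]
  refine and_congr Iff.rfl ?_
  exact Nat.le_floor_iff (by positivity)

end

/-- From `e ≤ α n`, multiplication by `s` gives `E ≥ ε s n`, and squaring this turns `16 ℓ ≤ s ε ^
2` into `le_sq`. The evaluation points are powers of `γ` with exponents `j + s k < q - 1`;
primitivity recovers the exponent, and division by `s` recovers `j` and `k`. -/
theorem valid_instOf {ε : ℝ} (hn : 0 < n) (hnq : n ≤ (Nat.card F - 1) / s) (hl : 0 < ℓ) (hε : 0 < ε)
    (hs : 16 * (ℓ : ℝ) / ε ^ 2 ≤ s) (hγ : IsPrimitiveElement γ) (ha : IsFoldedDomain γ s a)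
    (hα : 0 ≤ 1 - (d : ℝ) / (s * n) - ε)
    (y : Fin n → Fin ℓ → Fin s → F) :
    (instOf γ s d ℓ ⌊(1 - (d : ℝ) / (s * n) - ε) * n⌋₊ a y).Valid ∧
      ε * (s * n) ≤ (instOf γ s d ℓ ⌊(1 - (d : ℝ) / (s * n) - ε) * n⌋₊ a y).E := by
  set e := ⌊(1 - (d : ℝ) / (s * n) - ε) * n⌋₊ with he
  have hs0 : 0 < s := by
    -- For `s = 0` the quotient `(q - 1) / s` is `0` by convention, against `0 < n`.
    rcases Nat.eq_zero_or_pos s with rfl | h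
    · simp at hnq
      omega
    · exact h
  have hs' : (0 : ℝ) < s := by exact_mod_cast hs0
  have hn' : (0 : ℝ) < n := by exact_mod_cast hn
  have hsn : s * n ≤ Nat.card F - 1 := by
    rw [mul_comm]
    exact (Nat.le_div_iff_mul_le hs0).1 hnq
  have hfl : (e : ℝ) ≤ (1 - (d : ℝ) / (s * n) - ε) * n := Nat.floor_le (by positivity)
  have hsum : ε * (s * n) + d + s * e ≤ s * n := by
    have h1 := mul_le_mul_of_nonneg_left hfl hs'.le
    have h2 : (s : ℝ) * ((1 - (d : ℝ) / (s * n) - ε) * n) = s * n - d - ε * (s * n) := by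
      field_simp
    linarith
  have hpos : 0 < ε * (s * n) := by positivity
  have hlt : d + s * e < s * n := by
    have : (d : ℝ) + s * e < s * n := by linarith
    exact_mod_cast this
  have hE : ε * (s * n) ≤ (s * n - d - s * e : ℕ) := by
    rw [Nat.sub_sub, Nat.cast_sub hlt.le]
    push_cast
    linarith
  refine ⟨⟨hn, hl, hlt, ?_, ?_, ?_⟩, hE⟩
  · have h1 : 16 * (ℓ : ℝ) ≤ s * ε ^ 2 := (div_le_iff₀ (by positivity)).1 hs
    have h2 : (16 * ℓ * s * n ^ 2 : ℝ) ≤ ((s * n - d - s * e : ℕ) : ℝ) ^ 2 := by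
      calc (16 * ℓ * s * n ^ 2 : ℝ) = 16 * ℓ * (s * n ^ 2) := by ring
        _ ≤ s * ε ^ 2 * (s * n ^ 2) := mul_le_mul_of_nonneg_right h1 (by positivity)
        _ = (ε * (s * n)) ^ 2 := by ring
        _ ≤ _ := pow_le_pow_left₀ hpos.le hE 2
    exact_mod_cast h2
  · intro i hi i' hi' j hj j' hj' h
    obtain ⟨k, hk, hak⟩ := ha.2 ⟨i, hi⟩
    obtain ⟨k', hk', hak'⟩ := ha.2 ⟨i', hi'⟩
    have e1 := instOf_a (γ := γ) (s := s) (d := d) (e := e) (a := a) (y := y) ⟨i, hi⟩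
    have e2 := instOf_a (γ := γ) (s := s) (d := d) (e := e) (a := a) (y := y) ⟨i', hi'⟩
    simp only at e1 e2
    rw [e1, e2, hak, hak'] at h
    change γ ^ j * γ ^ (s * k) = γ ^ j' * γ ^ (s * k') at h
    change j < s at hj
    change j' < s at hj'
    rw [← pow_add, ← pow_add] at h
    have hb : ∀ {j k : ℕ}, j < s → k < (Nat.card F - 1) / s → j + s * k < Nat.card F - 1 := by
      intro j k hj hk
      have h1 : (k + 1) * s ≤ Nat.card F - 1 := (Nat.le_div_iff_mul_le hs0).1 hk
      nlinarith
    have hjk := hγ.pow_inj (hb hj hk) (hb hj' hk') h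
    have hjj : j = j' := by
      have := congrArg (· % s) hjk
      simpa [Nat.add_mul_mod_self_left, Nat.mod_eq_of_lt hj, Nat.mod_eq_of_lt hj'] using this
    have hkk : k = k' := by
      subst hjj
      exact Nat.eq_of_mul_eq_mul_left hs0 (by omega)
    refine ⟨?_, hjj⟩
    have := ha.1 (hak.trans (by rw [hkk, hak'] : γ ^ (s * k) = a ⟨i', hi'⟩))
    exact congrArg Fin.val this
  · intro j hj k hk h
    exact hγ.pow_inj (lt_of_lt_of_le hj hsn) (lt_of_lt_of_le hk hsn) h

end FoldedRS
end

noncomputable section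

namespace FoldedRS

universe u

set_option linter.unusedSectionVars false
set_option linter.unusedSimpArgs false

open Polynomial Module

/-- The running time is bounded by a fixed power of any bound for the memory, the cost of a field
operation and the inverse of the success probability. -/
theorem exists_recover_time : ∃ κ : ℕ, ∀ (F : Type u) [Field F] (I : Inst F) (σ : State F) (M : ℕ),
    Prog.HasInput I σ → σ.time = 0 → σ.Bdd M → fieldOpCost F + 1 ≤ M → I.Z + 2 ≤ M →
    ∀ σ' ∈ (Prog.recover.run σ).support, σ'.time ≤ M ^ κ :=
  ⟨Prog.recoverWt, fun _ _ _ _ _ h h0 hM hF hZ => Prog.recover_time h h0 hM hF hZ⟩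

variable {F : Type u} [Field F] {γ : F} {s d ℓ n : ℕ} {a : Fin n → F} {ε : ℝ}

theorem bdd_inputState {e M : ℕ} {y : Fin n → Fin ℓ → Fin s → F}
    (hM : s + d + n + ℓ + e + 3 ≤ M) : (inputState γ s d ℓ e a y).Bdd M := by
  refine ⟨by omega, fun A i hA => ?_⟩
  simp only [inputState]
  split_ifs with h
  · match i with
    | 0 => exact absurd ⟨h, rfl⟩ hA
    | 1 => change s + 2 ≤ M; omega
    | 2 => change d + 2 ≤ M; omega
    | 3 => change n + 2 ≤ M; omega
    | 4 => change ℓ + 2 ≤ M; omega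
    | 5 => change e + 2 ≤ M; omega
    | i + 6 => change 0 + 2 ≤ M; omega
  · omega

theorem fieldOpCost_le [Finite F] {X : ℝ} (h1 : 1 ≤ X) (hX : Real.logb 2 (Nat.card F) ≤ X) :
    (fieldOpCost F : ℝ) ≤ 9 * X ^ 2 := by
  have h2 : Nat.size (Nat.card F) ≤ Nat.log 2 (Nat.card F) + 1 :=
    Nat.size_le.2 (Nat.lt_pow_succ_log_self (by norm_num) _)
  have h3 : (Nat.log 2 (Nat.card F) : ℝ) ≤ Real.logb 2 (Nat.card F) := by
    exact_mod_cast Real.natLog_le_logb (Nat.card F) 2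
  have h4 : (Nat.size (Nat.card F) : ℝ) ≤ Nat.log 2 (Nat.card F) + 1 := by exact_mod_cast h2
  rw [fieldOpCost]
  push_cast
  calc (1 + (Nat.size (Nat.card F) : ℝ)) ^ 2 ≤ (3 * X) ^ 2 :=
        pow_le_pow_left₀ (by positivity) (by linarith) 2
    _ = _ := by ring

/-- Here `p` stands for the sum of the input parameters, `c` for the cost of a field operation, and
`X` for the base of the time bound. The constants add up because `2 + 9 + 2 ^ 17 + 3 ≤ 2 ^ 18`. -/
theorem memory_le {X Y p c Z : ℝ} (hX : 1 ≤ X) (hY : 0 ≤ Y) (hYX : Y ≤ X) (hp : p ≤ 2 * X)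
    (hc : c ≤ 9 * X ^ 2) (hZ : Z ≤ 2 ^ 17 * Y ^ 31) : p + c + Z + 3 ≤ 2 ^ 18 * X ^ 31 := by
  have p1 : X ≤ X ^ 31 := le_self_pow₀ hX (by norm_num)
  have p2 : X ^ 2 ≤ X ^ 31 := pow_le_pow_right₀ hX (by norm_num)
  have p3 : Y ^ 31 ≤ X ^ 31 := pow_le_pow_left₀ hY hYX 31
  generalize X ^ 31 = U at *
  generalize Y ^ 31 = V at *
  generalize X ^ 2 = W at *
  norm_num at hZ ⊢
  linarith

/-- The encodings that are close to the lists are few. -/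
theorem isListRecoverable_frsCode (hn : 0 < n) (hnq : n ≤ (Nat.card F - 1) / s) (hl : 0 < ℓ)
    (hε : 0 < ε) (hs : 16 * (ℓ : ℝ) / ε ^ 2 ≤ s) (hγ : IsPrimitiveElement γ)
    (ha : IsFoldedDomain γ s a) {C : ℕ} (hC : 16 ≤ C) :
    IsListRecoverable (frsCode γ s d a) (1 - (d : ℝ) / (s * n) - ε) ℓ (listSize C ℓ ε) := by
  classical
  intro S hS
  set α := 1 - (d : ℝ) / (s * n) - ε with hαdef
  rcases lt_or_ge α 0 with hα | hα
  · have : {c | c ∈ frsCode γ s d a ∧ distToLists c S ≤ α} = ∅ := by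
      refine Set.eq_empty_of_forall_notMem fun c hc => ?_
      have h0 : 0 ≤ distToLists c S := by unfold distToLists; positivity
      linarith [hc.2]
    rw [this, Set.encard_empty]
    exact zero_le
  · let y : (i : Fin n) → Fin ℓ ≃ {z // z ∈ S i} := fun i =>
      ((S i).equivFinOfCardEq (hS i)).symm
    obtain ⟨hV, hE⟩ := valid_instOf (d := d) hn hnq hl hε hs hγ ha hα
      (fun i j => (y i j : Fin s → F))
    set I := instOf γ s d ℓ ⌊α * n⌋₊ a (fun i j => (y i j : Fin s → F)) with hI
    have hsub : {c | c ∈ frsCode γ s d a ∧ distToLists c S ≤ α} ⊆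
        (hV.finite_inList.toFinset.image (frsEnc γ s a) : Finset (Fin n → Fin s → F)) := by
      rintro _ ⟨⟨P, hP, rfl⟩, hd⟩
      refine Finset.mem_coe.2 (Finset.mem_image_of_mem _ ?_)
      rw [Set.Finite.mem_toFinset]
      exact (inList_instOf y hn hα P).2 ⟨hP, hd⟩
    refine (Set.encard_le_encard hsub).trans ?_
    rw [Set.encard_coe_eq_coe_finsetCard]
    refine Nat.cast_le.2 (Finset.card_image_le.trans ?_)
    exact hV.card_le_listSize hε hE hC _ fun P hP =>
      hV.finite_inList.mem_toFinset.1 hP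

/-- The program recovers the list. -/
theorem listRecovers_frsCode [Finite F] (hn : 0 < n) (hnq : n ≤ (Nat.card F - 1) / s) (hl : 0 < ℓ)
    (hε : 0 < ε) (hs : 16 * (ℓ : ℝ) / ε ^ 2 ≤ s) (hγ : IsPrimitiveElement γ)
    (ha : IsFoldedDomain γ s a) (hα : 0 ≤ 1 - (d : ℝ) / (s * n) - ε) {C : ℕ} (hC : 16 ≤ C) {κ : ℕ}
    (hκ : ∀ (I : Inst F) (σ : State F) (M : ℕ),
      Prog.HasInput I σ → σ.time = 0 → σ.Bdd M → fieldOpCost F + 1 ≤ M → I.Z + 2 ≤ M →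
      ∀ σ' ∈ (Prog.recover.run σ).support, σ'.time ≤ M ^ κ)
    (hCκ : (2 ^ 18) ^ κ ≤ C) (hCκ' : 31 * κ ≤ C) :
    ListRecovers Prog.recover γ s d a (1 - (d : ℝ) / (s * n) - ε) ℓ (listSize C ℓ ε)
      (timeBound C (Nat.card F) s d n ℓ ε) := by
  classical
  intro S y
  obtain ⟨hV, hE⟩ := valid_instOf (d := d) hn hnq hl hε hs hγ ha hα
    (fun i j => (y i j : Fin s → F))
  have hmem := inList_instOf y hn hα (γ := γ) (d := d) (a := a)
  set α := 1 - (d : ℝ) / (s * n) - ε with hαdef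
  set e := ⌊α * n⌋₊ with he
  set I := instOf γ s d ℓ e a (fun i j => (y i j : Fin s → F)) with hI
  set σ := inputState γ s d ℓ e a (fun i j => (y i j : Fin s → F)) with hσ
  have hin : Prog.HasInput I σ := hasInput_inputState
  have h1 : σ.nat 1 0 = 0 := rfl
  refine ⟨fun σ' hσ' => ⟨?_, ?_⟩, ?_⟩
  · set Y := ((ℓ : ℝ) / ε) ^ (Real.logb 2 (ℓ / ε) / ε) with hY
    have hx1 : 1 ≤ (ℓ : ℝ) / ε := hV.one_le_ratio hε hE
    have hY1 : 1 ≤ Y := Real.one_le_rpow hx1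
      (div_nonneg (Real.logb_nonneg (by norm_num) hx1) hε.le)
    have hlog : 0 ≤ Real.logb 2 (Nat.card F) :=
      Real.logb_nonneg (by norm_num) (by exact_mod_cast Nat.card_pos)
    set X := Real.logb 2 (Nat.card F) + s + d + n + Y with hX
    have hs0 : (0 : ℝ) ≤ s := Nat.cast_nonneg _
    have hd0 : (0 : ℝ) ≤ d := Nat.cast_nonneg _
    have hn0 : (0 : ℝ) ≤ n := Nat.cast_nonneg _
    have hX1 : 1 ≤ X := by linarith
    have hε1 : ε ≤ 1 := hV.eps_le_one hE
    -- The base of the time bound has no term `ℓ` of its own; `16 ℓ ≤ s ε ^ 2` and `ε ≤ 1` let `s`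
    -- account for it.
    have hls : (ℓ : ℝ) ≤ s := by
      have h2 : 16 * (ℓ : ℝ) ≤ s * ε ^ 2 := (div_le_iff₀ (by positivity)).1 hs
      have h3 : (s : ℝ) * ε ^ 2 ≤ s * 1 := mul_le_mul_of_nonneg_left (by nlinarith) hs0
      have h4 : (0 : ℝ) ≤ ℓ := Nat.cast_nonneg _
      linarith
    have hen : (e : ℝ) ≤ n := by exact_mod_cast hV.e_lt.le
    have hZ := hV.Z_le hε hE
    have hF := fieldOpCost_le (F := F) hX1 (by linarith)
    set M := s + d + n + ℓ + e + fieldOpCost F + I.Z + 3 with hM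
    have ht := hκ I σ M hin rfl (bdd_inputState (by omega)) (by omega) (by omega) σ' hσ'
    have hMX : (M : ℝ) ≤ 2 ^ 18 * X ^ 31 := by
      have p5 : (M : ℝ) = s + d + n + ℓ + e + fieldOpCost F + I.Z + 3 := by
        rw [hM]; push_cast; ring
      rw [p5]
      exact memory_le (Y := Y) hX1 (by linarith) (by linarith) (by linarith) hF hZ
    calc (σ'.time : ℝ) ≤ (M : ℝ) ^ κ := by exact_mod_cast ht
      _ ≤ (2 ^ 18 * X ^ 31) ^ κ := pow_le_pow_left₀ (Nat.cast_nonneg _) hMX _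
      _ = (2 ^ 18) ^ κ * X ^ (31 * κ) := by rw [mul_pow, pow_mul]
      _ ≤ C * X ^ C := by
        refine mul_le_mul (by exact_mod_cast hCκ) (pow_le_pow_right₀ hX1 hCκ') (by positivity)
          (Nat.cast_nonneg _)
      _ = _ := rfl
  · obtain ⟨t1, t2⟩ := Prog.recover_sound hV hin h1 σ' hσ'
    have hcard := hV.card_le_listSize hε hE hC
      ((Finset.range (σ'.nat 1 0)).image (I.out σ')) (by
        intro P hP
        obtain ⟨j, hj, rfl⟩ := Finset.mem_image.1 hP
        exact t1 j (Finset.mem_range.1 hj))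
    rwa [Finset.card_image_of_injOn (by simpa using t2), Finset.card_range] at hcard
  · refine (Prog.recover_complete hV hin h1).trans (MeasureTheory.measure_mono ?_)
    intro σ' hσ' P hP hdist
    exact hσ' P ((hmem P).2 ⟨hP, hdist⟩)

end FoldedRS
end

theorem theorem3p1 :
    ∃ (C : ℕ) (p : FoldedRS.Prog),
      ∀ (F : Type*) [Field F] [Finite F] (q s d n ℓ : ℕ) (ε : ℝ) (γ : F) (a : Fin n → F),
        Nat.card F = q → 0 < n → n ≤ (q - 1) / s → 0 < ℓ → 0 < ε →
        16 * (ℓ : ℝ) / ε ^ 2 ≤ s →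
        FoldedRS.IsPrimitiveElement γ → FoldedRS.IsFoldedDomain γ s a →
        FoldedRS.IsListRecoverable (FoldedRS.frsCode γ s d a)
          (1 - (d : ℝ) / (s * n) - ε) ℓ (FoldedRS.listSize C ℓ ε) ∧
        (0 ≤ 1 - (d : ℝ) / (s * n) - ε →
          FoldedRS.ListRecovers p γ s d a (1 - (d : ℝ) / (s * n) - ε) ℓ
            (FoldedRS.listSize C ℓ ε) (FoldedRS.timeBound C q s d n ℓ ε)) := by
  obtain ⟨κ, hκ⟩ := FoldedRS.exists_recover_time
  obtain ⟨B, hB⟩ : ∃ B : ℕ, (2 ^ 18) ^ κ ≤ B := ⟨_, le_rfl⟩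
  -- The time is at most `(2 ^ 18 * X ^ 31) ^ κ`, so `B` covers the factor and `31 * κ` the
  -- exponent, while `16` is needed for the list size.
  refine ⟨B + 31 * κ + 16, FoldedRS.Prog.recover, ?_⟩
  rintro F _ _ q s d n ℓ ε γ a rfl hn hnq hl hε hs hγ ha
  exact ⟨FoldedRS.isListRecoverable_frsCode hn hnq hl hε hs hγ ha (by omega), fun hα =>
    FoldedRS.listRecovers_frsCode hn hnq hl hε hs hγ ha hα (by omega) (hκ F)
      (hB.trans (by omega)) (by omega)⟩
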